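/- For $m\in\mathbb{R}$ let $\mathcal{S}^m$ be the set of $C^\infty$ functions $a$ on $\mathbb{R}^n\times\mathbb{R}^n$ such that for all multi-indices $\alpha,\beta$ there is $C_{\alpha,\beta}$ with $|\partial_x^\alpha\partial_\xi^\beta a(x,\xi)|\le C_{\alpha,\beta}(1+|x|)^{m-|\alpha|}$ for all $x,\xi$. A symbol $a$ is compactly supported in $\xi$ if there is a compact $K\subset\mathbb{R}^n$ with $a(x,\xi)=0$ for all $x$ whenever $\xi\notin K$. Put $\hat u(\xi)=(2\pi)^{-n/2}\int e^{-i\langle x,\xi\rangle}u(x)\,dx$, $$(a(x,D)u)(x)=(2\pi)^{-n/2}\int e^{i\langle x,\xi\rangle}a(x,\xi)\hat u(\xi)\,d\xi,\qquad J(\Phi,a)=(e^{i\Phi}a)(x,D),$$ and $D^\alpha=(-i)^{|\alpha|}\partial^\alpha$. **Theorem.** Let $\epsilon>0$, $m_a,m_b\in\mathbb{R}$, let $\Phi\in\mathcal{S}^{1-\epsilon}$ be real-valued, and let $a\in\mathcal{S}^{m_a}$, $b\in\mathcal{S}^{m_b}$ be complex-valued and compactly supported in $\xi$. Set $m_d=m_a+m_b$,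 $$r(x,y,\eta)=\int_0^1(\nabla_x\Phi)((1-\tau)x+\tau y,\eta)\,d\tau,\qquad p(z,\zeta;x,\eta)=b(x,\eta+\zeta+r(x,x+z,\eta))\,a(x+z,\eta),$$ $$d_\alpha(x,\eta)=(\partial_\zeta^\alpha D_z^\alpha p)(0,0;x,\eta).$$ Then there exists $d\in\mathcal{S}^{m_d}$, compactly supported in $\xi$, such that $$b(x,D)J(\Phi,a)=J(\Phi,d)$$ as operators on the Schwartz space (which $J(\Phi,a)$ maps into itself), and such that $d$ has the asymptotic expansion $d\sim\sum_{\alpha}\frac1{\alpha!}d_\alpha$, that is, for every $N\in\{0,1,2,\dots\}$, $$d-\sum_{|\alpha|<N}\frac1{\alpha!}d_\alpha\in\mathcal{S}^{m_d-N}.$$ Moreover $d_\alpha\in\mathcal{S}^{m_d-|\alpha|}$ for every $\alpha$, $$d_0(x,\eta)=b(x,\eta+\nabla_x\Phi(x,\eta))\,a(x,\eta),$$ and for $|\alpha|=1$ $$d_\alpha(x,\eta)=(\partial_\eta^\alpha b)(x,\eta+\nabla_x\Phi(x,\eta))\,(D_x^\alpha a)(x,\eta)+\Big\langle(\nabla_\eta\partial_\eta^\alpha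 b)(x,\eta+\nabla_x\Phi(x,\eta)),\tfrac12(\nabla_xD_x^\alpha\Phi)(x,\eta)\Big\rangle a(x,\eta),$$ where $\langle v,w\rangle=\sum_k v_kw_k$ is the bilinear pairing. -/

import Mathlib

open scoped ContDiff SchwartzMap

noncomputable section

namespace OscSymbol

variable {n : ℕ}
variable {F : Type*} [NormedAddCommGroup F] [NormedSpace ℝ F]

/-- The partial derivative `∂_j f`. -/
def partialDeriv (j : Fin n) (f : EuclideanSpace ℝ (Fin n) → F) :
    EuclideanSpace ℝ (Fin n) → F :=
  fun x => fderiv ℝ f x (EuclideanSpace.single j 1)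

/-- The derivative `∂^α = ∂_0^(α 0) ⋯ ∂_(n-1)^(α (n-1))` for a multi-index `α`. -/
def multiDeriv (α : Fin n → ℕ) (f : EuclideanSpace ℝ (Fin n) → F) :
    EuclideanSpace ℝ (Fin n) → F :=
  (List.finRange n).foldr (fun j g => (partialDeriv j)^[α j] g) f

/-- `|α|`. -/
def order (α : Fin n → ℕ) : ℕ := ∑ j, α j

/-- `α!`. -/
def multiFactorial (α : Fin n → ℕ) : ℕ := ∏ j, (α j).factorial

/-- `D^α = (-i)^|α| ∂^α`. -/
def multiD (α : Fin n → ℕ) (f : EuclideanSpace ℝ (Fin n) → ℂ) :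
    EuclideanSpace ℝ (Fin n) → ℂ :=
  fun x => (-Complex.I) ^ order α * multiDeriv α f x

/-- The class `S^m`: smooth functions `a` of `(x, ξ)` with
`|∂_x^α ∂_ξ^β a (x, ξ)| ≤ C_{α, β} (1 + |x|)^(m - |α|)` for all multi-indices. -/
def IsSymbol (m : ℝ)
    (a : EuclideanSpace ℝ (Fin n) → EuclideanSpace ℝ (Fin n) → F) : Prop :=
  ContDiff ℝ ∞ (Function.uncurry a) ∧
    ∀ α β : Fin n → ℕ, ∃ C : ℝ, ∀ x ξ : EuclideanSpace ℝ (Fin n),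
      ‖multiDeriv α (fun y => multiDeriv β (a y) ξ) x‖ ≤ C * (1 + ‖x‖) ^ (m - order α)

/-- `a (x, ξ)` vanishes for all `x` when `ξ` is outside some fixed compact set. -/
def CompactSupportInXi
    (a : EuclideanSpace ℝ (Fin n) → EuclideanSpace ℝ (Fin n) → ℂ) : Prop :=
  ∃ K : Set (EuclideanSpace ℝ (Fin n)), IsCompact K ∧ ∀ x, ∀ ξ, ξ ∉ K → a x ξ = 0

/-- The unitary Fourier transform `û(ξ) = (2π)^(-n/2) ∫ e^{-i⟨x, ξ⟩} u(x) dx`. -/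
def fourierU (u : EuclideanSpace ℝ (Fin n) → ℂ) (ξ : EuclideanSpace ℝ (Fin n)) : ℂ :=
  (((2 * Real.pi) ^ (-(n : ℝ) / 2) : ℝ) : ℂ) *
    ∫ x : EuclideanSpace ℝ (Fin n), Complex.exp (-Complex.I * (inner ℝ x ξ : ℝ)) * u x

/-- `(a(x, D)u)(x) = (2π)^(-n/2) ∫ e^{i⟨x, ξ⟩} a(x, ξ) û(ξ) dξ`. -/
def pdo (a : EuclideanSpace ℝ (Fin n) → EuclideanSpace ℝ (Fin n) → ℂ)
    (u : EuclideanSpace ℝ (Fin n) → ℂ) (x : EuclideanSpace ℝ (Fin n)) : ℂ :=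
  (((2 * Real.pi) ^ (-(n : ℝ) / 2) : ℝ) : ℂ) *
    ∫ ξ : EuclideanSpace ℝ (Fin n),
      Complex.exp (Complex.I * (inner ℝ x ξ : ℝ)) * a x ξ * fourierU u ξ

/-- `J(Φ, a) = (e^{iΦ} a)(x, D)`. -/
def oscPdo (Φ : EuclideanSpace ℝ (Fin n) → EuclideanSpace ℝ (Fin n) → ℝ)
    (a : EuclideanSpace ℝ (Fin n) → EuclideanSpace ℝ (Fin n) → ℂ)
    (u : EuclideanSpace ℝ (Fin n) → ℂ) : EuclideanSpace ℝ (Fin n) → ℂ :=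
  pdo (fun x ξ => Complex.exp (Complex.I * (Φ x ξ : ℂ)) * a x ξ) u

/-- `(∇_x Φ)(x, η)`. -/
def gradX (Φ : EuclideanSpace ℝ (Fin n) → EuclideanSpace ℝ (Fin n) → ℝ)
    (x η : EuclideanSpace ℝ (Fin n)) : EuclideanSpace ℝ (Fin n) :=
  gradient (fun y => Φ y η) x

/-- `r(x, y, η) = ∫_0^1 (∇_x Φ)((1 - τ) x + τ y, η) dτ`. -/
def meanGrad (Φ : EuclideanSpace ℝ (Fin n) → EuclideanSpace ℝ (Fin n) → ℝ)
    (x y η : EuclideanSpace ℝ (Fin n)) : EuclideanSpace ℝ (Fin n) :=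
  ∫ τ in (0 : ℝ)..1, gradX Φ ((1 - τ) • x + τ • y) η

/-- `p(z, ζ; x, η) = b(x, η + ζ + r(x, x + z, η)) a(x + z, η)`. -/
def amplitude (Φ : EuclideanSpace ℝ (Fin n) → EuclideanSpace ℝ (Fin n) → ℝ)
    (a b : EuclideanSpace ℝ (Fin n) → EuclideanSpace ℝ (Fin n) → ℂ)
    (z ζ x η : EuclideanSpace ℝ (Fin n)) : ℂ :=
  b x (η + ζ + meanGrad Φ x (x + z) η) * a (x + z) η

/-- `d_α(x, η) = (∂_ζ^α D_z^α p)(0, 0; x, η)`. -/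
def expansionTerm (Φ : EuclideanSpace ℝ (Fin n) → EuclideanSpace ℝ (Fin n) → ℝ)
    (a b : EuclideanSpace ℝ (Fin n) → EuclideanSpace ℝ (Fin n) → ℂ)
    (α : Fin n → ℕ) (x η : EuclideanSpace ℝ (Fin n)) : ℂ :=
  multiDeriv α (fun ζ => multiD α (fun z => amplitude Φ a b z ζ x η) 0) 0

/-- The asymptotic expansion `d = ∑_α (1/α!) d_α` in `S^m`: for every `N`, the difference of `d`
and the finite sum over `|α| < N` belongs to `S^(m - N)`. -/
def HasSymbolExpansion (m : ℝ)
    (d : EuclideanSpace ℝ (Fin n) → EuclideanSpace ℝ (Fin n) → ℂ)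
    (c : (Fin n → ℕ) → EuclideanSpace ℝ (Fin n) → EuclideanSpace ℝ (Fin n) → ℂ) : Prop :=
  ∀ N : ℕ, IsSymbol (m - N) (fun x η =>
    d x η - ∑ k ∈ Finset.range N, ∑ α ∈ Finset.piAntidiag (Finset.univ : Finset (Fin n)) k,
      (1 / (multiFactorial α : ℂ)) * c α x η)

end OscSymbol

end

/-!
# Composition of a pseudodifferential operator with an oscillatory operator

Write `⟨x⟩ = 1 + |x|`. The kernel of `b(x, D)` is `β(x, z) = ∫ e^{-i⟨z, ξ⟩} b(x, ξ) dξ`, up to a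
constant and the translation `y = x + z`. Inserting the integral for `J(Φ, a) u` and pulling the
factor `e^{i(⟨x, η⟩ + Φ(x, η))}` out leaves `e^{i⟨z, η⟩}` and the exponential of `i` times the phase
increment `Φ(x + z, η) - Φ(x, η)`, which is `⟨z, r(x, x + z, η)⟩` by the fundamental theorem of
calculus (`inner_meanGrad`). The substitution `ξ = η + ζ + r` (`oscFactor_mul_oscInt`) then shows
that the composition is `J(Φ, d)` with `d = (2π)^(-n) ∬ e^{-i⟨z, ζ⟩} p(z, ζ; x, η) dζ dz`
(`compSymbol`, `pdo_oscPdo`). The inner integral has compact support in `ζ` and decreases rapidly in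
`z` by partial integration (`norm_oscInt_le`), so all integrals converge and can be exchanged.

For the expansion, dilate the amplitude to `p(tz, ζ; x, η)` and let `G(x, η, t)` be the iterated
integral. A derivative in `t` produces a factor `z` and a derivative of `p` in `z`. The latter falls
on `Φ` and `a` at the point `x + z`, or on segments ending there, and gains a factor `⟨x⟩⁻¹` at the
price of powers of `⟨z⟩` (Peetre's inequality, `peetre`), which are harmless. Hence Taylor expansion
in `t` at `0`, evaluated at `t = 1`, is an expansion in decreasing order (`mem_taylor_remainder`).
The Taylor coefficients are computed from `z^α e^{-i⟨z, ζ⟩} = (i∂_ζ)^α e^{-i⟨z, ζ⟩}` and Fourier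
inversion: they are the sums of `d_α / α!` over `|α| = k` (`iterate_dirD_iterInt`). The symbol
estimates use the phase only as a member of `S^1`; that it lies in `S^(1-ε)` matters for the
invariance of the Schwartz space, where each integration by parts in `ξ` gains `⟨x⟩^(-ε)`
(`norm_oscTransform_le`).

All symbol estimates, in the variables `x`, `η`, `z`, `ζ`, `t` or some of them, are instances of one
notion, `SymbolScale`: directions of differentiation, the change of the order caused by each of
them, and a zeroth-order estimate. Membership is proved by coinduction (`SymbolScale.Mem.coinduct`):
a family of functions that satisfies the zeroth-order estimates and is closed, up to finite sums,
under the derivatives of the scale lies in the symbol classes. Products, compositions and integrals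
depending on parameters are all handled in this way.
-/

noncomputable section

namespace OscSymbol

/-! ### Directional derivatives -/

section DirectionalDerivatives

variable {V V' F F' : Type*} [NormedAddCommGroup V] [NormedSpace ℝ V]
  [NormedAddCommGroup V'] [NormedSpace ℝ V'] [NormedAddCommGroup F] [NormedSpace ℝ F]
  [NormedAddCommGroup F'] [NormedSpace ℝ F']

/-- The directional derivative of `f` along the constant vector field `v`. -/
def dirD (v : V) (f : V → F) : V → F := fun p => fderiv ℝ f p v

lemma contDiff_dirD {f : V → F} (hf : ContDiff ℝ ∞ f) (v : V) : ContDiff ℝ ∞ (dirD v f) :=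
  (hf.fderiv_right (m := ∞) le_rfl).clm_apply contDiff_const

lemma differentiable_of_smooth {f : V → F} (hf : ContDiff ℝ ∞ f) : Differentiable ℝ f :=
  hf.differentiable (by simp)

lemma dirD_zero (v : V) : dirD v (0 : V → F) = 0 := by
  funext p; simp [dirD]

lemma dirD_const (v : V) (c : F) : dirD v (fun _ : V => c) = 0 := by
  funext p; simp [dirD]

lemma dirD_add {f g : V → F} (hf : ContDiff ℝ ∞ f) (hg : ContDiff ℝ ∞ g) (v : V) :
    dirD v (f + g) = dirD v f + dirD v g := by
  funext p
  simp only [dirD, Pi.add_apply]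
  rw [fderiv_add (differentiable_of_smooth hf p) (differentiable_of_smooth hg p)]
  rfl

lemma dirD_finsetSum {ι : Type*} (s : Finset ι) {f : ι → V → F}
    (hf : ∀ i ∈ s, ContDiff ℝ ∞ (f i)) (v : V) :
    dirD v (fun p => ∑ i ∈ s, f i p) = fun p => ∑ i ∈ s, dirD v (f i) p := by
  funext p
  simp only [dirD]
  rw [fderiv_fun_sum (fun i hi => differentiable_of_smooth (hf i hi) p)]
  simp

lemma dirD_mul {f g : V → ℂ} (hf : ContDiff ℝ ∞ f) (hg : ContDiff ℝ ∞ g) (v : V) :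
    dirD v (f * g) = dirD v f * g + f * dirD v g := by
  funext p
  simp only [dirD, Pi.add_apply, Pi.mul_apply]
  rw [fderiv_mul (differentiable_of_smooth hf p) (differentiable_of_smooth hg p)]
  simp; ring

lemma dirD_const_mul {f : V → ℂ} (hf : ContDiff ℝ ∞ f) (c : ℂ) (v : V) :
    dirD v (fun p => c * f p) = fun p => c * dirD v f p := by
  funext p
  simp only [dirD]
  rw [fderiv_const_mul (differentiable_of_smooth hf p)]
  simp

/-- Chain rule for the directional derivative of a composition. -/
lemma dirD_comp {f : V' → F} {S : V → V'} (hf : ContDiff ℝ ∞ f) (hS : ContDiff ℝ ∞ S)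
    (v : V) (p : V) : dirD v (fun q => f (S q)) p = fderiv ℝ f (S p) (dirD v S p) := by
  have := fderiv_comp p (differentiable_of_smooth hf (S p)) (differentiable_of_smooth hS p)
  simp only [dirD]
  rw [show (fun q => f (S q)) = f ∘ S from rfl, this]; rfl

lemma dirD_comp_const {f : V' → F} {S : V → V'} (hf : ContDiff ℝ ∞ f) (hS : ContDiff ℝ ∞ S)
    {v : V} {w : V'} (h : ∀ p, dirD v S p = w) :
    dirD v (fun q => f (S q)) = fun q => dirD w f (S q) := by
  funext p
  rw [dirD_comp hf hS, h p]; rfl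

lemma dirD_clm {f : V → F} (hf : ContDiff ℝ ∞ f) (L : F →L[ℝ] F') (v : V) :
    dirD v (fun p => L (f p)) = fun p => L (dirD v f p) := by
  funext p
  rw [dirD_comp L.contDiff hf]
  simp

lemma dirD_comm {f : V → F} (hf : ContDiff ℝ ∞ f) (v w : V) :
    dirD v (dirD w f) = dirD w (dirD v f) := by
  funext p
  have h1 : ∀ v w : V, dirD v (dirD w f) p = fderiv ℝ (fderiv ℝ f) p v w := by
    intro v w
    change fderiv ℝ (fun q => fderiv ℝ f q w) p v = _
    have hd : DifferentiableAt ℝ (fderiv ℝ f) p :=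
      differentiable_of_smooth (hf.fderiv_right (m := ∞) le_rfl) p
    rw [fderiv_clm_apply hd (differentiableAt_const _)]
    simp
  rw [h1, h1]
  have : IsSymmSndFDerivAt ℝ f p :=
    (hf.contDiffAt (x := p)).isSymmSndFDerivAt
      (by
          rw [minSmoothness_of_isRCLikeNormedField]
          exact WithTop.coe_le_coe.2 (le_top : (2 : ℕ∞) ≤ ⊤))
  exact this v w

variable {n : ℕ}

/-- Iterated directional derivatives: `dirD (e j)` is applied `α j` times, for every `j`. -/
def multiDir (e : Fin n → V) (α : Fin n → ℕ) (f : V → F) : V → F :=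
  (List.finRange n).foldr (fun j g => (dirD (e j))^[α j] g) f

/-- The partial derivatives are directional derivatives, so that `∂^α` transforms under a change of
variables by the rules for `multiDir`. -/
lemma multiDeriv_eq_multiDir (α : Fin n → ℕ) (f : EuclideanSpace ℝ (Fin n) → F) :
    multiDeriv α f = multiDir (fun j => EuclideanSpace.single j 1) α f := rfl

/-- Induction principle for `multiDir`: a relation between smooth functions on two spaces that is
preserved by each pair of directional derivatives is preserved by `multiDir`. -/
lemma multiDir_rel {e : Fin n → V} {e' : Fin n → V'} (R : (V → F) → (V' → F') → Prop)
    (hR : ∀ j f g, R f g → R (dirD (e j) f) (dirD (e' j) g)) (α : Fin n → ℕ)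
    {f : V → F} {g : V' → F'} (h : R f g) : R (multiDir e α f) (multiDir e' α g) := by
  unfold multiDir
  generalize List.finRange n = l
  induction l with
  | nil => exact h
  | cons j l ih =>
    simp only [List.foldr_cons]
    generalize α j = k
    induction k with
    | zero => exact ih
    | succ k ihk =>
      rw [Function.iterate_succ_apply', Function.iterate_succ_apply']
      exact hR _ _ _ ihk

lemma multiDir_pred {e : Fin n → V} (R : (V → F) → Prop)
    (hR : ∀ j f, R f → R (dirD (e j) f)) (α : Fin n → ℕ)
    {f : V → F} (h : R f) : R (multiDir e α f) :=
  multiDir_rel (e := e) (e' := e) (fun f _ => R f) (fun j f (_ : V → F) => hR j f) α (g := f) h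

lemma contDiff_multiDir {f : V → F} (hf : ContDiff ℝ ∞ f) (e : Fin n → V) (α : Fin n → ℕ) :
    ContDiff ℝ ∞ (multiDir e α f) :=
  multiDir_pred (fun f => ContDiff ℝ ∞ f) (fun _ _ h => contDiff_dirD h _) α hf

lemma multiDir_comp {f : V' → F} {S : V → V'} (hf : ContDiff ℝ ∞ f) (hS : ContDiff ℝ ∞ S)
    {e : Fin n → V} {e' : Fin n → V'} (h : ∀ j p, dirD (e j) S p = e' j) (α : Fin n → ℕ) :
    multiDir e α (fun q => f (S q)) = fun q => multiDir e' α f (S q) := by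
  refine (multiDir_rel (e := e) (e' := e')
    (fun g f => ContDiff ℝ ∞ f ∧ g = fun q => f (S q)) ?_ α ⟨hf, rfl⟩).2
  rintro j g f ⟨hf, rfl⟩
  exact ⟨contDiff_dirD hf _, dirD_comp_const hf hS (h j)⟩

lemma multiDir_clm {f : V → F} (hf : ContDiff ℝ ∞ f) (L : F →L[ℝ] F') (e : Fin n → V)
    (α : Fin n → ℕ) :
    multiDir e α (fun p => L (f p)) = fun p => L (multiDir e α f p) := by
  refine (multiDir_rel (e := e) (e' := e)
    (fun g f => ContDiff ℝ ∞ f ∧ g = fun q => L (f q)) ?_ α ⟨hf, rfl⟩).2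
  rintro j g f ⟨hf, rfl⟩
  exact ⟨contDiff_dirD hf _, dirD_clm hf L _⟩

lemma multiDir_dirD_comm {f : V → F} (hf : ContDiff ℝ ∞ f) (e : Fin n → V) (v : V)
    (α : Fin n → ℕ) : multiDir e α (dirD v f) = dirD v (multiDir e α f) := by
  refine (multiDir_rel (e := e) (e' := e)
    (fun g f => ContDiff ℝ ∞ f ∧ g = dirD v f) ?_ α ⟨hf, rfl⟩).2
  rintro j g f ⟨hf, rfl⟩
  exact ⟨contDiff_dirD hf _, dirD_comm hf _ _⟩

lemma dirD_iterate_comm {f : V → F} (hf : ContDiff ℝ ∞ f) (v w : V) (k : ℕ) :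
    (dirD v)^[k] (dirD w f) = dirD w ((dirD v)^[k] f) ∧ ContDiff ℝ ∞ ((dirD v)^[k] f) := by
  induction k with
  | zero => exact ⟨rfl, hf⟩
  | succ k ih =>
    simp only [Function.iterate_succ_apply']
    exact ⟨by rw [ih.1, dirD_comm ih.2], contDiff_dirD ih.2 _⟩

/-- `∂^α ∂_j = ∂^(α + e_j)` on smooth functions. -/
lemma multiDir_dirD_eq {f : V → F} (hf : ContDiff ℝ ∞ f) (e : Fin n → V)
    (α : Fin n → ℕ) (j : Fin n) :
    multiDir e α (dirD (e j) f) = multiDir e (α + Pi.single j 1) f := by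
  unfold multiDir
  have key : ∀ l : List (Fin n), l.Nodup →
      ContDiff ℝ ∞ (l.foldr (fun j g => (dirD (e j))^[α j] g) f) ∧
      l.foldr (fun j g => (dirD (e j))^[α j] g) (dirD (e j) f) =
        dirD (e j) (l.foldr (fun j g => (dirD (e j))^[α j] g) f) ∧
      (l.foldr (fun i g => (dirD (e i))^[(α + Pi.single j 1 : Fin n → ℕ) i] g) f =
        if j ∈ l then dirD (e j) (l.foldr (fun j g => (dirD (e j))^[α j] g) f)
        else l.foldr (fun j g => (dirD (e j))^[α j] g) f) := by
    intro l
    induction l with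
    | nil => intro _; exact ⟨hf, rfl, by simp⟩
    | cons i l ih =>
      intro hl
      obtain ⟨h1, h2, h3⟩ := ih (List.nodup_cons.1 hl).2
      have hi := (List.nodup_cons.1 hl).1
      simp only [List.foldr_cons]
      have hc := dirD_iterate_comm h1 (e i) (e j) (α i)
      refine ⟨hc.2, by rw [h2, hc.1], ?_⟩
      rw [h3]
      by_cases hij : i = j
      · subst hij
        simp [hi, Function.iterate_succ_apply']
      · have hij' : j ≠ i := fun h => hij h.symm
        by_cases hj : j ∈ l
        · simp [hj, hij, hc.1]
        · simp [hj, hij, hij']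
  obtain ⟨_, h2, h3⟩ := key (List.finRange n) (List.nodup_finRange n)
  rw [h2, h3]; simp

lemma multiDir_zero (e : Fin n → V) (f : V → F) : multiDir e 0 f = f := by
  unfold multiDir
  generalize List.finRange n = l
  induction l with
  | nil => rfl
  | cons j l ih => simp

lemma multiDir_single (e : Fin n → V) {f : V → F} (hf : ContDiff ℝ ∞ f) (j : Fin n) :
    multiDir e (Pi.single j 1) f = dirD (e j) f := by
  have := multiDir_dirD_eq hf e 0 j
  rw [multiDir_zero, zero_add] at this
  exact this.symm

end DirectionalDerivatives

/-! ### Scales of symbol classes -/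

section Scales

variable {ι ι' V V' M M' : Type*} [NormedAddCommGroup V] [NormedSpace ℝ V]
  [NormedAddCommGroup V'] [NormedSpace ℝ V'] [AddCommMonoid M] [AddCommMonoid M']

/-- A scale of symbol classes on `V`: a family `dir` of directions of differentiation, the change
`shift i` of the order caused by the derivative in direction `dir i`, and the zeroth-order estimate
`bound m f` that a function of order `m` has to satisfy. Orders live in an additive monoid, since
several weights are tracked at the same time. -/
structure SymbolScale (ι V M : Type*) [NormedAddCommGroup V] [NormedSpace ℝ V]
    [AddCommMonoid M] where
  dir : ι → V
  shift : ι → M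
  bound : M → (V → ℂ) → Prop
  bound_zero : ∀ m, bound m 0
  bound_add : ∀ m f g, bound m f → bound m g → bound m (f + g)

namespace SymbolScale

variable (S : SymbolScale ι V M) (S' : SymbolScale ι' V' M')

/-- The estimates of order `m` hold for all iterated derivatives of length at most `N`. -/
def HasOrder : ℕ → M → (V → ℂ) → Prop
  | 0, m, f => S.bound m f
  | N + 1, m, f => S.bound m f ∧ ∀ i, HasOrder N (m + S.shift i) (dirD (S.dir i) f)

/-- The symbol class of order `m`: smooth functions all of whose iterated derivatives in the
directions of the scale satisfy the estimates of the shifted order. -/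
def Mem (m : M) (f : V → ℂ) : Prop := ContDiff ℝ ∞ f ∧ ∀ N, S.HasOrder N m f

variable {S S'}

lemma Mem.bound {m : M} {f : V → ℂ} (h : S.Mem m f) : S.bound m f := h.2 0

lemma Mem.dirD {m : M} {f : V → ℂ} (h : S.Mem m f) (i : ι) :
    S.Mem (m + S.shift i) (dirD (S.dir i) f) :=
  ⟨contDiff_dirD h.1 _, fun N => (h.2 (N + 1)).2 i⟩

lemma HasOrder.zero (N : ℕ) (m : M) : S.HasOrder N m 0 := by
  induction N generalizing m with
  | zero => exact S.bound_zero m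
  | succ N ih => exact ⟨S.bound_zero m, fun i => by rw [dirD_zero]; exact ih _⟩

lemma HasOrder.add {N : ℕ} {m : M} {f g : V → ℂ} (hf : ContDiff ℝ ∞ f) (hg : ContDiff ℝ ∞ g)
    (h : S.HasOrder N m f) (h' : S.HasOrder N m g) : S.HasOrder N m (f + g) := by
  induction N generalizing m f g with
  | zero => exact S.bound_add m f g h h'
  | succ N ih =>
    refine ⟨S.bound_add m f g h.1 h'.1, fun i => ?_⟩
    rw [dirD_add hf hg]
    exact ih (contDiff_dirD hf _) (contDiff_dirD hg _) (h.2 i) (h'.2 i)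

lemma Mem.zero (m : M) : S.Mem m 0 := ⟨contDiff_const, fun N => HasOrder.zero N m⟩

lemma Mem.add {m : M} {f g : V → ℂ} (h : S.Mem m f) (h' : S.Mem m g) : S.Mem m (f + g) :=
  ⟨h.1.add h'.1, fun N => (h.2 N).add h.1 h'.1 (h'.2 N)⟩

/-- Coinduction up to finite sums: a predicate that implies smoothness and the zeroth-order
estimate, and that is preserved by the derivatives of the scale up to finite sums, implies
membership in the symbol class. -/
theorem Mem.coinduct (P : M → (V → ℂ) → Prop)
    (hs : ∀ m f, P m f → ContDiff ℝ ∞ f) (hb : ∀ m f, P m f → S.bound m f)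
    (hd : ∀ m f, P m f → ∀ i,
      OscSymbol.dirD (S.dir i) f ∈ AddSubmonoid.closure {g | P (m + S.shift i) g})
    {m : M} {f : V → ℂ} (h : P m f) : S.Mem m f := by
  have key : ∀ N m, ∀ f ∈ AddSubmonoid.closure {g | P m g},
      ContDiff ℝ ∞ f ∧ S.HasOrder N m f := by
    intro N
    induction N with
    | zero =>
      intro m f hf
      induction hf using AddSubmonoid.closure_induction with
      | mem f hf => exact ⟨hs _ _ hf, hb _ _ hf⟩
      | zero => exact ⟨contDiff_const, HasOrder.zero 0 m⟩
      | add f g _ _ h1 h2 => exact ⟨h1.1.add h2.1, h1.2.add h1.1 h2.1 h2.2⟩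
    | succ N ih =>
      intro m f hf
      induction hf using AddSubmonoid.closure_induction with
      | mem f hf => exact ⟨hs _ _ hf, hb _ _ hf, fun i => (ih _ _ (hd _ _ hf i)).2⟩
      | zero => exact ⟨contDiff_const, HasOrder.zero _ m⟩
      | add f g _ _ h1 h2 => exact ⟨h1.1.add h2.1, h1.2.add h1.1 h2.1 h2.2⟩
  exact ⟨hs _ _ h, fun N => (key N m f (AddSubmonoid.subset_closure h)).2⟩

/-- The zeroth-order estimates are multiplicative, and constants have order zero. -/
structure IsMultiplicative (S : SymbolScale ι V M) : Prop where
  one : ∀ c : ℂ, S.bound 0 (fun _ => c)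
  mul : ∀ m m' f g, S.bound m f → S.bound m' g → S.bound (m + m') (f * g)

lemma Mem.const (hS : S.IsMultiplicative) (c : ℂ) : S.Mem 0 (fun _ => c) := by
  refine ⟨contDiff_const, fun N => ?_⟩
  cases N with
  | zero => exact hS.one c
  | succ N => exact ⟨hS.one c, fun i => by rw [dirD_const]; exact HasOrder.zero _ _⟩

lemma Mem.mul (hS : S.IsMultiplicative) {m m' : M} {f g : V → ℂ} (hf : S.Mem m f)
    (hg : S.Mem m' g) : S.Mem (m + m') (f * g) := by
  refine Mem.coinduct (fun k h => ∃ m m' f g, m + m' = k ∧ S.Mem m f ∧ S.Mem m' g ∧ h = f * g)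
    ?_ ?_ ?_ ⟨m, m', f, g, rfl, hf, hg, rfl⟩
  · rintro _ _ ⟨m, m', f, g, rfl, hf, hg, rfl⟩
    exact hf.1.mul hg.1
  · rintro _ _ ⟨m, m', f, g, rfl, hf, hg, rfl⟩
    exact hS.mul _ _ _ _ hf.bound hg.bound
  · rintro _ _ ⟨m, m', f, g, rfl, hf, hg, rfl⟩ i
    rw [dirD_mul hf.1 hg.1]
    refine add_mem (AddSubmonoid.subset_closure ?_) (AddSubmonoid.subset_closure ?_)
    · exact ⟨_, _, _, _, by abel, hf.dirD i, hg, rfl⟩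
    · exact ⟨_, _, _, _, by abel, hf, hg.dirD i, rfl⟩

/-- Composition `f ∘ T`. The functions `c k i` are the coefficients of the chain rule: each of
them is zero or has the order that compensates the difference of the shifts of the two scales. -/
theorem Mem.comp [Fintype ι] (hS' : S'.IsMultiplicative) (φ : M →+ M') {T : V' → V}
    (hT : ContDiff ℝ ∞ T)
    (hb : ∀ m f, S.bound m f → S'.bound (φ m) (fun q => f (T q)))
    (c : ι' → ι → V' → ℝ)
    (hc : ∀ k q, OscSymbol.dirD (S'.dir k) T q = ∑ i, c k i q • S.dir i)
    (hc' : ∀ k i, (∀ q, c k i q = 0) ∨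
      ∃ e, e + φ (S.shift i) = S'.shift k ∧ S'.Mem e (fun q => (c k i q : ℂ)))
    {m : M} {f : V → ℂ} (hf : S.Mem m f) : S'.Mem (φ m) (fun q => f (T q)) := by
  refine Mem.coinduct (fun k h => ∃ e m u f, e + φ m = k ∧ S'.Mem e u ∧ S.Mem m f ∧
    h = u * fun q => f (T q)) ?_ ?_ ?_ ⟨0, m, fun _ => 1, f, by simp, Mem.const hS' 1, hf, ?_⟩
  · rintro _ _ ⟨e, m, u, f, rfl, hu, hf, rfl⟩
    exact hu.1.mul (hf.1.comp hT)
  · rintro _ _ ⟨e, m, u, f, rfl, hu, hf, rfl⟩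
    exact hS'.mul _ _ _ _ hu.bound (hb _ _ hf.bound)
  · rintro _ _ ⟨e, m, u, f, rfl, hu, hf, rfl⟩ k
    have hD : OscSymbol.dirD (S'.dir k) (fun q => f (T q)) =
        ∑ i, (fun q => (c k i q : ℂ)) * fun q => OscSymbol.dirD (S.dir i) f (T q) := by
      funext q
      rw [dirD_comp hf.1 hT, hc, map_sum, Finset.sum_apply]
      refine Finset.sum_congr rfl fun i _ => ?_
      simp [OscSymbol.dirD]
    have hfT : ContDiff ℝ ∞ (fun q => f (T q)) := hf.1.comp hT
    rw [dirD_mul hu.1 hfT, hD, Finset.mul_sum]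
    refine add_mem (AddSubmonoid.subset_closure ⟨_, _, _, f, ?_, hu.dirD k, hf, rfl⟩)
      (sum_mem fun i _ => ?_)
    · abel
    · rcases hc' k i with h0 | ⟨e', he', hmem⟩
      · have : (fun q => (c k i q : ℂ)) = 0 := by funext q; simp [h0]
        rw [this, zero_mul, mul_zero]; exact zero_mem _
      · refine AddSubmonoid.subset_closure ⟨e + e', m + S.shift i, u * _, _, ?_,
          hu.mul hS' hmem, hf.dirD i, by rw [mul_assoc]⟩
        rw [map_add, ← he']; abel
  · funext q; simp

end SymbolScale

end Scales

/-! ### Integrals depending on parameters -/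

section ParametricIntegrals

open MeasureTheory

lemma aestronglyMeasurable_slice {P Z X : Type*} [TopologicalSpace P] [TopologicalSpace Z]
    [SecondCountableTopology Z] [MeasurableSpace Z] [OpensMeasurableSpace Z] {μ : Measure Z}
    [TopologicalSpace X] [TopologicalSpace.PseudoMetrizableSpace X] {f : P × Z → X}
    (hf : Continuous f) (p : P) : AEStronglyMeasurable (fun z => f (p, z)) μ :=
  (hf.comp (Continuous.prodMk_right p)).aestronglyMeasurable

variable {P Z : Type*} [NormedAddCommGroup P]
  [NormedAddCommGroup Z] [NormedSpace ℝ Z] [FiniteDimensional ℝ Z]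
  [MeasurableSpace Z] [BorelSpace Z]

/-- `f (p, ·)` is dominated by an integrable function, locally uniformly in the parameter `p`. -/
def LocDom (μ : Measure Z) (f : P × Z → ℂ) : Prop :=
  ∀ p₀ : P, ∃ r > 0, ∃ g : Z → ℝ, Integrable g μ ∧
    ∀ᵐ z ∂μ, ∀ p ∈ Metric.ball p₀ r, ‖f (p, z)‖ ≤ g z

variable {μ : Measure Z} {f : P × Z → ℂ}

lemma LocDom.integrable (h : LocDom μ f) (hf : Continuous f) (p : P) :
    Integrable (fun z => f (p, z)) μ := by
  obtain ⟨r, hr, g, hg, hb⟩ := h p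
  exact hg.mono' (aestronglyMeasurable_slice hf p)
    (hb.mono fun z hz => hz p (Metric.mem_ball_self hr))

variable [NormedSpace ℝ P]

/-- Differentiation under the integral sign. It is enough to dominate the derivatives along a basis,
since they control the operator norm of the full derivative in the parameters. -/
lemma hasFDerivAt_paramIntegral {κ : Type*} [Fintype κ] (b : Module.Basis κ ℝ P)
    (hf : ContDiff ℝ ∞ f) (h0 : LocDom μ f) (h1 : ∀ i, LocDom μ (dirD (b i, 0) f)) (p₀ : P) :
    Integrable (fun z => (fderiv ℝ f (p₀, z)).comp (ContinuousLinearMap.inl ℝ P Z)) μ ∧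
    HasFDerivAt (fun p => ∫ z, f (p, z) ∂μ)
      (∫ z, (fderiv ℝ f (p₀, z)).comp (ContinuousLinearMap.inl ℝ P Z) ∂μ) p₀ := by
  obtain ⟨C, hC, hop⟩ := b.exists_opNorm_le (F := ℂ)
  choose r hr g hg hb using fun i => h1 i p₀
  obtain ⟨r', hr', hr''⟩ : ∃ r' > 0, ∀ i, r' ≤ r i := by
    rcases isEmpty_or_nonempty κ with hκ | hκ
    · exact ⟨1, one_pos, fun i => hκ.elim i⟩
    · refine ⟨Finset.univ.inf' Finset.univ_nonempty r, ?_, fun i => Finset.inf'_le _ (by simp)⟩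
      rw [gt_iff_lt, Finset.lt_inf'_iff]
      exact fun i _ => hr i
  have hbound : ∀ᵐ z ∂μ, ∀ p ∈ Metric.ball p₀ r',
      ‖(fderiv ℝ f (p, z)).comp (ContinuousLinearMap.inl ℝ P Z)‖ ≤ C * ∑ i, g i z := by
    filter_upwards [ae_all_iff.2 hb] with z hz p hp
    have hz' : ∀ i, ‖dirD (b i, 0) f (p, z)‖ ≤ g i z := fun i =>
      hz i p (Metric.ball_subset_ball (hr'' i) hp)
    have hnn : ∀ i, 0 ≤ g i z := fun i => (norm_nonneg _).trans (hz' i)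
    refine hop (Finset.sum_nonneg fun i _ => hnn i) fun i => ?_
    refine le_trans ?_ (Finset.single_le_sum (fun i _ => hnn i) (Finset.mem_univ i))
    simpa [dirD] using hz' i
  have hint : Integrable (fun z => C * ∑ i, g i z) μ :=
    (integrable_finsetSum _ fun i _ => hg i).const_mul C
  have hcont : Continuous fun q : P × Z =>
      (fderiv ℝ f q).comp (ContinuousLinearMap.inl ℝ P Z) :=
    (hf.continuous_fderiv (by simp)).clm_comp continuous_const
  have hmeas := aestronglyMeasurable_slice (μ := μ) hcont p₀
  refine ⟨hint.mono' hmeas (hbound.mono fun z hz => hz p₀ (Metric.mem_ball_self hr')), ?_⟩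
  refine hasFDerivAt_integral_of_dominated_of_fderiv_le (Metric.ball_mem_nhds p₀ hr')
    (Filter.Eventually.of_forall fun p => aestronglyMeasurable_slice hf.continuous p)
    (h0.integrable hf.continuous p₀) hmeas hbound hint (Filter.Eventually.of_forall ?_)
  intro z p _
  have h2 : HasFDerivAt (fun p : P => (p, z)) (ContinuousLinearMap.inl ℝ P Z) p :=
    hasFDerivAt_prodMk_left p z
  exact (differentiable_of_smooth hf (p, z)).hasFDerivAt.comp p h2

lemma dirD_paramIntegral {κ : Type*} [Fintype κ] (b : Module.Basis κ ℝ P)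
    (hf : ContDiff ℝ ∞ f) (h0 : LocDom μ f) (h1 : ∀ i, LocDom μ (dirD (b i, 0) f)) (v : P) :
    dirD v (fun p => ∫ z, f (p, z) ∂μ) = fun p => ∫ z, dirD (v, 0) f (p, z) ∂μ := by
  funext p
  obtain ⟨hi, hd⟩ := hasFDerivAt_paramIntegral b hf h0 h1 p
  rw [dirD, hd.fderiv, ContinuousLinearMap.integral_apply hi]
  simp [dirD]

variable [FiniteDimensional ℝ P]

/-- A family of locally dominated smooth integrands that is stable under differentiation in the
parameters has smooth integrals. -/
theorem contDiff_paramIntegral {κ : Type*} [Fintype κ] (b : Module.Basis κ ℝ P)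
    (Q : (P × Z → ℂ) → Prop) (hs : ∀ f, Q f → ContDiff ℝ ∞ f) (hl : ∀ f, Q f → LocDom μ f)
    (hd : ∀ f, Q f → ∀ i, Q (dirD (b i, 0) f)) (hf : Q f) :
    ContDiff ℝ ∞ (fun p => ∫ z, f (p, z) ∂μ) := by
  have key : ∀ N : ℕ, ∀ f, Q f → ContDiff ℝ N (fun p => ∫ z, f (p, z) ∂μ) := by
    intro N
    have hdiff : ∀ f, Q f → Differentiable ℝ (fun p => ∫ z, f (p, z) ∂μ) := fun f hf p =>
      (hasFDerivAt_paramIntegral b (hs f hf) (hl f hf)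
        (fun i => hl _ (hd f hf i)) p).2.differentiableAt
    induction N with
    | zero => exact fun f hf => contDiff_zero.2 (hdiff f hf).continuous
    | succ N ih =>
      intro f hf
      rw [Nat.cast_succ, contDiff_succ_iff_fderiv_apply]
      refine ⟨hdiff f hf, by simp, fun y => ?_⟩
      have : (fun x => fderiv ℝ (fun p => ∫ z, f (p, z) ∂μ) x y) =
          fun x => ∑ i, b.repr y i • ∫ z, dirD (b i, 0) f (x, z) ∂μ := by
        funext x
        conv_lhs => rw [← b.sum_repr y]
        rw [map_sum]
        refine Finset.sum_congr rfl fun i _ => ?_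
        rw [map_smul]
        congr 1
        exact congrFun (dirD_paramIntegral b (hs f hf) (hl f hf)
          (fun i => hl _ (hd f hf i)) (b i)) x
      rw [this]
      exact ContDiff.sum fun i _ => (ih _ (hd f hf i)).const_smul _
  exact contDiff_infty.2 fun N => key N f hf

lemma locDom_restrict_of_continuous [IsLocallyFiniteMeasure μ] {K : Set Z} (hK : IsCompact K)
    (hf : Continuous f) : LocDom (μ.restrict K) f := by
  intro p₀
  obtain ⟨C, hC⟩ := ((isCompact_closedBall p₀ 1).prod hK).exists_bound_of_continuousOn
    hf.continuousOn
  have : IsFiniteMeasure (μ.restrict K) := ⟨by simpa using hK.measure_lt_top⟩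
  refine ⟨1, one_pos, fun _ => C, integrable_const C, ?_⟩
  filter_upwards [ae_restrict_mem hK.measurableSet] with z hz p hp
  exact hC _ ⟨Metric.ball_subset_closedBall hp, hz⟩

theorem contDiff_setIntegral_compact [IsLocallyFiniteMeasure μ] {K : Set Z} (hK : IsCompact K)
    (hf : ContDiff ℝ ∞ f) : ContDiff ℝ ∞ (fun p => ∫ z in K, f (p, z) ∂μ) :=
  contDiff_paramIntegral (Module.finBasis ℝ P) (fun f => ContDiff ℝ ∞ f) (fun _ h => h)
    (fun _ h => locDom_restrict_of_continuous hK h.continuous)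
    (fun _ h _ => contDiff_dirD h _) hf

theorem dirD_setIntegral_compact [IsLocallyFiniteMeasure μ] {K : Set Z} (hK : IsCompact K)
    (hf : ContDiff ℝ ∞ f) (v : P) :
    dirD v (fun p => ∫ z in K, f (p, z) ∂μ) = fun p => ∫ z in K, dirD (v, 0) f (p, z) ∂μ :=
  dirD_paramIntegral (Module.finBasis ℝ P) hf (locDom_restrict_of_continuous hK hf.continuous)
    (fun _ => locDom_restrict_of_continuous hK (contDiff_dirD hf _).continuous) v

end ParametricIntegrals

/-! ### Weights, Peetre's inequality and the scales on phase space -/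

section ConcreteScales

/-- `ℝⁿ` with its Euclidean norm. -/
abbrev Rn (n : ℕ) := EuclideanSpace ℝ (Fin n)

/-- The standard basis vectors of `ℝⁿ`. -/
abbrev unitVec {n : ℕ} (j : Fin n) : Rn n := EuclideanSpace.single j 1

variable {n : ℕ}

lemma sum_smul_unitVec (v : Rn n) : ∑ j, v j • unitVec j = v := by
  have := (EuclideanSpace.basisFun (Fin n) ℝ).sum_repr v
  simpa using this

lemma one_le_bracket {V : Type*} [SeminormedAddCommGroup V] (x : V) : 1 ≤ 1 + ‖x‖ := by
  linarith [norm_nonneg x]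

lemma bracket_pos {V : Type*} [SeminormedAddCommGroup V] (x : V) : 0 < 1 + ‖x‖ := by
  linarith [norm_nonneg x]

lemma bracket_add_le {V : Type*} [SeminormedAddCommGroup V] (x z : V) :
    1 + ‖x + z‖ ≤ (1 + ‖x‖) * (1 + ‖z‖) := by
  nlinarith [norm_add_le x z, norm_nonneg x, norm_nonneg z]

/-- Peetre's inequality. -/
lemma peetre {V : Type*} [SeminormedAddCommGroup V] (x z : V) {m : ℝ} {K : ℕ}
    (hK : |m| ≤ K) :
    (1 + ‖x + z‖) ^ m ≤ (1 + ‖x‖) ^ m * (1 + ‖z‖) ^ K := by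
  have hz := one_le_bracket z
  have hx := bracket_pos x
  have hxz := bracket_pos (x + z)
  have h1 : (1 + ‖z‖) ^ |m| ≤ (1 + ‖z‖) ^ K := by
    rw [← Real.rpow_natCast]; exact Real.rpow_le_rpow_of_exponent_le hz hK
  refine le_trans ?_ (mul_le_mul_of_nonneg_left h1 (Real.rpow_nonneg hx.le m))
  rcases le_total 0 m with hm | hm
  · rw [abs_of_nonneg hm, ← Real.mul_rpow hx.le (by linarith)]
    exact Real.rpow_le_rpow hxz.le (bracket_add_le x z) hm
  · rw [abs_of_nonpos hm]
    have h2 : 1 + ‖x‖ ≤ (1 + ‖x + z‖) * (1 + ‖z‖) := by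
      have := bracket_add_le (x + z) (-z)
      simpa using this
    have h3 : (1 + ‖x‖) ^ (-m) ≤ ((1 + ‖x + z‖) * (1 + ‖z‖)) ^ (-m) :=
      Real.rpow_le_rpow hx.le h2 (by linarith)
    rw [Real.mul_rpow hxz.le (by linarith)] at h3
    have h4 : (1 + ‖x‖) ^ m * (1 + ‖x‖) ^ (-m) = 1 := by
      rw [← Real.rpow_add hx]; simp
    have h5 : (1 + ‖x + z‖) ^ m * (1 + ‖x + z‖) ^ (-m) = 1 := by
      rw [← Real.rpow_add hxz]; simp
    have h6 : 0 < (1 + ‖x‖) ^ m := Real.rpow_pos_of_pos hx m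
    have h7 : 0 < (1 + ‖x + z‖) ^ m := Real.rpow_pos_of_pos hxz m
    calc (1 + ‖x + z‖) ^ m = (1 + ‖x + z‖) ^ m * ((1 + ‖x‖) ^ m * (1 + ‖x‖) ^ (-m)) := by
          rw [h4, mul_one]
      _ ≤ (1 + ‖x + z‖) ^ m *
          ((1 + ‖x‖) ^ m * ((1 + ‖x + z‖) ^ (-m) * (1 + ‖z‖) ^ (-m))) := by gcongr
      _ = ((1 + ‖x + z‖) ^ m * (1 + ‖x + z‖) ^ (-m)) *
          ((1 + ‖x‖) ^ m * (1 + ‖z‖) ^ (-m)) := by ring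
      _ = _ := by rw [h5, one_mul]

lemma exists_bound_add {A : Type*} {F G : A → ℂ} {W : A → ℝ}
    (hF : ∃ C, ∀ p, ‖F p‖ ≤ C * W p) (hG : ∃ C, ∀ p, ‖G p‖ ≤ C * W p) :
    ∃ C, ∀ p, ‖F p + G p‖ ≤ C * W p := by
  obtain ⟨C, hC⟩ := hF
  obtain ⟨C', hC'⟩ := hG
  refine ⟨C + C', fun p => (norm_add_le _ _).trans ?_⟩
  rw [add_mul]
  exact add_le_add (hC p) (hC' p)

lemma exists_bound_mul {A : Type*} {F G : A → ℂ} {W W' : A → ℝ}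
    (hF : ∃ C, ∀ p, ‖F p‖ ≤ C * W p) (hG : ∃ C, ∀ p, ‖G p‖ ≤ C * W' p) :
    ∃ C, ∀ p, ‖F p * G p‖ ≤ C * (W p * W' p) := by
  obtain ⟨C, hC⟩ := hF
  obtain ⟨C', hC'⟩ := hG
  refine ⟨C * C', fun p => ?_⟩
  rw [norm_mul]
  calc ‖F p‖ * ‖G p‖ ≤ (C * W p) * (C' * W' p) :=
        mul_le_mul (hC p) (hC' p) (norm_nonneg _) ((norm_nonneg _).trans (hC p))
    _ = _ := by ring

/-- Phase space: the pairs `(x, ξ)`. -/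
abbrev Phase (n : ℕ) := Rn n × Rn n

/-- The coordinate directions of phase space. -/
def phaseDir : Fin n ⊕ Fin n → Phase n :=
  Sum.elim (fun j => (unitVec j, 0)) (fun j => (0, unitVec j))

/-- The coordinates of a vector of phase space with respect to `phaseDir`. -/
def phaseCoord (v : Phase n) : Fin n ⊕ Fin n → ℝ := Sum.elim (fun j => v.1 j) (fun j => v.2 j)

lemma sum_phaseCoord (v : Phase n) : ∑ i, phaseCoord v i • phaseDir i = v := by
  rw [Fintype.sum_sum_type]
  simp only [phaseCoord, phaseDir, Sum.elim_inl, Sum.elim_inr, Prod.smul_mk, smul_zero]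
  refine Prod.ext ?_ ?_
  · simp [Prod.fst_sum, sum_smul_unitVec]
  · simp [Prod.snd_sum, sum_smul_unitVec]

/-- The scale of the classes `S^m`. -/
def symbolScale (n : ℕ) : SymbolScale (Fin n ⊕ Fin n) (Phase n) ℝ where
  dir := phaseDir
  shift := Sum.elim (fun _ => -1) (fun _ => 0)
  bound m f := ∃ C, ∀ p, ‖f p‖ ≤ C * (1 + ‖p.1‖) ^ m
  bound_zero _ := ⟨0, by simp⟩
  bound_add _ _ _ hf hg := exists_bound_add hf hg

lemma symbolScale_isMultiplicative : (symbolScale n).IsMultiplicative where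
  one c := ⟨‖c‖, fun p => by simp⟩
  mul m m' f g hf hg := by
    obtain ⟨C, hC⟩ := exists_bound_mul hf hg
    refine ⟨C, fun p => ?_⟩
    rw [Real.rpow_add (bracket_pos _)]
    exact hC p

/-- The classes `S^m` again, with the zeroth-order estimate in the form
`|f (x + z, ξ)| ≤ C ⟨x⟩^m ⟨z⟩^K` that survives a translation of `x`; the second component of the
order is the exponent `K`. A derivative in `x` raises `K` by one, since Peetre's inequality needs
`|m| ≤ K` and `m` changes to `m - 1`. -/
def temperedScale (n : ℕ) : SymbolScale (Fin n ⊕ Fin n) (Phase n) (ℝ × ℕ) where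
  dir := phaseDir
  shift := Sum.elim (fun _ => (-1, 1)) (fun _ => 0)
  bound m f := ∃ C, ∀ q : (Rn n × Rn n) × Rn n,
    ‖f (q.1.1 + q.2, q.1.2)‖ ≤ C * ((1 + ‖q.1.1‖) ^ m.1 * (1 + ‖q.2‖) ^ m.2)
  bound_zero _ := ⟨0, by simp⟩
  bound_add _ f g hf hg := exists_bound_add
    (F := fun q : (Rn n × Rn n) × Rn n => f (q.1.1 + q.2, q.1.2))
    (G := fun q : (Rn n × Rn n) × Rn n => g (q.1.1 + q.2, q.1.2)) hf hg

lemma mem_temperedScale {m : ℝ} {K : ℕ} (hK : |m| ≤ K) {f : Phase n → ℂ}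
    (hf : (symbolScale n).Mem m f) : (temperedScale n).Mem (m, K) f := by
  refine SymbolScale.Mem.coinduct (fun k f => |k.1| ≤ k.2 ∧ (symbolScale n).Mem k.1 f)
    (fun _ _ h => h.2.1) ?_ ?_ ⟨hK, hf⟩
  · rintro ⟨m, K⟩ f ⟨hK, hf⟩
    obtain ⟨C, hC⟩ := hf.bound
    have hC0 : 0 ≤ C := by
      have := (norm_nonneg _).trans (hC 0)
      simpa using this
    refine ⟨C, fun q => (hC _).trans ?_⟩
    exact mul_le_mul_of_nonneg_left (peetre _ _ hK) hC0
  · rintro ⟨m, K⟩ f ⟨hK, hf⟩ i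
    refine AddSubmonoid.subset_closure ?_
    have := hf.dirD i
    rcases i with j | j
    · refine ⟨?_, this⟩
      simp only [temperedScale, Sum.elim_inl, Prod.mk_add_mk, Nat.cast_add, Nat.cast_one]
      calc |m + -1| ≤ |m| + |-1| := abs_add_le _ _
        _ ≤ K + 1 := by simpa using hK
    · refine ⟨?_, this⟩
      simpa [temperedScale] using hK

/-- The scale with the estimates `|f| ≤ C ⟨X⟩^m ⟨Z⟩^K ⟨τ⟩^L`, where `(m, K)` is the order, `L` is
arbitrary, and `X`, `Z`, `τ` are given functions on the space. The exponent `L` need not be tracked,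
because `τ` is eventually restricted to the interval `[0, 1]`. -/
def weightScale {ι V : Type*} [NormedAddCommGroup V] [NormedSpace ℝ V] (dir : ι → V)
    (shift : ι → ℝ × ℕ) (X Z : V → Rn n) (τ : V → ℝ) : SymbolScale ι V (ℝ × ℕ) where
  dir := dir
  shift := shift
  bound m f := ∃ L : ℕ, ∃ C, ∀ p,
    ‖f p‖ ≤ C * ((1 + ‖X p‖) ^ m.1 * (1 + ‖Z p‖) ^ m.2 * (1 + ‖τ p‖) ^ L)
  bound_zero _ := ⟨0, 0, by simp⟩
  bound_add m f g := by
    rintro ⟨L, C, hC⟩ ⟨L', C', hC'⟩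
    have hw : ∀ p, 0 ≤ (1 + ‖X p‖) ^ m.1 * (1 + ‖Z p‖) ^ m.2 := fun p => by positivity
    refine ⟨L + L', |C| + |C'|, fun p => (norm_add_le _ _).trans ?_⟩
    rw [add_mul]
    have h1 := one_le_bracket (τ p)
    refine add_le_add ((hC p).trans ?_) ((hC' p).trans ?_)
    · gcongr
      · exact le_abs_self C
      · omega
    · gcongr
      · exact le_abs_self C'
      · omega

lemma weightScale_isMultiplicative {ι V : Type*} [NormedAddCommGroup V] [NormedSpace ℝ V]
    (dir : ι → V) (shift : ι → ℝ × ℕ) (X Z : V → Rn n) (τ : V → ℝ) :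
    (weightScale dir shift X Z τ).IsMultiplicative where
  one c := ⟨0, ‖c‖, fun p => by simp⟩
  mul m m' f g := by
    rintro ⟨L, hf⟩ ⟨L', hg⟩
    obtain ⟨C, hC⟩ := exists_bound_mul hf hg
    refine ⟨L + L', C, fun p => (hC p).trans (le_of_eq ?_)⟩
    rw [Prod.fst_add, Prod.snd_add, Real.rpow_add (bracket_pos _), pow_add, pow_add]
    ring

/-- A function that is constant in the directions of the scale belongs to the class as soon as it
satisfies the zeroth-order estimate. -/
lemma SymbolScale.Mem.of_dirD_eq_zero {ι V M : Type*} [NormedAddCommGroup V] [NormedSpace ℝ V]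
    [AddCommMonoid M] {S : SymbolScale ι V M} {m : M} {f : V → ℂ} (hf : ContDiff ℝ ∞ f)
    (hb : S.bound m f) (hd : ∀ i, OscSymbol.dirD (S.dir i) f = 0) : S.Mem m f := by
  refine ⟨hf, fun N => ?_⟩
  cases N with
  | zero => exact hb
  | succ N => exact ⟨hb, fun i => by rw [hd]; exact HasOrder.zero _ _⟩

end ConcreteScales

/-! ### Symbols in terms of directional derivatives -/

section Bridge

variable {n : ℕ} {F : Type*} [NormedAddCommGroup F] [NormedSpace ℝ F]

lemma dirD_prodMk_right {V W : Type*} [NormedAddCommGroup V] [NormedSpace ℝ V]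
    [NormedAddCommGroup W] [NormedSpace ℝ W] (x : V) (v p : W) :
    dirD v (fun y : W => (x, y)) p = (0, v) := by
  simp only [dirD]
  rw [(hasFDerivAt_prodMk_right x p).fderiv]; simp

lemma dirD_prodMk_left {V W : Type*} [NormedAddCommGroup V] [NormedSpace ℝ V]
    [NormedAddCommGroup W] [NormedSpace ℝ W] (y : W) (v p : V) :
    dirD v (fun x : V => (x, y)) p = (v, 0) := by
  simp only [dirD]
  rw [(hasFDerivAt_prodMk_left p y).fderiv]; simp

lemma multiDeriv_snd {g : Phase n → F} (hg : ContDiff ℝ ∞ g) (β : Fin n → ℕ) (x ξ : Rn n) :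
    multiDeriv β (fun ξ => g (x, ξ)) ξ = multiDir (fun j => (0, unitVec j)) β g (x, ξ) := by
  rw [multiDeriv_eq_multiDir]
  exact congrFun (multiDir_comp (S := fun ξ => (x, ξ)) hg (contDiff_prodMk_right x)
    (fun j p => dirD_prodMk_right x _ p) β) ξ

lemma multiDeriv_fst {g : Phase n → F} (hg : ContDiff ℝ ∞ g) (α : Fin n → ℕ) (x ξ : Rn n) :
    multiDeriv α (fun x => g (x, ξ)) x = multiDir (fun j => (unitVec j, 0)) α g (x, ξ) := by
  rw [multiDeriv_eq_multiDir]
  exact congrFun (multiDir_comp (S := fun x => (x, ξ)) hg (contDiff_prodMk_left ξ)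
    (fun j p => dirD_prodMk_left ξ _ p) α) x

/-- The estimates in the definition of `IsSymbol`, in terms of directional derivatives on phase
space. -/
lemma isSymbol_iff_multiDir {m : ℝ} {a : Rn n → Rn n → F} :
    IsSymbol m a ↔ ContDiff ℝ ∞ (Function.uncurry a) ∧ ∀ α β : Fin n → ℕ, ∃ C : ℝ,
      ∀ p : Phase n, ‖multiDir (fun j => (unitVec j, 0)) α
        (multiDir (fun j => (0, unitVec j)) β (Function.uncurry a)) p‖ ≤
          C * (1 + ‖p.1‖) ^ (m - order α) := by
  refine and_congr_right fun h => forall_congr' fun α => forall_congr' fun β =>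
    exists_congr fun C => ?_
  have h2 : ∀ x ξ, multiDeriv α (fun y => multiDeriv β (a y) ξ) x =
      multiDir (fun j => (unitVec j, 0)) α
        (multiDir (fun j => (0, unitVec j)) β (Function.uncurry a)) (x, ξ) := by
    intro x ξ
    rw [← multiDeriv_fst (contDiff_multiDir h _ _)]
    congr 1
    funext y
    exact multiDeriv_snd h β y ξ
  constructor
  · intro h1 p
    have := h1 p.1 p.2
    rwa [h2] at this
  · intro h1 x ξ
    rw [h2]
    exact h1 (x, ξ)

lemma SymbolScale.Mem.multiDir {ι V M : Type*} [NormedAddCommGroup V] [NormedSpace ℝ V]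
    [AddCommMonoid M] {S : SymbolScale ι V M} {e : Fin n → V} {s : M}
    (he : ∀ j, ∃ i, S.dir i = e j ∧ S.shift i = s) (α : Fin n → ℕ) {m : M} {f : V → ℂ}
    (hf : S.Mem m f) : S.Mem (m + order α • s) (multiDir e α f) := by
  have hord : order α = ((List.finRange n).map α).sum := by
    rw [order, ← List.sum_ofFn, List.ofFn_eq_map]
  rw [hord]
  unfold OscSymbol.multiDir
  generalize List.finRange n = l
  induction l with
  | nil => simpa using hf
  | cons j l ih =>
    simp only [List.foldr_cons, List.map_cons, List.sum_cons]
    generalize α j = k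
    induction k with
    | zero => simpa using ih
    | succ k ihk =>
      rw [Function.iterate_succ_apply']
      obtain ⟨i, hi, hs⟩ := he j
      have := ihk.dirD i
      rw [hi, hs] at this
      convert this using 1
      rw [add_assoc m, ← succ_nsmul]; congr 2; ring

/-- The classes defined by multi-indices are those of the scale `symbolScale`, in which derivatives
are taken one at a time and in any order. -/
theorem isSymbol_iff_mem {m : ℝ} {a : Rn n → Rn n → ℂ} :
    IsSymbol m a ↔ (symbolScale n).Mem m (Function.uncurry a) := by
  rw [isSymbol_iff_multiDir]
  constructor
  · intro h
    refine SymbolScale.Mem.coinduct (fun (m : ℝ) f => ContDiff ℝ ∞ f ∧ ∀ α β : Fin n → ℕ, ∃ C : ℝ,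
      ∀ p : Phase n, ‖multiDir (fun j => (unitVec j, 0)) α
        (multiDir (fun j => (0, unitVec j)) β f) p‖ ≤ C * (1 + ‖p.1‖) ^ (m - order α))
      (fun _ _ h => h.1) ?_ ?_ h
    · rintro m f ⟨hf, h⟩
      obtain ⟨C, hC⟩ := h 0 0
      refine ⟨C, fun p => ?_⟩
      have := hC p
      rw [multiDir_zero, multiDir_zero] at this
      simpa [order] using this
    · rintro m f ⟨hf, h⟩ i
      refine AddSubmonoid.subset_closure ⟨contDiff_dirD hf _, fun α β => ?_⟩
      rcases i with j | j
      · obtain ⟨C, hC⟩ := h (α + Pi.single j 1) β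
        refine ⟨C, fun p => ?_⟩
        have := hC p
        rw [← multiDir_dirD_eq (contDiff_multiDir hf _ _), ← multiDir_dirD_comm hf] at this
        have ho : order (α + Pi.single j 1) = order α + 1 := by
          simp [order, Finset.sum_add_distrib]
        rw [ho] at this
        have he : m - ((order α + 1 : ℕ) : ℝ) = m + -1 - (order α : ℝ) := by push_cast; ring
        rw [he] at this
        exact this
      · obtain ⟨C, hC⟩ := h α (β + Pi.single j 1)
        refine ⟨C, fun p => ?_⟩
        have := hC p
        rw [← multiDir_dirD_eq hf] at this
        simpa [symbolScale, phaseDir] using this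
  · intro h
    refine ⟨h.1, fun α β => ?_⟩
    have h1 := SymbolScale.Mem.multiDir (S := symbolScale n) (s := 0)
      (e := fun j => (0, unitVec j)) (fun j => ⟨Sum.inr j, rfl, rfl⟩) β h
    have h2 := SymbolScale.Mem.multiDir (S := symbolScale n) (s := -1)
      (e := fun j => (unitVec j, 0)) (fun j => ⟨Sum.inl j, rfl, rfl⟩) α h1
    obtain ⟨C, hC⟩ := h2.bound
    refine ⟨C, fun p => (hC p).trans (le_of_eq ?_)⟩
    congr 2
    simp; ring

lemma IsSymbol.clm {F' : Type*} [NormedAddCommGroup F'] [NormedSpace ℝ F'] {m : ℝ}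
    {a : Rn n → Rn n → F} (h : IsSymbol m a) (L : F →L[ℝ] F') :
    IsSymbol m (fun x ξ => L (a x ξ)) := by
  rw [isSymbol_iff_multiDir] at h ⊢
  refine ⟨L.contDiff.comp h.1, fun α β => ?_⟩
  obtain ⟨C, hC⟩ := h.2 α β
  refine ⟨‖L‖ * C, fun p => ?_⟩
  have h1 : Function.uncurry (fun x ξ => L (a x ξ)) = fun p => L (Function.uncurry a p) := rfl
  rw [h1, multiDir_clm h.1, multiDir_clm (contDiff_multiDir h.1 _ _), mul_assoc]
  exact (L.le_opNorm _).trans (mul_le_mul_of_nonneg_left (hC p) (norm_nonneg _))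

lemma IsSymbol.mono {m m' : ℝ} (hm : m ≤ m') {a : Rn n → Rn n → F} (h : IsSymbol m a) :
    IsSymbol m' a := by
  refine ⟨h.1, fun α β => ?_⟩
  obtain ⟨C, hC⟩ := h.2 α β
  refine ⟨|C|, fun x ξ => (hC x ξ).trans ?_⟩
  gcongr
  · exact le_abs_self C
  · exact one_le_bracket x

end Bridge

/-! ### Scales for the variables of the amplitude -/

section AmplitudeScale

open MeasureTheory

variable {n : ℕ}

/-- The space of the variables `(((x, η), z), ζ)` of the amplitude. -/
abbrev Amp (n : ℕ) := (Phase n × Rn n) × Rn n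

/-- The coordinate directions in the space of the variables `(((x, η), z), ζ)`. -/
def ampDir : ((Fin n ⊕ Fin n) ⊕ Fin n) ⊕ Fin n → Amp n :=
  Sum.elim (Sum.elim (fun i => ((phaseDir i, 0), 0)) (fun j => ((0, unitVec j), 0)))
    (fun j => (0, unitVec j))

/-- The coordinates of a vector with respect to `ampDir`. -/
def ampCoord (v : Amp n) : ((Fin n ⊕ Fin n) ⊕ Fin n) ⊕ Fin n → ℝ :=
  Sum.elim (Sum.elim (phaseCoord v.1.1) (fun j => v.1.2 j)) (fun j => v.2 j)

lemma sum_ampCoord (v : Amp n) : ∑ i, ampCoord v i • ampDir i = v := by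
  rw [Fintype.sum_sum_type, Fintype.sum_sum_type]
  simp only [ampCoord, ampDir, Sum.elim_inl, Sum.elim_inr, Prod.smul_mk, smul_zero]
  refine Prod.ext (Prod.ext ?_ ?_) ?_
  · simp [Prod.fst_sum, -Fintype.sum_sum_type, sum_phaseCoord]
  · simp [Prod.fst_sum, Prod.snd_sum, sum_smul_unitVec]
  · simp [Prod.snd_sum, sum_smul_unitVec]

/-- The change of the order under the derivatives in the directions `ampDir`: derivatives in `x`
and in `z` lower the order in `x` by one and cost one power of `⟨z⟩`. -/
def ampShift : ((Fin n ⊕ Fin n) ⊕ Fin n) ⊕ Fin n → ℝ × ℕ :=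
  Sum.elim (Sum.elim (Sum.elim (fun _ => (-1, 1)) (fun _ => 0)) (fun _ => (-1, 1))) (fun _ => 0)

/-- The scale of functions of `(((x, η), z), ζ)` with the estimates `|f| ≤ C ⟨x⟩^m ⟨z⟩^K`. -/
def ampScale (n : ℕ) := weightScale (ampDir (n := n)) ampShift (fun v => v.1.1.1)
  (fun v => v.1.2) (fun _ => 0)

/-- The scale of functions of `((((x, η), z), ζ), s)` with the estimates
`|f| ≤ C ⟨x⟩^m ⟨z⟩^K ⟨s⟩^L`, where only the directions `ampDir` are differentiated. -/
def ampParamScale (n : ℕ) := weightScale (V := Amp n × ℝ) (fun i => (ampDir (n := n) i, 0))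
  ampShift (fun v => v.1.1.1.1) (fun v => v.1.1.2) (fun v => v.2)

/-- Integration over `[0, 1]` of a parameter preserves the classes. -/
lemma mem_ampScale_integral {m : ℝ × ℕ} {h : Amp n × ℝ → ℂ} (hh : (ampParamScale n).Mem m h) :
    (ampScale n).Mem m (fun v => ∫ s in Set.Icc (0 : ℝ) 1, h (v, s)) := by
  refine SymbolScale.Mem.coinduct (fun m g => ∃ h, (ampParamScale n).Mem m h ∧
    g = fun v => ∫ s in Set.Icc (0 : ℝ) 1, h (v, s)) ?_ ?_ ?_ ⟨h, hh, rfl⟩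
  · rintro m _ ⟨h, hh, rfl⟩
    exact contDiff_setIntegral_compact isCompact_Icc hh.1
  · rintro m _ ⟨h, hh, rfl⟩
    obtain ⟨L, C, hC⟩ := hh.bound
    refine ⟨0, C * 2 ^ L, fun v => ?_⟩
    have hw : 0 ≤ C * ((1 + ‖v.1.1.1‖) ^ m.1 * (1 + ‖v.1.2‖) ^ m.2) := by
      simpa using (norm_nonneg _).trans (hC (v, 0))
    have := norm_setIntegral_le_of_norm_le_const (μ := volume) (s := Set.Icc (0 : ℝ) 1)
      (f := fun s => h (v, s))
      (C := C * 2 ^ L * ((1 + ‖v.1.1.1‖) ^ m.1 * (1 + ‖v.1.2‖) ^ m.2)) (by simp) (fun s hs => by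
        refine (hC (v, s)).trans ?_
        have hs1 : (1 + ‖s‖) ^ L ≤ 2 ^ L := by
          gcongr
          rw [Real.norm_of_nonneg hs.1]; linarith [hs.2]
        calc _ = C * ((1 + ‖v.1.1.1‖) ^ m.1 * (1 + ‖v.1.2‖) ^ m.2) * (1 + ‖s‖) ^ L := by ring
          _ ≤ C * ((1 + ‖v.1.1.1‖) ^ m.1 * (1 + ‖v.1.2‖) ^ m.2) * 2 ^ L := by gcongr
          _ = _ := by ring)
    simpa using this
  · rintro m _ ⟨h, hh, rfl⟩ i
    refine AddSubmonoid.subset_closure ⟨_, hh.dirD i, ?_⟩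
    exact dirD_setIntegral_compact isCompact_Icc hh.1 _

/-- Composition of a function on phase space with a map `(X, Y)`. -/
lemma SymbolScale.Mem.comp_phase {ι V M : Type*} [NormedAddCommGroup V] [NormedSpace ℝ V]
    [AddCommMonoid M] {S : SymbolScale ι V M} (hS : S.IsMultiplicative) (φ : ℝ × ℕ →+ M)
    {X Y : V → Rn n} (hX : ContDiff ℝ ∞ X) (hY : ContDiff ℝ ∞ Y)
    (hb : ∀ m f, (temperedScale n).bound m f → S.bound (φ m) (fun q => f (X q, Y q)))
    (hX' : ∀ k j, (∀ q, OscSymbol.dirD (S.dir k) X q j = 0) ∨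
      ∃ e, e + φ (-1, 1) = S.shift k ∧ S.Mem e (fun q => (OscSymbol.dirD (S.dir k) X q j : ℂ)))
    (hY' : ∀ k j, (∀ q, OscSymbol.dirD (S.dir k) Y q j = 0) ∨
      ∃ e, e = S.shift k ∧ S.Mem e (fun q => (OscSymbol.dirD (S.dir k) Y q j : ℂ)))
    {m : ℝ × ℕ} {f : Phase n → ℂ} (hf : (temperedScale n).Mem m f) :
    S.Mem (φ m) (fun q => f (X q, Y q)) := by
  refine hf.comp hS φ (T := fun q => (X q, Y q)) (hX.prodMk hY) hb
    (fun k i q => phaseCoord (OscSymbol.dirD (S.dir k) (fun q => (X q, Y q)) q) i)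
    (fun k q => (sum_phaseCoord _).symm) ?_
  have hD : ∀ k q, OscSymbol.dirD (S.dir k) (fun q => (X q, Y q)) q =
      (OscSymbol.dirD (S.dir k) X q, OscSymbol.dirD (S.dir k) Y q) := by
    intro k q
    simp only [OscSymbol.dirD]
    rw [DifferentiableAt.fderiv_prodMk (differentiable_of_smooth hX q)
      (differentiable_of_smooth hY q)]
    rfl
  rintro k (j | j)
  · simp only [hD, phaseCoord, Sum.elim_inl]
    exact hX' k j
  · simp only [hD, phaseCoord, Sum.elim_inr]
    rcases hY' k j with h | ⟨e, he, h⟩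
    · exact Or.inl h
    · exact Or.inr ⟨e, by rw [← he]; change e + φ 0 = e; simp, h⟩

end AmplitudeScale

/-! ### The average of the gradient along a segment -/

section MeanGradient

open MeasureTheory

variable {n : ℕ} {Φ : Rn n → Rn n → ℝ}

lemma gradX_apply (hΦ : ContDiff ℝ ∞ (Function.uncurry Φ)) (x η : Rn n) (j : Fin n) :
    gradX Φ x η j = dirD (unitVec j, 0) (Function.uncurry Φ) (x, η) := by
  have h1 : gradX Φ x η j = fderiv ℝ (fun y => Φ y η) x (unitVec j) := by
    have h2 : inner ℝ (gradX Φ x η) (unitVec j) = gradX Φ x η j := by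
      simp [EuclideanSpace.inner_single_right]
    rw [← h2, gradX, gradient, InnerProductSpace.toDual_symm_apply]
  rw [h1]
  exact congrFun (dirD_comp_const (S := fun y => (y, η)) hΦ (contDiff_prodMk_left η)
    (fun p => dirD_prodMk_left η (unitVec j) p)) x

lemma contDiff_gradX (hΦ : ContDiff ℝ ∞ (Function.uncurry Φ)) :
    ContDiff ℝ ∞ (fun p : Phase n => gradX Φ p.1 p.2) := by
  rw [contDiff_euclidean]
  intro j
  have : (fun p : Phase n => gradX Φ p.1 p.2 j) = dirD (unitVec j, 0) (Function.uncurry Φ) := by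
    funext p; exact gradX_apply hΦ _ _ _
  rw [this]
  exact contDiff_dirD hΦ _

lemma meanGrad_eq (hΦ : ContDiff ℝ ∞ (Function.uncurry Φ)) (x z η : Rn n) (j : Fin n) :
    meanGrad Φ x (x + z) η j = ∫ s in Set.Icc (0 : ℝ) 1, gradX Φ (x + s • z) η j := by
  have h1 : ∀ s : ℝ, (1 - s) • x + s • (x + z) = x + s • z := by
    intro s; module
  have hc : Continuous fun s : ℝ => gradX Φ (x + s • z) η :=
    (contDiff_gradX hΦ).continuous.comp (f := fun s : ℝ => (x + s • z, η)) (by fun_prop)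
  unfold meanGrad
  simp only [h1]
  rw [integral_Icc_eq_integral_Ioc, ← intervalIntegral.integral_of_le zero_le_one]
  exact ((EuclideanSpace.proj j : Rn n →L[ℝ] ℝ).intervalIntegral_comp_comm
    (hc.intervalIntegrable 0 1)).symm

/-- The segment average `r (x, x + z, η)` of the gradient, as a function of the variables of the
amplitude. -/
def ampGrad (Φ : Rn n → Rn n → ℝ) (v : Amp n) : Rn n :=
  meanGrad Φ v.1.1.1 (v.1.1.1 + v.1.2) v.1.1.2

/-- The components of the gradient of the phase, as complex functions on phase space. -/
def gradComp (Φ : Rn n → Rn n → ℝ) (j : Fin n) (p : Phase n) : ℂ := (gradX Φ p.1 p.2 j : ℂ)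

lemma ampGrad_eq (hΦ : ContDiff ℝ ∞ (Function.uncurry Φ)) (j : Fin n) :
    (fun v : Amp n => (ampGrad Φ v j : ℂ)) = fun v => ∫ s in Set.Icc (0 : ℝ) 1,
      gradComp Φ j (v.1.1.1 + s • v.1.2, v.1.1.2) := by
  funext v
  rw [ampGrad, meanGrad_eq hΦ]
  exact integral_ofReal.symm

lemma mem_gradComp (hΦ : IsSymbol 1 Φ) (j : Fin n) :
    (temperedScale n).Mem 0 (gradComp Φ j) := by
  have h1 : IsSymbol 1 (fun x ξ => (Φ x ξ : ℂ)) := hΦ.clm Complex.ofRealCLM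
  have h2 := (isSymbol_iff_mem.1 h1).dirD (Sum.inl j)
  have h3 : gradComp Φ j = dirD ((symbolScale n).dir (Sum.inl j))
      (Function.uncurry fun x ξ => (Φ x ξ : ℂ)) := by
    funext p
    have := congrFun (dirD_clm hΦ.1 Complex.ofRealCLM ((symbolScale n).dir (Sum.inl j))) p
    rw [gradComp, gradX_apply hΦ.1]
    exact this.symm
  have h4 : (1 : ℝ) + (symbolScale n).shift (Sum.inl j) = 0 := by simp [symbolScale]
  rw [← h3, h4] at h2
  exact mem_temperedScale (K := 0) (by simp) h2

lemma dirD_apply {V : Type*} [NormedAddCommGroup V] [NormedSpace ℝ V] {X : V → Rn n}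
    (hX : ContDiff ℝ ∞ X) (v q : V) (j : Fin n) :
    dirD v X q j = dirD v (fun q => X q j) q :=
  (congrFun (dirD_clm hX (EuclideanSpace.proj j : Rn n →L[ℝ] ℝ) v) q).symm

end MeanGradient

/-! ### Symbol estimates for the amplitude -/

section AmplitudeMembership

open MeasureTheory

variable {n : ℕ} {Φ : Rn n → Rn n → ℝ}

/-- The directional derivative of a map that is affine along the line in question. -/
lemma dirD_eq_of_affine {V F : Type*} [NormedAddCommGroup V] [NormedSpace ℝ V]
    [NormedAddCommGroup F] [NormedSpace ℝ F] {X : V → F} (hX : ContDiff ℝ ∞ X) {v q : V} {w : F}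
    (h : ∀ t : ℝ, X (q + t • v) = X q + t • w) : dirD v X q = w := by
  have h1 := (differentiable_of_smooth hX q).lineDeriv_eq_fderiv (v := v)
  rw [dirD, ← h1, lineDeriv]
  simp only [h]
  have : HasDerivAt (fun t : ℝ => X q + t • w) ((1 : ℝ) • w) 0 :=
    ((hasDerivAt_id (0 : ℝ)).smul_const w).const_add (X q)
  simpa using this.deriv

lemma bracket_smul_le {V : Type*} [NormedAddCommGroup V] [NormedSpace ℝ V] (s : ℝ) (z : V) :
    1 + ‖s • z‖ ≤ (1 + ‖z‖) * (1 + ‖s‖) := by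
  rw [norm_smul]; nlinarith [norm_nonneg s, norm_nonneg z]

lemma ampParamScale_isMultiplicative : (ampParamScale n).IsMultiplicative :=
  weightScale_isMultiplicative _ _ _ _ _

lemma ampScale_isMultiplicative : (ampScale n).IsMultiplicative :=
  weightScale_isMultiplicative _ _ _ _ _

lemma unitVec_apply (i j : Fin n) : (unitVec i : Rn n) j = if j = i then 1 else 0 := by
  simp

/-- The pullback under `(x, η, z, s) ↦ (x + s z, η)`. -/
lemma mem_ampParamScale_pullback {m : ℝ × ℕ} {f : Phase n → ℂ} (hf : (temperedScale n).Mem m f) :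
    (ampParamScale n).Mem m (fun q => f (q.1.1.1.1 + q.2 • q.1.1.2, q.1.1.1.2)) := by
  have hX : ContDiff ℝ ∞ (fun q : Amp n × ℝ => q.1.1.1.1 + q.2 • q.1.1.2) := by fun_prop
  have hY : ContDiff ℝ ∞ (fun q : Amp n × ℝ => q.1.1.1.2) := by fun_prop
  have hS := ampParamScale_isMultiplicative (n := n)
  refine SymbolScale.Mem.comp_phase hS (AddMonoidHom.id _) hX hY ?_ ?_ ?_ hf
  · rintro ⟨m, K⟩ f ⟨C, hC⟩
    have hC0 : 0 ≤ C := by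
      have := (norm_nonneg _).trans (hC 0)
      simpa using this
    refine ⟨K, C, fun q => (hC ((q.1.1.1.1, q.1.1.1.2), q.2 • q.1.1.2)).trans ?_⟩
    refine mul_le_mul_of_nonneg_left ?_ hC0
    simp only [AddMonoidHom.id_apply]
    rw [mul_assoc, ← mul_pow]
    gcongr
    exact bracket_smul_le _ _
  · rintro (((i | i) | i) | i) j
    · refine Or.inr ⟨0, by simp [ampParamScale, weightScale, ampShift], ?_⟩
      have : ∀ q, dirD ((ampParamScale n).dir (Sum.inl (Sum.inl (Sum.inl i))))
          (fun q : Amp n × ℝ => q.1.1.1.1 + q.2 • q.1.1.2) q = unitVec i := by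
        intro q
        refine dirD_eq_of_affine hX fun t => ?_
        simp [ampParamScale, weightScale, ampDir, phaseDir]; abel
      simp only [this]
      exact SymbolScale.Mem.const hS _
    · left
      intro q
      rw [dirD_eq_of_affine (w := 0) hX]
      · simp
      · simp [ampParamScale, weightScale, ampDir, phaseDir]
    · refine Or.inr ⟨0, by simp [ampParamScale, weightScale, ampShift], ?_⟩
      have : ∀ q, dirD ((ampParamScale n).dir (Sum.inl (Sum.inr i)))
          (fun q : Amp n × ℝ => q.1.1.1.1 + q.2 • q.1.1.2) q = q.2 • unitVec i := by
        intro q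
        refine dirD_eq_of_affine hX fun t => ?_
        simp [ampParamScale, weightScale, ampDir]
        rw [add_assoc, smul_comm]
      simp only [this]
      refine SymbolScale.Mem.of_dirD_eq_zero ?_ ?_ ?_
      · simp only [PiLp.smul_apply, unitVec_apply, smul_eq_mul]
        exact Complex.ofRealCLM.contDiff.comp (contDiff_snd.mul contDiff_const)
      · refine ⟨1, 1, fun q => ?_⟩
        simp only [PiLp.smul_apply, unitVec_apply, smul_eq_mul]
        split_ifs <;> simp
        positivity
      · intro k
        funext q
        rw [dirD_eq_of_affine (w := 0)]
        · rfl
        · simp only [PiLp.smul_apply, unitVec_apply, smul_eq_mul]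
          exact Complex.ofRealCLM.contDiff.comp (contDiff_snd.mul contDiff_const)
        · simp [ampParamScale, weightScale]
    · left
      intro q
      rw [dirD_eq_of_affine (w := 0) hX]
      · simp
      · simp [ampParamScale, weightScale, ampDir]
  · rintro (((i | i) | i) | i) j
    · left
      intro q
      rw [dirD_eq_of_affine (w := 0) hY]
      · simp
      · simp [ampParamScale, weightScale, ampDir, phaseDir]
    · refine Or.inr ⟨0, by simp [ampParamScale, weightScale, ampShift], ?_⟩
      have : ∀ q, dirD ((ampParamScale n).dir (Sum.inl (Sum.inl (Sum.inr i))))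
          (fun q : Amp n × ℝ => q.1.1.1.2) q = unitVec i := by
        intro q
        refine dirD_eq_of_affine hY fun t => ?_
        simp [ampParamScale, weightScale, ampDir, phaseDir]
      simp only [this]
      exact SymbolScale.Mem.const hS _
    · left
      intro q
      rw [dirD_eq_of_affine (w := 0) hY]
      · simp
      · simp [ampParamScale, weightScale, ampDir]
    · left
      intro q
      rw [dirD_eq_of_affine (w := 0) hY]
      · simp
      · simp [ampParamScale, weightScale, ampDir]

lemma mem_ampGrad (hΦ : IsSymbol 1 Φ) (j : Fin n) :
    (ampScale n).Mem 0 (fun v => (ampGrad Φ v j : ℂ)) := by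
  rw [ampGrad_eq hΦ.1]
  exact mem_ampScale_integral (mem_ampParamScale_pullback (mem_gradComp hΦ j))

lemma contDiff_ampGrad (hΦ : IsSymbol 1 Φ) : ContDiff ℝ ∞ (ampGrad Φ) := by
  rw [contDiff_euclidean]
  intro j
  exact Complex.reCLM.contDiff.comp (mem_ampGrad hΦ j).1

/-- The pullback under `(x, η, z, ζ) ↦ (x + z, η)`. -/
lemma mem_ampScale_pullback {m : ℝ × ℕ} {f : Phase n → ℂ} (hf : (temperedScale n).Mem m f) :
    (ampScale n).Mem m (fun v => f (v.1.1.1 + v.1.2, v.1.1.2)) := by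
  have hX : ContDiff ℝ ∞ (fun v : Amp n => v.1.1.1 + v.1.2) := by fun_prop
  have hY : ContDiff ℝ ∞ (fun v : Amp n => v.1.1.2) := by fun_prop
  have hS := ampScale_isMultiplicative (n := n)
  have hX' : ∀ k q, dirD ((ampScale n).dir k) (fun v : Amp n => v.1.1.1 + v.1.2) q =
      (ampDir k).1.1.1 + (ampDir k).1.2 := by
    intro k q
    refine dirD_eq_of_affine hX fun t => ?_
    simp [ampScale, weightScale]; abel
  have hY' : ∀ k q, dirD ((ampScale n).dir k) (fun v : Amp n => v.1.1.2) q =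
      (ampDir k).1.1.2 := by
    intro k q
    refine dirD_eq_of_affine hY fun t => ?_
    simp [ampScale, weightScale]
  refine SymbolScale.Mem.comp_phase hS (AddMonoidHom.id _) hX hY ?_ ?_ ?_ hf
  · rintro ⟨m, K⟩ f ⟨C, hC⟩
    refine ⟨0, C, fun q => (hC ((q.1.1.1, q.1.1.2), q.1.2)).trans ?_⟩
    simp
  · rintro (((i | i) | i) | i) j <;> simp only [hX']
    · exact Or.inr ⟨0, by simp [ampScale, weightScale, ampShift], SymbolScale.Mem.const hS _⟩
    · left; simp [ampDir, phaseDir]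
    · exact Or.inr ⟨0, by simp [ampScale, weightScale, ampShift], SymbolScale.Mem.const hS _⟩
    · left; simp [ampDir]
  · rintro (((i | i) | i) | i) j <;> simp only [hY']
    · left; simp [ampDir, phaseDir]
    · exact Or.inr ⟨0, by simp [ampScale, weightScale, ampShift], SymbolScale.Mem.const hS _⟩
    · left; simp [ampDir]
    · left; simp [ampDir]

/-- The pullback under `(x, η, z, ζ) ↦ (x, η + ζ + r (x, x + z, η))`. -/
lemma mem_ampScale_shifted (hΦ : IsSymbol 1 Φ) {m : ℝ × ℕ} {f : Phase n → ℂ}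
    (hf : (temperedScale n).Mem m f) :
    (ampScale n).Mem m (fun v => f (v.1.1.1, v.1.1.2 + v.2 + ampGrad Φ v)) := by
  have hX : ContDiff ℝ ∞ (fun v : Amp n => v.1.1.1) := by fun_prop
  have hL : ContDiff ℝ ∞ (fun v : Amp n => v.1.1.2 + v.2) := by fun_prop
  have hr := contDiff_ampGrad hΦ
  have hY : ContDiff ℝ ∞ (fun v : Amp n => v.1.1.2 + v.2 + ampGrad Φ v) := hL.add hr
  have hS := ampScale_isMultiplicative (n := n)
  have hX' : ∀ k q, dirD ((ampScale n).dir k) (fun v : Amp n => v.1.1.1) q =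
      (ampDir k).1.1.1 := by
    intro k q
    refine dirD_eq_of_affine hX fun t => ?_
    simp [ampScale, weightScale]
  have hL' : ∀ k q, dirD ((ampScale n).dir k) (fun v : Amp n => v.1.1.2 + v.2) q =
      (ampDir k).1.1.2 + (ampDir k).2 := by
    intro k q
    refine dirD_eq_of_affine hL fun t => ?_
    simp [ampScale, weightScale]; abel
  have hY' : ∀ k j, (fun q => (dirD ((ampScale n).dir k)
      (fun v : Amp n => v.1.1.2 + v.2 + ampGrad Φ v) q j : ℂ)) =
      (fun _ => ((((ampDir k).1.1.2 + (ampDir k).2) j : ℝ) : ℂ)) +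
        dirD ((ampScale n).dir k) (fun v => (ampGrad Φ v j : ℂ)) := by
    intro k j
    funext q
    have h1 := congrFun (dirD_add hL hr ((ampScale n).dir k)) q
    have h2 : dirD ((ampScale n).dir k) (fun v => (ampGrad Φ v j : ℂ)) q =
        (dirD ((ampScale n).dir k) (ampGrad Φ) q j : ℂ) := by
      rw [dirD_apply hr]
      exact congrFun (dirD_clm (f := fun v => ampGrad Φ v j) ((contDiff_euclidean.1 hr) j)
        Complex.ofRealCLM _) q
    rw [Pi.add_apply, h2, ← Complex.ofReal_add, ← hL' k q]
    congr 1
    exact congrArg (fun w : Rn n => w j) h1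
  refine SymbolScale.Mem.comp_phase hS (AddMonoidHom.id _) hX hY ?_ ?_ ?_ hf
  · rintro ⟨m, K⟩ f ⟨C, hC⟩
    have hC0 : 0 ≤ C := by
      have := (norm_nonneg _).trans (hC 0)
      simpa using this
    refine ⟨0, C, fun q => ?_⟩
    have h := hC ((q.1.1.1, q.1.1.2 + q.2 + ampGrad Φ q), 0)
    rw [add_zero] at h
    refine h.trans ?_
    refine mul_le_mul_of_nonneg_left ?_ hC0
    simp only [norm_zero, add_zero, one_pow, mul_one, AddMonoidHom.id_apply]
    exact le_mul_of_one_le_right (by positivity) (one_le_pow₀ (one_le_bracket _))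
  · rintro (((i | i) | i) | i) j <;> simp only [hX']
    · exact Or.inr ⟨0, by simp [ampScale, weightScale, ampShift], SymbolScale.Mem.const hS _⟩
    · left; simp [ampDir, phaseDir]
    · left; simp [ampDir]
    · left; simp [ampDir]
  · intro k j
    refine Or.inr ⟨_, rfl, ?_⟩
    rw [hY']
    refine SymbolScale.Mem.add ?_ ?_
    · rcases k with ((i | i) | i) | i
      · convert SymbolScale.Mem.zero _ using 1
        funext v; simp [ampDir, phaseDir]
      · exact SymbolScale.Mem.const hS _
      · convert SymbolScale.Mem.zero _ using 1
        funext v; simp [ampDir]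
      · exact SymbolScale.Mem.const hS _
    · have := (mem_ampGrad hΦ j).dirD k
      rwa [zero_add] at this

/-- The amplitude `p`, as a function of the variables `(((x, η), z), ζ)`. -/
def ampFun (Φ : Rn n → Rn n → ℝ) (a b : Rn n → Rn n → ℂ) (v : Amp n) : ℂ :=
  amplitude Φ a b v.1.2 v.2 v.1.1.1 v.1.1.2

/-- The amplitude is a symbol of order `ma + mb` in `x`, with a loss of finitely many powers of
`⟨z⟩` that does not increase under derivatives in `ζ`. -/
theorem mem_ampFun (hΦ : IsSymbol 1 Φ) {a b : Rn n → Rn n → ℂ} {ma mb : ℝ}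
    (ha : IsSymbol ma a) (hb : IsSymbol mb b) :
    ∃ K : ℕ, (ampScale n).Mem (ma + mb, K) (ampFun Φ a b) := by
  obtain ⟨Ka, hKa⟩ := exists_nat_ge |ma|
  obtain ⟨Kb, hKb⟩ := exists_nat_ge |mb|
  have h1 := mem_ampScale_pullback (mem_temperedScale hKa (isSymbol_iff_mem.1 ha))
  have h2 := mem_ampScale_shifted hΦ (mem_temperedScale hKb (isSymbol_iff_mem.1 hb))
  refine ⟨Kb + Ka, ?_⟩
  have := h2.mul ampScale_isMultiplicative h1
  rwa [Prod.mk_add_mk, add_comm mb ma] at this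

end AmplitudeMembership

/-! ### The terms of the expansion -/

section ExpansionTerms

open MeasureTheory

variable {n : ℕ} {Φ : Rn n → Rn n → ℝ} {a b : Rn n → Rn n → ℂ}

/-- The coordinate directions of the variable `z`. -/
def zDir (j : Fin n) : Amp n := ((0, unitVec j), 0)

/-- The coordinate directions of the variable `ζ`. -/
def zetaDir (j : Fin n) : Amp n := (0, unitVec j)

lemma contDiff_ampFun (hΦ : IsSymbol 1 Φ) (ha : ContDiff ℝ ∞ (Function.uncurry a))
    (hb : ContDiff ℝ ∞ (Function.uncurry b)) : ContDiff ℝ ∞ (ampFun Φ a b) := by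
  have h1 : ContDiff ℝ ∞ (fun v : Amp n => v.1.1.2 + v.2 + ampGrad Φ v) :=
    (by fun_prop : ContDiff ℝ ∞ (fun v : Amp n => v.1.1.2 + v.2)).add (contDiff_ampGrad hΦ)
  have h2 : ContDiff ℝ ∞ (fun v : Amp n => (v.1.1.1, v.1.1.2 + v.2 + ampGrad Φ v)) :=
    ContDiff.prodMk (by fun_prop) h1
  have h3 : ContDiff ℝ ∞ (fun v : Amp n => (v.1.1.1 + v.1.2, v.1.1.2)) := by fun_prop
  exact (hb.comp h2).mul (ha.comp h3)

lemma multiDeriv_z {f : Amp n → ℂ} (hf : ContDiff ℝ ∞ f) (α : Fin n → ℕ) (p : Phase n)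
    (z ζ : Rn n) : multiDeriv α (fun z => f ((p, z), ζ)) z = multiDir zDir α f ((p, z), ζ) := by
  have hS : ContDiff ℝ ∞ (fun z : Rn n => (((p, z), ζ) : Amp n)) := by fun_prop
  rw [multiDeriv_eq_multiDir]
  exact congrFun (multiDir_comp hf hS
    (fun j q => dirD_eq_of_affine hS fun t => by simp [zDir]) α) z

lemma multiDeriv_zeta {f : Amp n → ℂ} (hf : ContDiff ℝ ∞ f) (α : Fin n → ℕ) (p : Phase n)
    (z ζ : Rn n) : multiDeriv α (fun ζ => f ((p, z), ζ)) ζ = multiDir zetaDir α f ((p, z), ζ) := by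
  have hS : ContDiff ℝ ∞ (fun ζ : Rn n => (((p, z), ζ) : Amp n)) := by fun_prop
  rw [multiDeriv_eq_multiDir]
  exact congrFun (multiDir_comp hf hS
    (fun j q => dirD_eq_of_affine hS fun t => by simp [zetaDir]) α) ζ

lemma multiDir_const_mul {V : Type*} [NormedAddCommGroup V] [NormedSpace ℝ V] {f : V → ℂ}
    (hf : ContDiff ℝ ∞ f) (c : ℂ) (e : Fin n → V) (α : Fin n → ℕ) :
    multiDir e α (fun p => c * f p) = fun p => c * multiDir e α f p :=
  multiDir_clm hf (ContinuousLinearMap.mul ℝ ℂ c) e α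

lemma expansionTerm_eq (hp : ContDiff ℝ ∞ (ampFun Φ a b)) (α : Fin n → ℕ) (x η : Rn n) :
    expansionTerm Φ a b α x η = (-Complex.I) ^ order α *
      multiDir zetaDir α (multiDir zDir α (ampFun Φ a b)) (((x, η), 0), 0) := by
  unfold expansionTerm multiD
  have h1 : ∀ ζ, multiDeriv α (fun z => amplitude Φ a b z ζ x η) 0 =
      multiDir zDir α (ampFun Φ a b) (((x, η), 0), ζ) := fun ζ =>
    multiDeriv_z hp α (x, η) 0 ζ
  simp only [h1]
  have hs := contDiff_multiDir hp zDir α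
  rw [← multiDeriv_zeta hs, multiDeriv_eq_multiDir, multiDeriv_eq_multiDir, multiDir_const_mul]
  exact hs.comp (by fun_prop : ContDiff ℝ ∞ (fun ζ : Rn n => ((((x, η), 0), ζ) : Amp n)))

lemma mem_symbolScale_restrict {m : ℝ × ℕ} {f : Amp n → ℂ} (hf : (ampScale n).Mem m f) :
    (symbolScale n).Mem m.1 (fun p => f ((p, 0), 0)) := by
  have hT : ContDiff ℝ ∞ (fun p : Phase n => (((p, 0), 0) : Amp n)) := by fun_prop
  have hD : ∀ k q, dirD ((symbolScale n).dir k) (fun p : Phase n => (((p, 0), 0) : Amp n)) q =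
      ((phaseDir k, 0), 0) := fun k q => dirD_eq_of_affine hT fun t => by simp [symbolScale]
  refine hf.comp symbolScale_isMultiplicative (AddMonoidHom.fst ℝ ℕ) hT ?_
    (fun k i _ => ampCoord ((phaseDir k, 0), 0) i) (fun k q => ?_) ?_
  · rintro ⟨m, K⟩ f ⟨L, C, hC⟩
    exact ⟨C, fun p => by simpa using hC ((p, 0), 0)⟩
  · rw [hD]; exact (sum_ampCoord _).symm
  · rintro (k | k) (((i | i) | i) | i)
    · exact Or.inr ⟨0, by simp [ampScale, symbolScale, weightScale, ampShift],
        SymbolScale.Mem.const symbolScale_isMultiplicative _⟩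
    · left; simp [ampCoord, phaseCoord, phaseDir]
    · left; simp [ampCoord]
    · left; simp [ampCoord]
    · left; simp [ampCoord, phaseCoord, phaseDir]
    · exact Or.inr ⟨0, by simp [ampScale, symbolScale, weightScale, ampShift],
        SymbolScale.Mem.const symbolScale_isMultiplicative _⟩
    · left; simp [ampCoord]
    · left; simp [ampCoord]

lemma SymbolScale.Mem.const_mul {ι V M : Type*} [NormedAddCommGroup V] [NormedSpace ℝ V]
    [AddCommMonoid M] {S : SymbolScale ι V M} (hS : S.IsMultiplicative) (c : ℂ) {m : M}
    {f : V → ℂ} (hf : S.Mem m f) : S.Mem m (fun p => c * f p) := by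
  have := (SymbolScale.Mem.const hS c).mul hS hf
  rwa [zero_add] at this

theorem isSymbol_expansionTerm (hΦ : IsSymbol 1 Φ) {ma mb : ℝ} (ha : IsSymbol ma a)
    (hb : IsSymbol mb b) (α : Fin n → ℕ) :
    IsSymbol (ma + mb - order α) (expansionTerm Φ a b α) := by
  obtain ⟨K, hp⟩ := mem_ampFun hΦ ha hb
  have h1 := SymbolScale.Mem.multiDir (e := zDir) (s := (-1, 1))
    (fun j => ⟨Sum.inl (Sum.inr j), rfl, rfl⟩) α hp
  have h2 := SymbolScale.Mem.multiDir (e := zetaDir) (s := 0)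
    (fun j => ⟨Sum.inr j, rfl, rfl⟩) α h1
  have h3 := (mem_symbolScale_restrict h2).const_mul symbolScale_isMultiplicative
    ((-Complex.I) ^ order α)
  rw [isSymbol_iff_mem]
  convert h3 using 1
  · simp; ring
  · funext p
    exact expansionTerm_eq hp.1 α p.1 p.2

lemma meanGrad_self (Φ : Rn n → Rn n → ℝ) (x η : Rn n) : meanGrad Φ x x η = gradX Φ x η := by
  unfold meanGrad
  have : ∀ τ : ℝ, (1 - τ) • x + τ • x = x := fun τ => by module
  simp [this]

theorem expansionTerm_zero (Φ : Rn n → Rn n → ℝ) (a b : Rn n → Rn n → ℂ) (x η : Rn n) :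
    expansionTerm Φ a b 0 x η = b x (η + gradX Φ x η) * a x η := by
  simp [expansionTerm, multiD, multiDeriv_eq_multiDir, multiDir_zero, order, amplitude,
    meanGrad_self]

lemma exists_eq_single_of_order_eq_one {α : Fin n → ℕ} (h : order α = 1) :
    ∃ j, α = Pi.single j 1 := by
  have h0 : ∃ j, α j ≠ 0 := by
    by_contra! h0
    simp [order, h0] at h
  obtain ⟨j, hj⟩ := h0
  refine ⟨j, ?_⟩
  have h1 : α j + ∑ i ∈ Finset.univ.erase j, α i = 1 := by
    rw [Finset.add_sum_erase _ _ (Finset.mem_univ j)]; exact h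
  have h2 : ∑ i ∈ Finset.univ.erase j, α i = 0 := by omega
  rw [Finset.sum_eq_zero_iff] at h2
  funext i
  by_cases hij : i = j
  · subst hij; simp; omega
  · rw [Pi.single_eq_of_ne hij]; exact h2 i (by simp [hij])

lemma partialDeriv_fst {F : Type*} [NormedAddCommGroup F] [NormedSpace ℝ F] {g : Phase n → F}
    (hg : ContDiff ℝ ∞ g) (j : Fin n) (x ξ : Rn n) :
    partialDeriv j (fun y => g (y, ξ)) x = dirD (unitVec j, 0) g (x, ξ) := by
  have := multiDeriv_fst hg (Pi.single j 1) x ξ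
  rwa [multiDir_single _ hg, multiDeriv_eq_multiDir, multiDir_single] at this
  exact hg.comp (contDiff_prodMk_left ξ)

lemma partialDeriv_snd {F : Type*} [NormedAddCommGroup F] [NormedSpace ℝ F] {g : Phase n → F}
    (hg : ContDiff ℝ ∞ g) (j : Fin n) (x ξ : Rn n) :
    partialDeriv j (fun ζ => g (x, ζ)) ξ = dirD (0, unitVec j) g (x, ξ) := by
  have := multiDeriv_snd hg (Pi.single j 1) x ξ
  rwa [multiDir_single _ hg, multiDeriv_eq_multiDir, multiDir_single] at this
  exact hg.comp (contDiff_prodMk_right x)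

/-- The derivative of the segment average of the gradient at the diagonal is half the derivative
of the gradient. -/
lemma dirD_ampGrad_diag (hΦ : IsSymbol 1 Φ) (j k : Fin n) (p : Phase n) (ζ : Rn n) :
    (dirD (zDir j) (ampGrad Φ) ((p, 0), ζ) k : ℂ) =
      1 / 2 * dirD (unitVec j, 0) (gradComp Φ k) p := by
  have hr := contDiff_ampGrad hΦ
  have hg := (mem_gradComp hΦ k).1
  have hT : ContDiff ℝ ∞ (fun q : Amp n × ℝ => (q.1.1.1.1 + q.2 • q.1.1.2, q.1.1.1.2)) := by
    fun_prop
  have hD : ∀ s : ℝ, dirD (zDir j, 0)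
      (fun q : Amp n × ℝ => (q.1.1.1.1 + q.2 • q.1.1.2, q.1.1.1.2)) (((p, 0), ζ), s) =
      s • (unitVec j, 0) := by
    intro s
    refine dirD_eq_of_affine hT fun t => ?_
    refine Prod.ext ?_ ?_ <;> simp [zDir, smul_comm s t]
  have h2 : (dirD (zDir j) (ampGrad Φ) ((p, 0), ζ) k : ℂ) =
      dirD (zDir j) (fun v => (ampGrad Φ v k : ℂ)) ((p, 0), ζ) := by
    rw [dirD_apply hr]
    exact (congrFun (dirD_clm (f := fun v => ampGrad Φ v k) ((contDiff_euclidean.1 hr) k)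
      Complex.ofRealCLM _) _).symm
  rw [h2, ampGrad_eq hΦ.1]
  have h3 := dirD_setIntegral_compact (μ := volume) (isCompact_Icc (a := (0 : ℝ)) (b := 1))
    (hg.comp hT) (zDir j)
  refine (congrFun h3 ((p, 0), ζ)).trans ?_
  have h4 : ∀ s : ℝ, dirD (zDir j, (0 : ℝ))
      (gradComp Φ k ∘ fun q : Amp n × ℝ => (q.1.1.1.1 + q.2 • q.1.1.2, q.1.1.1.2))
      (((p, 0), ζ), s) = (s : ℂ) * dirD (unitVec j, 0) (gradComp Φ k) p := by
    intro s
    have := dirD_comp hg hT (zDir j, (0 : ℝ)) (((p, 0), ζ), s)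
    refine this.trans ?_
    rw [hD, map_smul]
    simp [dirD]
  simp only [h4]
  rw [integral_mul_const]
  congr 1
  rw [integral_Icc_eq_integral_Ioc, ← intervalIntegral.integral_of_le zero_le_one,
    intervalIntegral.integral_ofReal, integral_id]
  norm_num

theorem expansionTerm_of_order_eq_one (hΦ : IsSymbol 1 Φ)
    (ha : ContDiff ℝ ∞ (Function.uncurry a)) (hb : ContDiff ℝ ∞ (Function.uncurry b))
    {α : Fin n → ℕ} (hα : order α = 1) (x η : Rn n) :
    expansionTerm Φ a b α x η =
      multiDeriv α (b x) (η + gradX Φ x η) * multiD α (fun y => a y η) x +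
        (∑ k : Fin n, partialDeriv k (multiDeriv α (b x)) (η + gradX Φ x η) *
          ((1 / 2) * partialDeriv k (multiD α (fun y => (Φ y η : ℂ))) x)) * a x η := by
  obtain ⟨j, rfl⟩ := exists_eq_single_of_order_eq_one hα
  have hp := contDiff_ampFun hΦ ha hb
  have hΦc : ContDiff ℝ ∞ (Function.uncurry fun y η => (Φ y η : ℂ)) :=
    Complex.ofRealCLM.contDiff.comp hΦ.1
  rw [expansionTerm_eq hp, hα, pow_one, multiDir_single _ hp,
    multiDir_single _ (contDiff_dirD hp _)]
  have hb1 : ∀ ξ, multiDeriv (Pi.single j 1) (b x) ξ =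
      dirD (0, unitVec j) (Function.uncurry b) (x, ξ) := fun ξ => by
    rw [← multiDir_single (fun j => ((0 : Rn n), unitVec j)) hb]
    exact multiDeriv_snd hb _ x ξ
  have hΦ1 : multiD (Pi.single j 1) (fun y => (Φ y η : ℂ)) = fun y => -Complex.I *
      dirD (unitVec j, 0) (Function.uncurry fun y η => (Φ y η : ℂ)) (y, η) := by
    funext y
    rw [multiD, hα, pow_one, ← multiDir_single (fun j => (unitVec j, (0 : Rn n))) hΦc]
    congr 1
    exact multiDeriv_fst hΦc _ y η
  have ha1 : multiD (Pi.single j 1) (fun y => a y η) x = -Complex.I *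
      dirD (unitVec j, 0) (Function.uncurry a) (x, η) := by
    rw [multiD, hα, pow_one, ← multiDir_single (fun j => (unitVec j, (0 : Rn n))) ha]
    congr 1
    exact multiDeriv_fst ha _ x η
  have hb2 : ∀ k ξ, partialDeriv k (multiDeriv (Pi.single j 1) (b x)) ξ =
      dirD (0, unitVec j) (dirD (0, unitVec k) (Function.uncurry b)) (x, ξ) := fun k ξ => by
    rw [dirD_comm hb, ← partialDeriv_snd (contDiff_dirD hb _)]
    congr 1
    funext ξ
    exact hb1 ξ
  have hΦ2 : ∀ k, partialDeriv k (multiD (Pi.single j 1) (fun y => (Φ y η : ℂ))) x =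
      -Complex.I * dirD (unitVec j, 0) (gradComp Φ k) (x, η) := fun k => by
    have hgc : gradComp Φ k = dirD (unitVec k, 0) (Function.uncurry fun y η => (Φ y η : ℂ)) := by
      funext p
      rw [gradComp, gradX_apply hΦ.1]
      exact (congrFun (dirD_clm hΦ.1 Complex.ofRealCLM _) p).symm
    rw [hΦ1, hgc, dirD_comm hΦc, ← partialDeriv_fst (contDiff_dirD hΦc _)]
    simp only [partialDeriv]
    rw [fderiv_const_mul]
    · simp
    · exact (differentiable_of_smooth ((contDiff_dirD hΦc _).comp (contDiff_prodMk_left η)) x)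
  rw [hb1, ha1]
  simp only [hb2, hΦ2]
  -- the first derivative in `z`, at `z = 0`, as a function of `ζ`
  have hz : ∀ ζ, dirD (zDir j) (ampFun Φ a b) (((x, η), 0), ζ) =
      (∑ k, 1 / 2 * dirD (unitVec j, 0) (gradComp Φ k) (x, η) * a x η *
        dirD (0, unitVec k) (Function.uncurry b) (x, η + ζ + gradX Φ x η)) +
      dirD (unitVec j, 0) (Function.uncurry a) (x, η) *
        Function.uncurry b (x, η + ζ + gradX Φ x η) := by
    intro ζ
    have hL : ContDiff ℝ ∞ (fun v : Amp n => v.1.1.2 + v.2) := by fun_prop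
    have hY : ContDiff ℝ ∞ (fun v : Amp n => v.1.1.2 + v.2 + ampGrad Φ v) :=
      hL.add (contDiff_ampGrad hΦ)
    have hXY : ContDiff ℝ ∞ (fun v : Amp n => (v.1.1.1, v.1.1.2 + v.2 + ampGrad Φ v)) :=
      ContDiff.prodMk (by fun_prop) hY
    have hA : ContDiff ℝ ∞ (fun v : Amp n => (v.1.1.1 + v.1.2, v.1.1.2)) := by fun_prop
    have hsplit : ampFun Φ a b =
        (fun v => Function.uncurry b (v.1.1.1, v.1.1.2 + v.2 + ampGrad Φ v)) *
          fun v => Function.uncurry a (v.1.1.1 + v.1.2, v.1.1.2) := rfl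
    have hgrad : ampGrad Φ (((x, η), 0), ζ) = gradX Φ x η := by simp [ampGrad, meanGrad_self]
    have hDA : dirD (zDir j) (fun v : Amp n => Function.uncurry a (v.1.1.1 + v.1.2, v.1.1.2)) =
        fun v => dirD (unitVec j, 0) (Function.uncurry a) (v.1.1.1 + v.1.2, v.1.1.2) :=
      dirD_comp_const ha hA fun q => dirD_eq_of_affine hA fun t => by simp [zDir, add_assoc]
    have hDXY : dirD (zDir j) (fun v : Amp n => (v.1.1.1, v.1.1.2 + v.2 + ampGrad Φ v))
        (((x, η), 0), ζ) =
        ∑ k, dirD (zDir j) (ampGrad Φ) (((x, η), 0), ζ) k • ((0 : Rn n), (unitVec k : Rn n)) := by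
      have h1 : dirD (zDir j) (fun v : Amp n => (v.1.1.1, v.1.1.2 + v.2 + ampGrad Φ v))
          (((x, η), 0), ζ) = (0, dirD (zDir j) (ampGrad Φ) (((x, η), 0), ζ)) := by
        have e1 : dirD (zDir j) (fun v : Amp n => v.1.1.1) (((x, η), 0), ζ) = 0 :=
          dirD_eq_of_affine (by fun_prop) fun t => by simp [zDir]
        have e2 : dirD (zDir j) (fun v : Amp n => v.1.1.2 + v.2) (((x, η), 0), ζ) = 0 :=
          dirD_eq_of_affine hL fun t => by simp [zDir]
        have e3 := congrFun (dirD_add hL (contDiff_ampGrad hΦ) (zDir j)) (((x, η), 0), ζ)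
        rw [Pi.add_apply, e2, zero_add] at e3
        simp only [dirD] at e1 e3 ⊢
        rw [DifferentiableAt.fderiv_prodMk (by fun_prop) (differentiable_of_smooth hY _)]
        exact Prod.ext e1 e3
      rw [h1]
      refine Prod.ext ?_ ?_
      · simp [Prod.fst_sum]
      · simp [Prod.snd_sum, sum_smul_unitVec]
    have hDB := dirD_comp hb hXY (zDir j) (((x, η), 0), ζ)
    rw [hDXY, map_sum] at hDB
    have hB' : ContDiff ℝ ∞
        (fun v : Amp n => Function.uncurry b (v.1.1.1, v.1.1.2 + v.2 + ampGrad Φ v)) := hb.comp hXY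
    have hA' : ContDiff ℝ ∞
        (fun v : Amp n => Function.uncurry a (v.1.1.1 + v.1.2, v.1.1.2)) := ha.comp hA
    rw [hsplit, dirD_mul hB' hA', Pi.add_apply, Pi.mul_apply, Pi.mul_apply,
      hDB, hDA, Finset.sum_mul]
    simp only [hgrad, add_zero, map_smul]
    congr 1
    · refine Finset.sum_congr rfl fun k _ => ?_
      rw [Complex.real_smul, dirD_ampGrad_diag hΦ]
      simp only [dirD, Function.uncurry_apply_pair]
      ring
    · ring
  have hS : ContDiff ℝ ∞ (fun ζ : Rn n => (x, η + ζ + gradX Φ x η)) := by fun_prop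
  have hSD : ∀ q, dirD (unitVec j) (fun ζ : Rn n => (x, η + ζ + gradX Φ x η)) q =
      (0, unitVec j) := fun q => dirD_eq_of_affine hS fun t => by simp; abel
  have hcomp : ∀ g : Phase n → ℂ, ContDiff ℝ ∞ g →
      dirD (unitVec j) (fun ζ => g (x, η + ζ + gradX Φ x η)) 0 =
        dirD (0, unitVec j) g (x, η + gradX Φ x η) := fun g hg => by
    rw [dirD_comp_const hg hS hSD]; simp
  have hzeta : dirD (zetaDir j) (dirD (zDir j) (ampFun Φ a b)) (((x, η), 0), 0) =
      dirD (unitVec j) (fun ζ => dirD (zDir j) (ampFun Φ a b) (((x, η), 0), ζ)) 0 := by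
    have hS : ContDiff ℝ ∞ (fun ζ : Rn n => ((((x, η), 0), ζ) : Amp n)) := by fun_prop
    rw [dirD_comp_const (contDiff_dirD hp _) hS (w := zetaDir j)]
    intro q
    exact dirD_eq_of_affine hS fun t => by simp [zetaDir]
  rw [hzeta]
  simp only [hz]
  have hbs : ∀ k, ContDiff ℝ ∞ (fun ζ => dirD (0, unitVec k) (Function.uncurry b)
      (x, η + ζ + gradX Φ x η)) := fun k => (contDiff_dirD hb _).comp hS
  have hbs' : ContDiff ℝ ∞ (fun ζ => Function.uncurry b (x, η + ζ + gradX Φ x η)) := hb.comp hS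
  have hadd := congrFun (dirD_add (f := fun ζ => ∑ k, 1 / 2 *
      dirD (unitVec j, 0) (gradComp Φ k) (x, η) * a x η *
        dirD (0, unitVec k) (Function.uncurry b) (x, η + ζ + gradX Φ x η))
    (g := fun ζ => dirD (unitVec j, 0) (Function.uncurry a) (x, η) *
        Function.uncurry b (x, η + ζ + gradX Φ x η))
    (ContDiff.sum fun k _ => contDiff_const.mul (hbs k)) (contDiff_const.mul hbs') (unitVec j)) 0
  refine (congrArg (fun w => -Complex.I * w) hadd).trans ?_
  rw [Pi.add_apply, dirD_const_mul hbs', dirD_finsetSum _ fun k _ => contDiff_const.mul (hbs k)]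
  simp only [dirD_const_mul (hbs _), hcomp _ hb, hcomp _ (contDiff_dirD hb _)]
  rw [mul_add, Finset.mul_sum, Finset.sum_mul, add_comm]
  congr 1
  · ring
  · refine Finset.sum_congr rfl fun k _ => by ring

end ExpansionTerms

/-! ### Dilation of the amplitude in `z` -/

section DilatedAmplitude

open MeasureTheory

variable {n : ℕ}

/-- The space of the variables `((((x, η), t), z), ζ)`. -/
abbrev Dil (n : ℕ) := ((Phase n × ℝ) × Rn n) × Rn n

/-- The directions of the parameters `((x, η), t)`. -/
def paramDir : (Fin n ⊕ Fin n) ⊕ Unit → Phase n × ℝ :=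
  Sum.elim (fun i => (phaseDir i, 0)) (fun _ => (0, 1))

/-- The directions of differentiation `x`, `η`, `t`, `ζ` in the space `Dil n`. -/
def dilDir : ((Fin n ⊕ Fin n) ⊕ Unit) ⊕ Fin n → Dil n :=
  Sum.elim (fun i => ((paramDir i, 0), 0)) (fun j => (0, unitVec j))

/-- The change of the order under the derivatives in the directions `dilDir`: each derivative in
`x` or `t` lowers the order in `x` by one. The derivative in `t` costs two powers of `⟨z⟩`: one for
the factor `z`, one for the derivative of the amplitude in `z`. -/
def dilShift : ((Fin n ⊕ Fin n) ⊕ Unit) ⊕ Fin n → ℝ × ℕ :=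
  Sum.elim (Sum.elim (Sum.elim (fun _ => (-1, 1)) (fun _ => 0)) (fun _ => (-1, 2))) (fun _ => 0)

/-- The scale of functions of `((((x, η), t), z), ζ)` with the estimates
`|f| ≤ C ⟨x⟩^m ⟨z⟩^K ⟨t⟩^L`. -/
def dilScale (n : ℕ) := weightScale (dilDir (n := n)) dilShift (fun q => q.1.1.1.1)
  (fun q => q.1.2) (fun q => q.1.1.2)

/-- The dilation `f (t z, ζ; x, η)` of a function of `(((x, η), z), ζ)`. -/
def dilate (f : Amp n → ℂ) (q : Dil n) : ℂ := f ((q.1.1.1, q.1.1.2 • q.1.2), q.2)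

lemma contDiff_dilation :
    ContDiff ℝ ∞ (fun q : Dil n => (((q.1.1.1, q.1.1.2 • q.1.2), q.2) : Amp n)) := by
  fun_prop

/-- A derivative in `t` of a dilation produces a factor `z` and a derivative in `z`. The latter
lowers the order in `x`, so that Taylor expansion in `t` is an expansion in decreasing order. -/
lemma mem_dilate {m : ℝ × ℕ} {f : Amp n → ℂ} (hf : (ampScale n).Mem m f) :
    (dilScale n).Mem m (dilate f) := by
  have hS : (dilScale n).IsMultiplicative := weightScale_isMultiplicative _ _ _ _ _
  have hT := contDiff_dilation (n := n)
  have hD : ∀ i q, dirD ((dilScale n).dir (Sum.inl (Sum.inl i)))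
      (fun q : Dil n => (((q.1.1.1, q.1.1.2 • q.1.2), q.2) : Amp n)) q = ((phaseDir i, 0), 0) :=
    fun i q => dirD_eq_of_affine hT fun t => by
      simp [dilScale, weightScale, dilDir, paramDir]
  have hDt : ∀ q, dirD ((dilScale n).dir (Sum.inl (Sum.inr ())))
      (fun q : Dil n => (((q.1.1.1, q.1.1.2 • q.1.2), q.2) : Amp n)) q = ((0, q.1.2), 0) :=
    fun q => dirD_eq_of_affine hT fun t => by
      simp [dilScale, weightScale, dilDir, paramDir, add_smul]
  have hDζ : ∀ j q, dirD ((dilScale n).dir (Sum.inr j))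
      (fun q : Dil n => (((q.1.1.1, q.1.1.2 • q.1.2), q.2) : Amp n)) q = (0, unitVec j) :=
    fun j q => dirD_eq_of_affine hT fun t => by
      simp [dilScale, weightScale, dilDir]
  refine hf.comp hS (AddMonoidHom.id _) hT ?_
    (fun k i q => ampCoord (dirD ((dilScale n).dir k)
      (fun q : Dil n => (((q.1.1.1, q.1.1.2 • q.1.2), q.2) : Amp n)) q) i)
    (fun k q => (sum_ampCoord _).symm) ?_
  · rintro ⟨m, K⟩ f ⟨L, C, hC⟩
    have hC0 : 0 ≤ C := by
      have := (norm_nonneg _).trans (hC 0)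
      simpa using this
    refine ⟨K, C, fun q => (hC _).trans ?_⟩
    refine mul_le_mul_of_nonneg_left ?_ hC0
    simp only [norm_zero, add_zero, one_pow, mul_one, AddMonoidHom.id_apply]
    rw [mul_assoc, ← mul_pow]
    gcongr
    exact bracket_smul_le _ _
  · rintro (((k | k) | k) | k) (((i | i) | i) | i)
    · refine Or.inr ⟨0, by simp [dilScale, ampScale, weightScale, ampShift, dilShift], ?_⟩
      simp only [hD]
      exact SymbolScale.Mem.const hS _
    · left; intro q; simp only [hD]; simp [ampCoord, phaseCoord, phaseDir]
    · left; intro q; simp only [hD]; simp [ampCoord]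
    · left; intro q; simp only [hD]; simp [ampCoord]
    · left; intro q; simp only [hD]; simp [ampCoord, phaseCoord, phaseDir]
    · refine Or.inr ⟨0, by simp [dilScale, ampScale, weightScale, ampShift, dilShift], ?_⟩
      simp only [hD]
      exact SymbolScale.Mem.const hS _
    · left; intro q; simp only [hD]; simp [ampCoord]
    · left; intro q; simp only [hD]; simp [ampCoord]
    · left; intro q; simp only [hDt]; simp [ampCoord, phaseCoord]
    · left; intro q; simp only [hDt]; simp [ampCoord, phaseCoord]
    · refine Or.inr ⟨(0, 1), by simp [dilScale, ampScale, weightScale, ampShift, dilShift], ?_⟩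
      simp only [hDt]
      simp only [ampCoord, Sum.elim_inl, Sum.elim_inr]
      have hc : ContDiff ℝ ∞ (fun q : Dil n => q.1.2 i) := by fun_prop
      have hc' : ContDiff ℝ ∞ (fun q : Dil n => (q.1.2 i : ℂ)) := Complex.ofRealCLM.contDiff.comp hc
      refine SymbolScale.Mem.of_dirD_eq_zero hc' ⟨0, 1, fun q => ?_⟩ fun k => ?_
      · have := PiLp.norm_apply_le q.1.2 i
        simp only [Real.norm_eq_abs] at this
        simp; linarith
      · funext q
        rcases k with k | k
        · exact dirD_eq_of_affine hc' fun t => by simp [dilScale, weightScale, dilDir]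
        · exact dirD_eq_of_affine hc' fun t => by simp [dilScale, weightScale, dilDir]
    · left; intro q; simp only [hDt]; simp [ampCoord]
    · left; intro q; simp only [hDζ]; simp [ampCoord, phaseCoord]
    · left; intro q; simp only [hDζ]; simp [ampCoord, phaseCoord]
    · left; intro q; simp only [hDζ]; simp [ampCoord]
    · refine Or.inr ⟨0, by simp [dilScale, ampScale, weightScale, ampShift, dilShift], ?_⟩
      simp only [hDζ]
      exact SymbolScale.Mem.const hS _

end DilatedAmplitude

/-! ### The oscillatory integral in `ζ` -/

section OscillatoryIntegral

open MeasureTheory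

variable {n : ℕ}

/-- `f (·, ζ)` vanishes for `|ζ| > R`. -/
def SuppBall {W : Type*} (R : ℝ) (f : W × Rn n → ℂ) : Prop :=
  ∀ q ζ, ζ ∉ Metric.closedBall 0 R → f (q, ζ) = 0

lemma SuppBall.dirD {W : Type*} [NormedAddCommGroup W] [NormedSpace ℝ W] {R : ℝ}
    {f : W × Rn n → ℂ} (hf : SuppBall R f) (v : W × Rn n) : SuppBall R (dirD v f) := by
  intro q ζ hζ
  have h1 : ∀ᶠ p : W × Rn n in nhds (q, ζ), p.2 ∉ Metric.closedBall 0 R :=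
    (Metric.isClosed_closedBall.isOpen_compl.preimage continuous_snd).mem_nhds hζ
  have h2 : f =ᶠ[nhds (q, ζ)] fun _ => 0 := h1.mono fun p hp => hf p.1 p.2 hp
  rw [OscSymbol.dirD, h2.fderiv_eq]
  simp

/-- The oscillating factor `e^{-i⟨z, ζ⟩}`. -/
def oscKernel (z ζ : Rn n) : ℂ := Complex.exp (-Complex.I * (inner ℝ z ζ : ℝ))

lemma norm_oscKernel (z ζ : Rn n) : ‖oscKernel z ζ‖ = 1 := by
  rw [oscKernel, Complex.norm_exp]; simp

lemma contDiff_oscKernel : ContDiff ℝ ∞ (fun p : Rn n × Rn n => oscKernel p.1 p.2) := by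
  unfold oscKernel
  have : ContDiff ℝ ∞ (fun p : Rn n × Rn n => ((inner ℝ p.1 p.2 : ℝ) : ℂ)) :=
    Complex.ofRealCLM.contDiff.comp (contDiff_fst.inner ℝ contDiff_snd)
  exact (contDiff_const.mul this).cexp

lemma fderiv_oscKernel (z ζ : Rn n) (j : Fin n) :
    fderiv ℝ (fun ζ => oscKernel z ζ) ζ (unitVec j) = -Complex.I * z j * oscKernel z ζ := by
  have h1 : HasFDerivAt (fun ζ : Rn n => ((inner ℝ z ζ : ℝ) : ℂ))
      (Complex.ofRealCLM.comp (innerSL ℝ z)) ζ :=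
    Complex.ofRealCLM.hasFDerivAt.comp ζ (innerSL ℝ z).hasFDerivAt
  have h2 := (h1.const_mul (-Complex.I)).cexp
  unfold oscKernel
  rw [h2.fderiv]
  simp [EuclideanSpace.inner_single_right]
  ring

/-- `∫ e^{-i⟨z, ζ⟩} f (((x, η), t, z), ζ) dζ`. -/
def oscInt (f : Dil n → ℂ) (q : (Phase n × ℝ) × Rn n) : ℂ :=
  ∫ ζ, oscKernel q.2 ζ * f (q, ζ)

variable {R : ℝ} {f : Dil n → ℂ}

lemma oscInt_eq (hf : SuppBall R f) : oscInt f = fun q =>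
    ∫ ζ in Metric.closedBall 0 R, oscKernel q.2 ζ * f (q, ζ) := by
  funext q
  refine (setIntegral_eq_integral_of_forall_compl_eq_zero fun ζ hζ => ?_).symm
  rw [hf q ζ hζ, mul_zero]

lemma contDiff_oscKernel_mul (hf : ContDiff ℝ ∞ f) :
    ContDiff ℝ ∞ (fun p : Dil n => oscKernel p.1.2 p.2 * f p) :=
  (contDiff_oscKernel.comp
    (by fun_prop : ContDiff ℝ ∞ (fun p : Dil n => (p.1.2, p.2)))).mul hf

lemma contDiff_oscInt (hf : ContDiff ℝ ∞ f) (hR : SuppBall R f) : ContDiff ℝ ∞ (oscInt f) := by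
  rw [oscInt_eq hR]
  exact contDiff_setIntegral_compact (isCompact_closedBall 0 R) (contDiff_oscKernel_mul hf)

lemma dirD_oscInt (hf : ContDiff ℝ ∞ f) (hR : SuppBall R f) (w : Phase n × ℝ) :
    dirD (w, 0) (oscInt f) = oscInt (dirD ((w, 0), 0) f) := by
  rw [oscInt_eq hR, oscInt_eq (hR.dirD _)]
  refine (dirD_setIntegral_compact (μ := volume) (isCompact_closedBall 0 R)
    (contDiff_oscKernel_mul hf) (w, 0)).trans ?_
  have hk : ContDiff ℝ ∞ (fun p : Dil n => oscKernel p.1.2 p.2) :=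
    contDiff_oscKernel.comp (by fun_prop : ContDiff ℝ ∞ (fun p : Dil n => (p.1.2, p.2)))
  have h1 : dirD ((w, 0), 0) (fun p : Dil n => oscKernel p.1.2 p.2) = 0 := by
    funext q
    exact dirD_eq_of_affine hk fun t => by simp
  have h2 := dirD_mul hk hf ((w, 0), 0)
  rw [h1, zero_mul, zero_add] at h2
  funext q
  congr 1
  funext ζ
  exact congrFun h2 (q, ζ)

lemma integrable_of_support_closedBall {g : Rn n → ℂ} (hg : Continuous g)
    (h : ∀ ζ, ζ ∉ Metric.closedBall 0 R → g ζ = 0) : Integrable g :=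
  hg.integrable_of_hasCompactSupport
    (HasCompactSupport.intro (isCompact_closedBall 0 R) h)

lemma dirD_eq_zero_of_support {g : Rn n → ℂ} (h : ∀ ζ, ζ ∉ Metric.closedBall 0 R → g ζ = 0)
    (v : Rn n) {ζ : Rn n} (hζ : ζ ∉ Metric.closedBall 0 R) : dirD v g ζ = 0 := by
  have h2 : g =ᶠ[nhds ζ] fun _ => 0 :=
    Filter.mem_of_superset (Metric.isClosed_closedBall.isOpen_compl.mem_nhds hζ) h
  rw [dirD, h2.fderiv_eq]; simp

/-- Integration by parts in `ζ`. -/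
lemma mul_integral_oscKernel {g : Rn n → ℂ} (hg : ContDiff ℝ ∞ g)
    (h : ∀ ζ, ζ ∉ Metric.closedBall 0 R → g ζ = 0) (z : Rn n) (j : Fin n) :
    (z j : ℂ) * ∫ ζ, oscKernel z ζ * g ζ =
      -Complex.I * ∫ ζ, oscKernel z ζ * dirD (unitVec j) g ζ := by
  have hk : ContDiff ℝ ∞ (fun ζ : Rn n => oscKernel z ζ) :=
    contDiff_oscKernel.comp (contDiff_prodMk_right z)
  have hg' : ContDiff ℝ ∞ (dirD (unitVec j) g) := contDiff_dirD hg _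
  have h' := fun ζ hζ => dirD_eq_zero_of_support h (unitVec j) (ζ := ζ) hζ
  have hfd : ∀ ζ, fderiv ℝ (fun ζ => oscKernel z ζ) ζ (unitVec j) =
    -Complex.I * z j * oscKernel z ζ := fun ζ => fderiv_oscKernel z ζ j
  have := integral_mul_fderiv_eq_neg_fderiv_mul_of_integrable (μ := volume)
    (f := fun ζ => oscKernel z ζ) (g := g) (v := unitVec j) ?_ ?_ ?_
    (fun ζ _ => differentiable_of_smooth hk ζ) (fun ζ _ => differentiable_of_smooth hg ζ)
  · simp only [hfd] at this
    have h3 : ∫ ζ, -Complex.I * z j * oscKernel z ζ * g ζ =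
        -Complex.I * z j * ∫ ζ, oscKernel z ζ * g ζ := by
      rw [← integral_const_mul]; congr 1; funext ζ; ring
    rw [h3] at this
    have h4 : ∫ ζ, oscKernel z ζ * dirD (unitVec j) g ζ =
      -(-Complex.I * z j * ∫ ζ, oscKernel z ζ * g ζ) := this
    rw [h4]
    linear_combination ((z j : ℂ) * ∫ ζ, oscKernel z ζ * g ζ) * Complex.I_sq
  · simp only [hfd]
    refine integrable_of_support_closedBall (R := R)
      ((continuous_const.mul hk.continuous).mul hg.continuous) fun ζ hζ => by rw [h ζ hζ, mul_zero]
  · exact integrable_of_support_closedBall (R := R) (hk.continuous.mul hg'.continuous)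
      fun ζ hζ => mul_eq_zero_of_right _ (h' ζ hζ)
  · exact integrable_of_support_closedBall (R := R) (hk.continuous.mul hg.continuous)
      fun ζ hζ => by rw [h ζ hζ, mul_zero]

lemma mul_oscInt (hf : ContDiff ℝ ∞ f) (hR : SuppBall R f) (q : (Phase n × ℝ) × Rn n)
    (j : Fin n) : (q.2 j : ℂ) * oscInt f q = -Complex.I * oscInt (dirD (0, unitVec j) f) q := by
  have hS : ContDiff ℝ ∞ (fun ζ : Rn n => (q, ζ)) := contDiff_prodMk_right q
  have := mul_integral_oscKernel (g := fun ζ => f (q, ζ)) (hf.comp hS) (hR q) q.2 j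
  rwa [dirD_comp_const hf hS (fun ζ => dirD_prodMk_right q _ ζ)] at this

lemma norm_le_sum_abs (z : Rn n) : ‖z‖ ≤ ∑ j, |z j| := by
  conv_lhs => rw [← sum_smul_unitVec z]
  refine (norm_sum_le _ _).trans (Finset.sum_le_sum fun j _ => ?_)
  rw [norm_smul]; simp

/-- Rapid decay of the oscillatory integral in `z`, by repeated integration by parts. -/
lemma norm_oscInt_le {m : ℝ × ℕ} (hf : (dilScale n).Mem m f) (hR : SuppBall R f) (M : ℕ) :
    ∃ L : ℕ, ∃ C : ℝ, ∀ q, ‖oscInt f q‖ * (1 + ‖q.2‖) ^ M ≤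
      C * ((1 + ‖q.1.1.1‖) ^ m.1 * (1 + ‖q.1.2‖) ^ L) := by
  have key : ∀ M : ℕ, ∀ f, (dilScale n).Mem m f → SuppBall R f →
      ∃ L : ℕ, ∃ C : ℝ, 0 ≤ C ∧ ∀ q, ‖oscInt f q‖ * (1 + ‖q.2‖) ^ M ≤
        C * ((1 + ‖q.1.1.1‖) ^ m.1 * (1 + ‖q.2‖) ^ m.2 * (1 + ‖q.1.2‖) ^ L) := by
    intro M
    induction M with
    | zero =>
      intro f hf hR
      obtain ⟨L, C, hC⟩ := hf.bound
      have hC0 : 0 ≤ C := by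
        have := (norm_nonneg _).trans (hC 0)
        simpa using this
      refine ⟨L, C * volume.real (Metric.closedBall (0 : Rn n) R), by positivity, fun q => ?_⟩
      rw [oscInt_eq hR, pow_zero, mul_one]
      refine (norm_setIntegral_le_of_norm_le_const
        (C := C * ((1 + ‖q.1.1.1‖) ^ m.1 * (1 + ‖q.2‖) ^ m.2 * (1 + ‖q.1.2‖) ^ L))
        (isCompact_closedBall 0 R).measure_lt_top (fun ζ _ => ?_)).trans (le_of_eq ?_)
      · rw [norm_mul, norm_oscKernel, one_mul]
        exact hC (q, ζ)
      · ring
    | succ M ih =>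
      intro f hf hR
      have hder : ∀ j : Fin n, (dilScale n).Mem m (dirD (0, unitVec j) f) := fun j => by
        have := hf.dirD (Sum.inr j)
        have h0 : m + (dilScale n).shift (Sum.inr j) = m := add_zero m
        rwa [h0] at this
      obtain ⟨L, C, hC0, hC⟩ := ih f hf hR
      choose L' C' hC0' hC' using fun j => ih _ (hder j) (hR.dirD _)
      refine ⟨L + ∑ j, L' j, C + ∑ j, C' j, add_nonneg hC0 (Finset.sum_nonneg fun j _ => hC0' j),
        fun q => ?_⟩
      set w := (1 + ‖q.1.1.1‖) ^ m.1 * (1 + ‖q.2‖) ^ m.2 with hw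
      have hw0 : 0 ≤ w := by positivity
      have ht := one_le_bracket q.1.2
      have h1 : ‖oscInt f q‖ * (1 + ‖q.2‖) ≤
          ‖oscInt f q‖ + ∑ j, ‖oscInt (dirD (0, unitVec j) f) q‖ := by
        have h2 : ∀ j, ‖oscInt (dirD (0, unitVec j) f) q‖ = |q.2 j| * ‖oscInt f q‖ := by
          intro j
          have := congrArg norm (mul_oscInt hf.1 hR q j)
          rw [norm_mul, norm_mul] at this
          simpa using this.symm
        simp only [h2]
        rw [← Finset.sum_mul]
        nlinarith [norm_le_sum_abs q.2, norm_nonneg (oscInt f q)]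
      calc ‖oscInt f q‖ * (1 + ‖q.2‖) ^ (M + 1)
          = ‖oscInt f q‖ * (1 + ‖q.2‖) * (1 + ‖q.2‖) ^ M := by ring
        _ ≤ (‖oscInt f q‖ + ∑ j, ‖oscInt (dirD (0, unitVec j) f) q‖) * (1 + ‖q.2‖) ^ M := by
            gcongr
        _ = ‖oscInt f q‖ * (1 + ‖q.2‖) ^ M +
            ∑ j, ‖oscInt (dirD (0, unitVec j) f) q‖ * (1 + ‖q.2‖) ^ M := by
            rw [add_mul, Finset.sum_mul]
        _ ≤ C * (w * (1 + ‖q.1.2‖) ^ (L + ∑ j, L' j)) +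
            ∑ j, C' j * (w * (1 + ‖q.1.2‖) ^ (L + ∑ j, L' j)) := by
            refine add_le_add ((hC q).trans ?_)
              (Finset.sum_le_sum fun j _ => (hC' j q).trans ?_)
            · gcongr
              · omega
            · have := hC0' j
              gcongr
              have := Finset.single_le_sum (f := L') (fun i _ => Nat.zero_le _)
                (Finset.mem_univ j)
              omega
        _ = _ := by rw [← Finset.sum_mul, ← add_mul]
  -- `m.2` further powers of `⟨z⟩` absorb the growth of `f` in `z`
  obtain ⟨L, C, -, hC⟩ := key (M + m.2) f hf hR
  refine ⟨L, C, fun q => ?_⟩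
  have h1 : 0 < (1 + ‖q.2‖) ^ m.2 := by have := bracket_pos q.2; positivity
  refine le_of_mul_le_mul_right ?_ h1
  calc _ = ‖oscInt f q‖ * (1 + ‖q.2‖) ^ (M + m.2) := by rw [pow_add]; ring
    _ ≤ _ := hC q
    _ = _ := by ring

end OscillatoryIntegral

/-! ### The iterated integral and its Taylor expansion -/

section IteratedIntegral

open MeasureTheory

variable {n : ℕ} {R : ℝ} {f : Dil n → ℂ}

/-- `∬ e^{-i⟨z, ζ⟩} f (((x, η), t, z), ζ) dζ dz`. -/
def iterInt (f : Dil n → ℂ) (c : Phase n × ℝ) : ℂ := ∫ z, oscInt f (c, z)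

/-- The scale of functions of `((x, η), t)` with the estimates `|g| ≤ C ⟨x⟩^m ⟨t⟩^L`, in which
derivatives in `x` and in `t` lower the order by one. -/
def paramScale (n : ℕ) := weightScale (paramDir (n := n))
  (Sum.elim (Sum.elim (fun _ => (-1, 0)) (fun _ => 0)) (fun _ => (-1, 0)))
  (fun c => c.1.1) (fun _ => 0) (fun c => c.2)

/-- The directions `paramDir` form a basis. -/
def paramBasis (n : ℕ) : Module.Basis ((Fin n ⊕ Fin n) ⊕ Unit) ℝ (Phase n × ℝ) :=
  (((EuclideanSpace.basisFun (Fin n) ℝ).toBasis.prod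
    (EuclideanSpace.basisFun (Fin n) ℝ).toBasis).prod (Module.Basis.singleton Unit ℝ))

lemma paramBasis_apply (i : (Fin n ⊕ Fin n) ⊕ Unit) : paramBasis n i = paramDir i := by
  rcases i with (i | i) | i <;>
    simp [paramBasis, paramDir, phaseDir, Module.Basis.prod_apply]

lemma mem_dilScale_dirD {m : ℝ × ℕ} (hf : (dilScale n).Mem m f) (i : (Fin n ⊕ Fin n) ⊕ Unit) :
    (dilScale n).Mem (m + dilShift (Sum.inl i)) (dirD ((paramDir i, 0), 0) f) :=
  hf.dirD (Sum.inl i)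

/-- The decay of the inner integral in `z` makes the outer integral converge, locally uniformly in
the parameters. -/
lemma locDom_oscInt {m : ℝ × ℕ} (hf : (dilScale n).Mem m f) (hR : SuppBall R f) :
    LocDom volume (oscInt f) := by
  intro c₀
  obtain ⟨L, C, hC⟩ := norm_oscInt_le hf hR (n + 1)
  have hcont : Continuous fun c : Phase n × ℝ =>
      C * ((1 + ‖c.1.1‖) ^ m.1 * (1 + ‖c.2‖) ^ L) := by
    have : Continuous fun c : Phase n × ℝ => (1 + ‖c.1.1‖) ^ m.1 :=
      Continuous.rpow_const (by fun_prop) fun c => Or.inl (bracket_pos _).ne'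
    fun_prop
  obtain ⟨B, hB⟩ := (isCompact_closedBall c₀ 1).exists_bound_of_continuousOn hcont.continuousOn
  refine ⟨1, one_pos, fun z => B * (1 + ‖z‖) ^ (-((n : ℝ) + 1)), ?_, ?_⟩
  · refine (integrable_one_add_norm ?_).const_mul B
    simp
  · refine Filter.Eventually.of_forall fun z c hc => ?_
    have h1 := hC (c, z)
    have h2 := hB c (Metric.ball_subset_closedBall hc)
    have h3 : 0 < (1 + ‖z‖) ^ (n + 1) := pow_pos (bracket_pos z) _
    have h4 : (1 + ‖z‖) ^ (-((n : ℝ) + 1)) = ((1 + ‖z‖) ^ (n + 1))⁻¹ := by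
      rw [Real.rpow_neg (bracket_pos z).le, ← Real.rpow_natCast]; simp
    beta_reduce
    rw [h4, ← div_eq_mul_inv, le_div_iff₀ h3]
    exact h1.trans ((le_abs_self _).trans h2)

lemma dirD_iterInt {m : ℝ × ℕ} (hf : (dilScale n).Mem m f) (hR : SuppBall R f)
    (i : (Fin n ⊕ Fin n) ⊕ Unit) :
    dirD (paramDir i) (iterInt f) = iterInt (dirD ((paramDir i, 0), 0) f) := by
  refine (dirD_paramIntegral (paramBasis n) (contDiff_oscInt hf.1 hR) (locDom_oscInt hf hR)
    (fun j => ?_) (paramDir i)).trans ?_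
  · rw [paramBasis_apply, dirD_oscInt hf.1 hR]
    exact locDom_oscInt (mem_dilScale_dirD hf j) (hR.dirD _)
  · rw [dirD_oscInt hf.1 hR]; rfl

lemma contDiff_iterInt {m : ℝ × ℕ} (hf : (dilScale n).Mem m f) (hR : SuppBall R f) :
    ContDiff ℝ ∞ (iterInt f) := by
  refine contDiff_paramIntegral (paramBasis n)
    (fun h => ∃ m f, (dilScale n).Mem m f ∧ SuppBall R f ∧ h = oscInt f) ?_ ?_ ?_
    ⟨m, f, hf, hR, rfl⟩
  · rintro _ ⟨m, f, hf, hR, rfl⟩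
    exact contDiff_oscInt hf.1 hR
  · rintro _ ⟨m, f, hf, hR, rfl⟩
    exact locDom_oscInt hf hR
  · rintro _ ⟨m, f, hf, hR, rfl⟩ i
    rw [paramBasis_apply, dirD_oscInt hf.1 hR]
    exact ⟨_, _, mem_dilScale_dirD hf i, hR.dirD _, rfl⟩

/-- The iterated integral inherits the order in `x` of its integrand. The exponent of `⟨z⟩` plays no
role any more, because the inner integral decreases rapidly in `z`. -/
theorem mem_iterInt {m : ℝ × ℕ} (hf : (dilScale n).Mem m f) (hR : SuppBall R f) :
    (paramScale n).Mem m (iterInt f) := by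
  refine SymbolScale.Mem.coinduct (fun k g => ∃ K f, (dilScale n).Mem (k.1, K) f ∧
    SuppBall R f ∧ g = iterInt f) ?_ ?_ ?_ ⟨m.2, f, hf, hR, rfl⟩
  · rintro _ _ ⟨K, f, hf, hR, rfl⟩
    exact contDiff_iterInt hf hR
  · rintro k _ ⟨K, f, hf, hR, rfl⟩
    obtain ⟨L, C, hC⟩ := norm_oscInt_le hf hR (n + 1)
    refine ⟨L, C * ∫ z : Rn n, (1 + ‖z‖) ^ (-((n : ℝ) + 1)), fun c => ?_⟩
    have hint : Integrable fun z : Rn n => (1 + ‖z‖) ^ (-((n : ℝ) + 1)) :=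
      integrable_one_add_norm (by simp)
    have := norm_integral_le_of_norm_le (f := fun z => oscInt f (c, z))
      (hint.const_mul (C * ((1 + ‖c.1.1‖) ^ k.1 * (1 + ‖c.2‖) ^ L)))
      (Filter.Eventually.of_forall fun z => by
        have h3 : 0 < (1 + ‖z‖) ^ (n + 1) := pow_pos (bracket_pos z) _
        have h4 : (1 + ‖z‖) ^ (-((n : ℝ) + 1)) = ((1 + ‖z‖) ^ (n + 1))⁻¹ := by
          rw [Real.rpow_neg (bracket_pos z).le, ← Real.rpow_natCast]; simp
        rw [h4, ← div_eq_mul_inv, le_div_iff₀ h3]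
        exact hC (c, z))
    rw [integral_const_mul] at this
    refine this.trans (le_of_eq ?_)
    simp; ring
  · rintro k _ ⟨K, f, hf, hR, rfl⟩ i
    refine AddSubmonoid.subset_closure ⟨(((k.1, K) : ℝ × ℕ) + dilShift (n := n) (Sum.inl i)).2, _,
      ?_, hR.dirD _, dirD_iterInt hf hR i⟩
    · convert mem_dilScale_dirD hf i using 1
      rcases i with (i | i) | i <;> simp [paramScale, weightScale, dilShift]

/-- Evaluation at a fixed value of the parameter `t`. -/
lemma mem_symbolScale_eval {m : ℝ × ℕ} {g : Phase n × ℝ → ℂ} (hg : (paramScale n).Mem m g)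
    (t : ℝ) : (symbolScale n).Mem m.1 (fun p => g (p, t)) := by
  refine SymbolScale.Mem.coinduct (fun k h => ∃ m g, m.1 = k ∧ (paramScale n).Mem m g ∧
    h = fun p => g (p, t)) ?_ ?_ ?_ ⟨m, g, rfl, hg, rfl⟩
  · rintro _ _ ⟨m, g, rfl, hg, rfl⟩
    exact hg.1.comp (contDiff_prodMk_left t)
  · rintro _ _ ⟨m, g, rfl, hg, rfl⟩
    obtain ⟨L, C, hC⟩ := hg.bound
    refine ⟨C * (1 + ‖t‖) ^ L, fun p => (hC (p, t)).trans (le_of_eq ?_)⟩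
    simp; ring
  · rintro _ _ ⟨m, g, rfl, hg, rfl⟩ i
    refine AddSubmonoid.subset_closure ⟨_, _, ?_, hg.dirD (Sum.inl i),
      dirD_comp_const hg.1 (contDiff_prodMk_left t) fun p => dirD_prodMk_left t _ p⟩
    rcases i with i | i <;> simp [paramScale, weightScale, symbolScale]

/-- Integration over `[0, 1]` in the parameter `t`, with a smooth weight. -/
lemma mem_symbolScale_integral {m : ℝ × ℕ} {g : Phase n × ℝ → ℂ} (hg : (paramScale n).Mem m g)
    {w : ℝ → ℂ} (hw : ContDiff ℝ ∞ w) :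
    (symbolScale n).Mem m.1 (fun p => ∫ t in Set.Icc (0 : ℝ) 1, w t * g (p, t)) := by
  obtain ⟨W, hW⟩ := (isCompact_Icc (a := (0 : ℝ)) (b := 1)).exists_bound_of_continuousOn
    hw.continuous.continuousOn
  have hw2 : ContDiff ℝ ∞ (fun q : Phase n × ℝ => w q.2) := hw.comp contDiff_snd
  refine SymbolScale.Mem.coinduct (fun k h => ∃ m g, m.1 = k ∧ (paramScale n).Mem m g ∧
    h = fun p => ∫ t in Set.Icc (0 : ℝ) 1, w t * g (p, t)) ?_ ?_ ?_ ⟨m, g, rfl, hg, rfl⟩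
  · rintro _ _ ⟨m, g, rfl, hg, rfl⟩
    exact contDiff_setIntegral_compact (f := fun q => w q.2 * g q) isCompact_Icc (hw2.mul hg.1)
  · rintro _ _ ⟨m, g, rfl, hg, rfl⟩
    obtain ⟨L, C, hC⟩ := hg.bound
    have hC0 : 0 ≤ C := by
      have := (norm_nonneg _).trans (hC 0)
      simpa using this
    refine ⟨W * (C * 2 ^ L), fun p => ?_⟩
    have := norm_setIntegral_le_of_norm_le_const (μ := volume) (s := Set.Icc (0 : ℝ) 1)
      (f := fun t => w t * g (p, t)) (C := W * (C * 2 ^ L) * (1 + ‖p.1‖) ^ m.1) (by simp)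
      (fun t ht => by
        have ht1 : (1 + ‖t‖) ^ L ≤ 2 ^ L := by
          gcongr
          rw [Real.norm_of_nonneg ht.1]; linarith [ht.2]
        have h1 : ‖g (p, t)‖ ≤ C * 2 ^ L * (1 + ‖p.1‖) ^ m.1 := by
          refine (hC (p, t)).trans ?_
          simp only [norm_zero, add_zero, one_pow, mul_one]
          calc _ = C * (1 + ‖t‖) ^ L * (1 + ‖p.1‖) ^ m.1 := by ring
            _ ≤ _ := by gcongr
        rw [norm_mul, mul_assoc]
        exact mul_le_mul (hW t ht) h1 (norm_nonneg _) ((norm_nonneg _).trans (hW t ht)))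
    simpa using this
  · rintro _ _ ⟨m, g, rfl, hg, rfl⟩ i
    refine AddSubmonoid.subset_closure ⟨_, _, ?_, hg.dirD (Sum.inl i), ?_⟩
    · rcases i with i | i <;> simp [paramScale, weightScale, symbolScale]
    · refine (dirD_setIntegral_compact (μ := volume) (f := fun q => w q.2 * g q) isCompact_Icc
        (hw2.mul hg.1) _).trans ?_
      have h1 : dirD (phaseDir i, (0 : ℝ)) (fun q : Phase n × ℝ => w q.2) = 0 := by
        funext q
        exact dirD_eq_of_affine hw2 fun t => by simp
      have h2 := dirD_mul hw2 hg.1 (phaseDir i, (0 : ℝ))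
      rw [h1, zero_mul, zero_add] at h2
      funext p
      congr 1
      funext t
      exact congrFun h2 (p, t)

lemma iterate_dirD_param {g : Phase n × ℝ → ℂ} (hg : ContDiff ℝ ∞ g) (k : ℕ) (p : Phase n)
    (t : ℝ) : iteratedDeriv k (fun t => g (p, t)) t = (dirD (0, 1))^[k] g (p, t) := by
  induction k generalizing g with
  | zero => simp
  | succ k ih =>
    rw [iteratedDeriv_succ', Function.iterate_succ_apply, ← ih (contDiff_dirD hg _)]
    congr 1
    funext t
    have h1 := congrFun (dirD_comp_const (v := (1 : ℝ)) hg (contDiff_prodMk_right p)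
      fun t => dirD_prodMk_right p _ t) t
    rw [← h1]
    rfl

/-- Taylor expansion at `t = 0`, evaluated at `t = 1`. Since derivatives in `t` lower the order,
the remainder has lower order. -/
theorem mem_taylor_remainder {m : ℝ × ℕ} {g : Phase n × ℝ → ℂ} (hg : (paramScale n).Mem m g)
    (N : ℕ) : (symbolScale n).Mem (m.1 - N) (fun p => g (p, 1) -
      ∑ k ∈ Finset.range N, (1 / (k.factorial : ℂ)) * (dirD (0, 1))^[k] g (p, 0)) := by
  have hit : ∀ k : ℕ, (paramScale n).Mem (m + k • (-1, 0)) ((dirD (0, 1))^[k] g) := by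
    intro k
    induction k with
    | zero => simpa using hg
    | succ k ih =>
      rw [Function.iterate_succ_apply', succ_nsmul, ← add_assoc]
      exact ih.dirD (Sum.inr ())
  cases N with
  | zero => simpa using mem_symbolScale_eval hg 1
  | succ N =>
    have hw : ContDiff ℝ ∞ (fun t : ℝ => ((((1 - t) ^ N / N.factorial : ℝ)) : ℂ)) :=
      Complex.ofRealCLM.contDiff.comp (((contDiff_const.sub contDiff_id).pow N).div_const _)
    have h1 := mem_symbolScale_integral (hit (N + 1)) hw
    convert h1 using 1
    · simp; ring
    · funext p
      have hgp : ContDiff ℝ ∞ (fun t => g (p, t)) := hg.1.comp (contDiff_prodMk_right p)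
      have h2 := taylor_integral_remainder (f := fun t => g (p, t)) (x := 1) (x₀ := 0) (n := N)
        (hgp.of_le (by exact_mod_cast le_top)).contDiffOn
      have hu : UniqueDiffOn ℝ (Set.uIcc (0 : ℝ) 1) := uniqueDiffOn_uIcc (by norm_num)
      have h3 : ∀ k : ℕ, ∀ t ∈ Set.uIcc (0 : ℝ) 1,
          iteratedDerivWithin k (fun t => g (p, t)) (Set.uIcc 0 1) t =
            (dirD (0, 1))^[k] g (p, t) := by
        intro k t ht
        rw [iteratedDerivWithin_eq_iteratedDeriv hu
          ((hgp.of_le (by exact_mod_cast le_top)).contDiffAt) ht, iterate_dirD_param hg.1]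
      rw [taylor_within_apply] at h2
      have h4 : ∑ k ∈ Finset.range (N + 1), (((k.factorial : ℝ))⁻¹ * (1 - 0) ^ k) •
          iteratedDerivWithin k (fun t => g (p, t)) (Set.uIcc 0 1) 0 =
          ∑ k ∈ Finset.range (N + 1), (1 / (k.factorial : ℂ)) * (dirD (0, 1))^[k] g (p, 0) := by
        refine Finset.sum_congr rfl fun k _ => ?_
        rw [h3 k 0 (by simp)]
        simp [Complex.real_smul]
      rw [← h4, h2, intervalIntegral.integral_of_le zero_le_one, ← integral_Icc_eq_integral_Ioc]
      refine setIntegral_congr_fun measurableSet_Icc fun t ht => ?_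
      rw [h3 (N + 1) t (by rwa [Set.uIcc_of_le zero_le_one]), Complex.real_smul]

end IteratedIntegral

/-! ### The multinomial formula -/

section Multinomial

variable {n : ℕ}

lemma multiFactorial_add_single (α : Fin n → ℕ) (j : Fin n) :
    multiFactorial (α + Pi.single j 1) = (α j + 1) * multiFactorial α := by
  unfold multiFactorial
  rw [← Finset.mul_prod_erase Finset.univ _ (Finset.mem_univ j),
    ← Finset.mul_prod_erase Finset.univ (fun i => (α i).factorial) (Finset.mem_univ j), ← mul_assoc]
  congr 1
  · simp [Nat.factorial_succ]
  · refine Finset.prod_congr rfl fun i hi => ?_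
    simp [Pi.single_eq_of_ne (Finset.ne_of_mem_erase hi)]

lemma multiFactorial_ne_zero (α : Fin n → ℕ) : (multiFactorial α : ℂ) ≠ 0 := by
  rw [Nat.cast_ne_zero]
  exact Finset.prod_ne_zero_iff.2 fun i _ => Nat.factorial_ne_zero _

lemma prod_pow_add_single (z : Fin n → ℂ) (α : Fin n → ℕ) (j : Fin n) :
    ∏ i, z i ^ (α + Pi.single j 1 : Fin n → ℕ) i = z j * ∏ i, z i ^ α i := by
  simp only [Pi.add_apply, pow_add, Finset.prod_mul_distrib]
  rw [Finset.prod_eq_single (f := fun i => z i ^ (Pi.single j 1 : Fin n → ℕ) i) j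
    (fun i _ hi => by simp [Pi.single_eq_of_ne hi]) (by simp)]
  simp [mul_comm]

/-- The inductive step of the multinomial formula. -/
lemma sum_multinomial_step (z : Fin n → ℂ) (u : (Fin n → ℕ) → ℂ) (k : ℕ) :
    ∑ j, z j * ∑ α ∈ Finset.piAntidiag (Finset.univ : Finset (Fin n)) k,
      1 / (multiFactorial α : ℂ) * (∏ i, z i ^ α i) * u (α + Pi.single j 1) =
    (k + 1) * ∑ β ∈ Finset.piAntidiag (Finset.univ : Finset (Fin n)) (k + 1),
      1 / (multiFactorial β : ℂ) * (∏ i, z i ^ β i) * u β := by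
  have hR : (k + 1 : ℂ) * ∑ β ∈ Finset.piAntidiag (Finset.univ : Finset (Fin n)) (k + 1),
      1 / (multiFactorial β : ℂ) * (∏ i, z i ^ β i) * u β =
      ∑ j, ∑ β ∈ Finset.piAntidiag (Finset.univ : Finset (Fin n)) (k + 1),
        (β j : ℂ) * (1 / (multiFactorial β : ℂ) * (∏ i, z i ^ β i) * u β) := by
    rw [Finset.sum_comm, Finset.mul_sum]
    refine Finset.sum_congr rfl fun β hβ => ?_
    rw [← Finset.sum_mul]
    congr 1
    rw [← Nat.cast_sum, (Finset.mem_piAntidiag.1 hβ).1]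
    simp
  rw [hR]
  refine Finset.sum_congr rfl fun j _ => ?_
  rw [Finset.mul_sum]
  refine Finset.sum_of_injOn (fun α => α + Pi.single j 1) ?_ ?_ ?_ ?_
  · exact fun α _ β _ h => add_right_cancel h
  · intro α hα
    rw [Finset.mem_coe, Finset.mem_piAntidiag] at hα ⊢
    refine ⟨?_, by simp⟩
    simp [Finset.sum_add_distrib, hα.1]
  · intro β hβ hβ'
    by_cases h0 : β j = 0
    · simp [h0]
    · refine absurd ⟨β - Pi.single j 1, ?_, ?_⟩ hβ'
      · rw [Finset.mem_coe, Finset.mem_piAntidiag] at *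
        refine ⟨?_, by simp⟩
        have h1 : β = β - Pi.single j 1 + Pi.single j 1 := by
          funext i
          by_cases hi : i = j
          · subst hi; simp; omega
          · simp [Pi.single_eq_of_ne hi]
        have h2 := hβ.1
        rw [h1] at h2
        simp only [Pi.add_apply, Finset.sum_add_distrib] at h2
        simpa using h2
      · funext i
        by_cases hi : i = j
        · subst hi; simp; omega
        · simp [Pi.single_eq_of_ne hi]
  · intro α _
    rw [multiFactorial_add_single, prod_pow_add_single]
    have h1 := multiFactorial_ne_zero α
    have h2 : (α j + 1 : ℂ) ≠ 0 := by exact_mod_cast Nat.succ_ne_zero (α j)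
    simp only [Pi.add_apply, Pi.single_eq_same]
    push_cast
    field_simp

/-- The direction of the parameter `t`. -/
def tDir (n : ℕ) : Dil n := (((0, 1), 0), 0)

lemma contDiff_dilate {f : Amp n → ℂ} (hf : ContDiff ℝ ∞ f) : ContDiff ℝ ∞ (dilate f) :=
  hf.comp contDiff_dilation

lemma dirD_tDir_dilate {f : Amp n → ℂ} (hf : ContDiff ℝ ∞ f) :
    dirD (tDir n) (dilate f) = fun q => ∑ j, (q.1.2 j : ℂ) * dilate (dirD (zDir j) f) q := by
  funext q
  have h1 := dirD_comp hf contDiff_dilation (tDir n) q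
  have h2 : dirD (tDir n) (fun q : Dil n => (((q.1.1.1, q.1.1.2 • q.1.2), q.2) : Amp n)) q =
      ∑ j, q.1.2 j • zDir j := by
    rw [dirD_eq_of_affine (w := ((0, q.1.2), 0)) contDiff_dilation fun t => by
      simp [tDir, add_smul]]
    refine Prod.ext (Prod.ext ?_ ?_) ?_
    · simp [zDir, Prod.fst_sum]
    · simp [zDir, Prod.fst_sum, Prod.snd_sum, sum_smul_unitVec]
    · simp [zDir, Prod.snd_sum]
  rw [h2, map_sum] at h1
  refine h1.trans (Finset.sum_congr rfl fun j _ => ?_)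
  rw [map_smul, Complex.real_smul]
  rfl

/-- The coordinates of `z` are constants for the derivatives in `t`. -/
lemma iterate_dirD_tDir_sum (k : ℕ) {h : Fin n → Dil n → ℂ} (hh : ∀ j, ContDiff ℝ ∞ (h j)) :
    (dirD (tDir n))^[k] (fun q => ∑ j, (q.1.2 j : ℂ) * h j q) =
      fun q => ∑ j, (q.1.2 j : ℂ) * (dirD (tDir n))^[k] (h j) q := by
  induction k generalizing h with
  | zero => rfl
  | succ k ih =>
    have hz : ∀ j : Fin n, ContDiff ℝ ∞ (fun q : Dil n => (q.1.2 j : ℂ)) := fun j =>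
      Complex.ofRealCLM.contDiff.comp (by fun_prop : ContDiff ℝ ∞ (fun q : Dil n => q.1.2 j))
    have h1 : dirD (tDir n) (fun q => ∑ j, (q.1.2 j : ℂ) * h j q) =
        fun q => ∑ j, (q.1.2 j : ℂ) * dirD (tDir n) (h j) q := by
      rw [dirD_finsetSum (f := fun j q => (q.1.2 j : ℂ) * h j q) _ fun j _ => (hz j).mul (hh j)]
      funext q
      refine Finset.sum_congr rfl fun j _ => ?_
      have h2 : dirD (tDir n) (fun q : Dil n => (q.1.2 j : ℂ)) = 0 := by
        funext q
        exact dirD_eq_of_affine (hz j) fun t => by simp [tDir]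
      have h3 := congrFun (dirD_mul (hz j) (hh j) (tDir n)) q
      rw [h2, zero_mul, zero_add] at h3
      exact h3
    simp only [Function.iterate_succ_apply]
    rw [h1, ih fun j => contDiff_dirD (hh j) _]

/-- The multinomial formula for the derivatives of `f (t z)` in `t`. -/
lemma iterate_dirD_tDir_dilate (k : ℕ) {f : Amp n → ℂ} (hf : ContDiff ℝ ∞ f) (q : Dil n) :
    (dirD (tDir n))^[k] (dilate f) q = k.factorial *
      ∑ α ∈ Finset.piAntidiag (Finset.univ : Finset (Fin n)) k,
        1 / (multiFactorial α : ℂ) * (∏ i, (q.1.2 i : ℂ) ^ α i) *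
          dilate (multiDir zDir α f) q := by
  induction k generalizing f with
  | zero =>
    have h0 : ∏ i, (q.1.2 i : ℂ) ^ (0 : Fin n → ℕ) i = 1 := by simp
    simp [multiFactorial, multiDir_zero]
  | succ k ih =>
    rw [Function.iterate_succ_apply, dirD_tDir_dilate hf,
      iterate_dirD_tDir_sum k fun j => contDiff_dilate (contDiff_dirD hf _)]
    simp only [ih (contDiff_dirD hf _), multiDir_dirD_eq hf]
    have := sum_multinomial_step (fun i => (q.1.2 i : ℂ))
      (fun β => dilate (multiDir zDir β f) q) k
    rw [Nat.factorial_succ]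
    push_cast
    rw [mul_comm (k + 1 : ℂ), mul_assoc, ← this, Finset.mul_sum]
    refine Finset.sum_congr rfl fun j _ => by ring

end Multinomial

/-! ### Fourier inversion and the Taylor coefficients -/

section FourierInversion

open MeasureTheory FourierTransform

variable {n : ℕ} {R : ℝ}

lemma oscInt_eq_fourier {g : Rn n → ℂ} (z : Rn n) :
    ∫ ζ, oscKernel z ζ * g ζ = 𝓕 g ((2 * Real.pi)⁻¹ • z) := by
  rw [Real.fourier_eq']
  congr 1
  funext ζ
  rw [smul_eq_mul, oscKernel]
  congr 2
  rw [inner_smul_right, real_inner_comm]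
  push_cast
  have : (Real.pi : ℂ) ≠ 0 := by exact_mod_cast Real.pi_ne_zero
  field_simp

/-- Fourier inversion at the origin. -/
lemma integral_oscInt_eq {g : Rn n → ℂ} (hg : ContDiff ℝ ∞ g)
    (h : ∀ ζ, ζ ∉ Metric.closedBall 0 R → g ζ = 0) :
    Integrable (fun z => ∫ ζ, oscKernel z ζ * g ζ) ∧
    ∫ z, ∫ ζ, oscKernel z ζ * g ζ = (2 * Real.pi) ^ n * g 0 := by
  have hpi : (0 : ℝ) < 2 * Real.pi := by positivity
  set G : 𝓢(Rn n, ℂ) := (HasCompactSupport.intro (isCompact_closedBall 0 R) h).toSchwartzMap hg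
  have hG : (G : Rn n → ℂ) = g := rfl
  have hint : Integrable (𝓕 g) := by
    rw [← hG, ← SchwartzMap.fourier_coe]
    exact (𝓕 G).integrable
  simp only [oscInt_eq_fourier]
  refine ⟨hint.comp_smul (inv_ne_zero hpi.ne'), ?_⟩
  rw [Measure.integral_comp_inv_smul_of_nonneg _ _ hpi.le]
  have hinv := congrFun (hg.continuous.fourierInv_fourier_eq
    (integrable_of_support_closedBall hg.continuous h) hint) 0
  rw [Real.fourierInv_eq'] at hinv
  simp only [inner_zero_right, mul_zero, Complex.ofReal_zero, zero_mul, Complex.exp_zero,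
    one_smul] at hinv
  rw [hinv, Complex.real_smul]
  simp

/-- Repeated integration by parts. -/
lemma prod_mul_integral_oscKernel {g : Rn n → ℂ} (hg : ContDiff ℝ ∞ g)
    (h : ∀ ζ, ζ ∉ Metric.closedBall 0 R → g ζ = 0) (z : Rn n) (α : Fin n → ℕ) :
    ((∏ i, (z i : ℂ) ^ α i) * ∫ ζ, oscKernel z ζ * g ζ =
      (-Complex.I) ^ order α * ∫ ζ, oscKernel z ζ * multiDeriv α g ζ) ∧
    ContDiff ℝ ∞ (multiDeriv α g) ∧
    ∀ ζ, ζ ∉ Metric.closedBall 0 R → multiDeriv α g ζ = 0 := by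
  have hord : order α = ((List.finRange n).map α).sum := by
    rw [order, ← List.sum_ofFn, List.ofFn_eq_map]
  have hprod : ∏ i, (z i : ℂ) ^ α i = ((List.finRange n).map fun i => (z i : ℂ) ^ α i).prod := by
    rw [← List.prod_ofFn, List.ofFn_eq_map]
  rw [hord, hprod, multiDeriv_eq_multiDir]
  unfold multiDir
  generalize List.finRange n = l
  induction l with
  | nil => simpa using ⟨hg, by simpa using h⟩
  | cons j l ih =>
    simp only [List.foldr_cons, List.map_cons, List.sum_cons, List.prod_cons]
    generalize α j = k
    induction k with
    | zero => simpa using ih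
    | succ k ihk =>
      obtain ⟨h1, h2, h3⟩ := ihk
      rw [Function.iterate_succ_apply']
      refine ⟨?_, contDiff_dirD h2 _, ?_⟩
      · have h4 := mul_integral_oscKernel h2 h3 z j
        rw [pow_succ', mul_assoc, mul_assoc, ← mul_assoc ((z j : ℂ) ^ k), h1, mul_left_comm, h4]
        ring
      · exact fun ζ hζ => dirD_eq_zero_of_support h3 _ hζ

lemma SuppBall.multiDir_zDir {f : Amp n → ℂ} (hf : SuppBall R f) (α : Fin n → ℕ) :
    SuppBall R (multiDir zDir α f) :=
  multiDir_pred (fun f => SuppBall R f) (fun _ _ h => h.dirD _) α hf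

lemma SuppBall.dilate {f : Amp n → ℂ} (hf : SuppBall R f) : SuppBall R (dilate f) :=
  fun _ _ hζ => hf _ _ hζ

/-- The derivatives in `t` at `t = 0` of the iterated integral of a dilated amplitude. -/
theorem iterate_dirD_iterInt {m : ℝ × ℕ} {f : Amp n → ℂ} (hf : (ampScale n).Mem m f)
    (hR : SuppBall R f) (k : ℕ) (p : Phase n) :
    (dirD (0, 1))^[k] (iterInt (dilate f)) (p, 0) = (2 * Real.pi) ^ n * (k.factorial *
      ∑ α ∈ Finset.piAntidiag (Finset.univ : Finset (Fin n)) k,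
        1 / (multiFactorial α : ℂ) * ((-Complex.I) ^ order α *
          multiDir zetaDir α (multiDir zDir α f) ((p, 0), 0))) := by
  have h1 : ∀ k : ℕ, ∃ m, (dilScale n).Mem m ((dirD (tDir n))^[k] (dilate f)) ∧
      SuppBall R ((dirD (tDir n))^[k] (dilate f)) ∧
      (dirD (0, 1))^[k] (iterInt (dilate f)) = iterInt ((dirD (tDir n))^[k] (dilate f)) := by
    intro k
    induction k with
    | zero => exact ⟨m, mem_dilate hf, hR.dilate, rfl⟩
    | succ k ih =>
      obtain ⟨m, h1, h2, h3⟩ := ih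
      simp only [Function.iterate_succ_apply']
      refine ⟨_, mem_dilScale_dirD h1 (Sum.inr ()), h2.dirD _, ?_⟩
      rw [h3]
      exact dirD_iterInt h1 h2 (Sum.inr ())
  obtain ⟨_, -, -, h2⟩ := h1 k
  rw [h2, iterInt]
  -- `q α` is the derivative of order `α` in `z` at `z = 0`, a function of `ζ`
  set q : (Fin n → ℕ) → Rn n → ℂ := fun α ζ => multiDir zDir α f ((p, 0), ζ) with hq
  have hqs : ∀ α, ContDiff ℝ ∞ (q α) := fun α =>
    (contDiff_multiDir hf.1 _ _).comp (contDiff_prodMk_right _)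
  have hqR : ∀ α ζ, ζ ∉ Metric.closedBall 0 R → q α ζ = 0 := fun α ζ hζ =>
    hR.multiDir_zDir α _ _ hζ
  have hQ : ∀ z, oscInt ((dirD (tDir n))^[k] (dilate f)) ((p, 0), z) = k.factorial *
      ∑ α ∈ Finset.piAntidiag (Finset.univ : Finset (Fin n)) k,
        1 / (multiFactorial α : ℂ) * ((-Complex.I) ^ order α *
          ∫ ζ, oscKernel z ζ * multiDeriv α (q α) ζ) := by
    intro z
    have h3 : ∀ ζ, oscKernel z ζ * (dirD (tDir n))^[k] (dilate f) (((p, 0), z), ζ) =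
        k.factorial * ∑ α ∈ Finset.piAntidiag (Finset.univ : Finset (Fin n)) k,
          1 / (multiFactorial α : ℂ) * (∏ i, (z i : ℂ) ^ α i) * (oscKernel z ζ * q α ζ) := by
      intro ζ
      rw [iterate_dirD_tDir_dilate k hf.1, mul_left_comm, Finset.mul_sum]
      congr 1
      refine Finset.sum_congr rfl fun α _ => ?_
      simp only [dilate, zero_smul, hq]
      ring
    have hk : Continuous fun ζ : Rn n => oscKernel z ζ :=
      (contDiff_oscKernel.comp (contDiff_prodMk_right z)).continuous
    rw [oscInt]
    simp only [h3]
    rw [integral_const_mul, integral_finsetSum]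
    · congr 1
      refine Finset.sum_congr rfl fun α _ => ?_
      rw [integral_const_mul, mul_assoc,
        (prod_mul_integral_oscKernel (hqs α) (hqR α) z α).1]
    · intro α _
      exact (integrable_of_support_closedBall (R := R) (hk.mul (hqs α).continuous)
        fun ζ hζ => mul_eq_zero_of_right _ (hqR α ζ hζ)).const_mul _
  simp only [hQ]
  have hI := fun α => integral_oscInt_eq (R := R)
    (prod_mul_integral_oscKernel (hqs α) (hqR α) 0 α).2.1
    (prod_mul_integral_oscKernel (hqs α) (hqR α) 0 α).2.2
  have hInt : ∀ α ∈ Finset.piAntidiag (Finset.univ : Finset (Fin n)) k,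
      Integrable (fun z => 1 / (multiFactorial α : ℂ) * ((-Complex.I) ^ order α *
        ∫ ζ, oscKernel z ζ * multiDeriv α (q α) ζ)) := fun α _ =>
    ((hI α).1.const_mul _).const_mul _
  rw [integral_const_mul, integral_finsetSum _ hInt, mul_left_comm]
  congr 1
  rw [Finset.mul_sum]
  refine Finset.sum_congr rfl fun α _ => ?_
  rw [integral_const_mul, integral_const_mul, (hI α).2, hq,
    multiDeriv_zeta (contDiff_multiDir hf.1 _ _)]
  ring

end FourierInversion

/-! ### A criterion for Schwartz functions -/

section SchwartzCriterion

variable {n : ℕ}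

/-- A family of smooth functions that decrease rapidly, stable under partial derivatives, consists
of Schwartz functions. -/
theorem exists_schwartz_of_family (Q : (Rn n → ℂ) → Prop) (hs : ∀ f, Q f → ContDiff ℝ ∞ f)
    (hb : ∀ f, Q f → ∀ k : ℕ, ∃ C, ∀ x, ‖x‖ ^ k * ‖f x‖ ≤ C)
    (hd : ∀ f, Q f → ∀ j, Q (dirD (unitVec j) f)) {f : Rn n → ℂ} (hf : Q f) :
    ∃ v : 𝓢(Rn n, ℂ), ⇑v = f := by
  have key : ∀ N k : ℕ, ∀ f, Q f → ∃ C, ∀ x, ‖x‖ ^ k * ‖iteratedFDeriv ℝ N f x‖ ≤ C := by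
    intro N
    induction N with
    | zero =>
      intro k f hf
      simpa using hb f hf k
    | succ N ih =>
      intro k f hf
      choose C hC using fun j => ih k _ (hd f hf j)
      -- the derivative of `f` is the sum over `j` of `L j (∂_j f)`, with constant linear maps `L j`
      let L : Fin n → ℂ →L[ℝ] (Rn n →L[ℝ] ℂ) := fun j =>
        ContinuousLinearMap.smulRightL ℝ (Rn n) ℂ (EuclideanSpace.proj j : Rn n →L[ℝ] ℝ)
      have hfd : fderiv ℝ f = fun x => ∑ j, L j (dirD (unitVec j) f x) := by
        funext x
        ext v
        conv_lhs => rw [← sum_smul_unitVec v]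
        simp [L, dirD]
      have hsm : ∀ j, ContDiff ℝ N (dirD (unitVec j) f) := fun j =>
        (contDiff_dirD (hs f hf) _).of_le (by exact_mod_cast le_top)
      refine ⟨∑ j, ‖L j‖ * C j, fun x => ?_⟩
      rw [← norm_iteratedFDeriv_fderiv, hfd]
      have h1 : iteratedFDeriv ℝ N (fun x => ∑ j, L j (dirD (unitVec j) f x)) x =
          ∑ j, iteratedFDeriv ℝ N (fun x => L j (dirD (unitVec j) f x)) x := by
        exact iteratedFDeriv_fun_sum_apply fun j _ => ((L j).contDiff.comp (hsm j)).contDiffAt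
      rw [h1]
      calc ‖x‖ ^ k * ‖∑ j, iteratedFDeriv ℝ N (fun x => L j (dirD (unitVec j) f x)) x‖
          ≤ ‖x‖ ^ k * ∑ j, ‖L j‖ * ‖iteratedFDeriv ℝ N (dirD (unitVec j) f) x‖ := by
            gcongr
            refine (norm_sum_le _ _).trans (Finset.sum_le_sum fun j _ => ?_)
            exact (L j).norm_iteratedFDeriv_comp_left (hsm j).contDiffAt le_rfl
        _ = ∑ j, ‖L j‖ * (‖x‖ ^ k * ‖iteratedFDeriv ℝ N (dirD (unitVec j) f) x‖) := by
            rw [Finset.mul_sum]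
            exact Finset.sum_congr rfl fun j _ => by ring
        _ ≤ ∑ j, ‖L j‖ * C j := Finset.sum_le_sum fun j _ =>
            mul_le_mul_of_nonneg_left (hC j x) (norm_nonneg (L j))
  exact ⟨⟨f, hs f hf, fun k N => key N k f hf⟩, rfl⟩

end SchwartzCriterion

/-! ### The action on Schwartz functions -/

section SchwartzRange

open MeasureTheory FourierTransform

variable {n : ℕ} {R : ℝ} {Φ : Rn n → Rn n → ℝ} {c : Phase n → ℂ}

lemma mem_symbolScale_mono {m m' : ℝ} (h : m ≤ m') (hc : (symbolScale n).Mem m c) :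
    (symbolScale n).Mem m' c :=
  isSymbol_iff_mem.1 ((isSymbol_iff_mem (a := Function.curry c).2 hc).mono h)

/-- Multiplication by a smooth function of `ξ` preserves the symbols with compact support
in `ξ`. -/
lemma mem_symbolScale_mul_snd {m : ℝ} {g : Rn n → ℂ} (hg : ContDiff ℝ ∞ g)
    (hc : (symbolScale n).Mem m c) (hR : SuppBall R c) :
    (symbolScale n).Mem m (fun p => g p.2 * c p) := by
  have hg2 : ∀ g : Rn n → ℂ, ContDiff ℝ ∞ g → ContDiff ℝ ∞ (fun p : Phase n => g p.2) :=
    fun g hg => hg.comp contDiff_snd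
  refine SymbolScale.Mem.coinduct (fun m h => ∃ g c, ContDiff ℝ ∞ g ∧
    (symbolScale n).Mem m c ∧ SuppBall R c ∧ h = fun p => g p.2 * c p) ?_ ?_ ?_
    ⟨g, c, hg, hc, hR, rfl⟩
  · rintro m _ ⟨g, c, hg, hc, hR, rfl⟩
    exact (hg2 g hg).mul hc.1
  · rintro m _ ⟨g, c, hg, hc, hR, rfl⟩
    obtain ⟨C, hC⟩ := hc.bound
    obtain ⟨B, hB⟩ := (isCompact_closedBall (0 : Rn n) R).exists_bound_of_continuousOn
      hg.continuous.continuousOn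
    refine ⟨|B| * C, fun p => ?_⟩
    rw [norm_mul, mul_assoc]
    have h0 := (norm_nonneg _).trans (hC p)
    by_cases hp : p.2 ∈ Metric.closedBall 0 R
    · exact mul_le_mul ((hB _ hp).trans (le_abs_self B)) (hC p) (norm_nonneg _) (abs_nonneg B)
    · have : c p = 0 := hR p.1 p.2 hp
      rw [this, norm_zero, mul_zero]
      positivity
  · rintro m _ ⟨g, c, hg, hc, hR, rfl⟩ i
    have h1 := dirD_mul (hg2 g hg) hc.1 ((symbolScale n).dir i)
    have h2 : dirD ((symbolScale n).dir i) (fun p : Phase n => g p.2 * c p) = _ := h1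
    rw [h2]
    rcases i with j | j
    · have h3 : dirD ((symbolScale n).dir (Sum.inl j)) (fun p : Phase n => g p.2) = 0 := by
        funext q
        exact dirD_eq_of_affine (hg2 g hg) fun t => by simp [symbolScale, phaseDir]
      rw [h3, zero_mul, zero_add]
      exact AddSubmonoid.subset_closure ⟨g, _, hg, hc.dirD _, hR.dirD _, rfl⟩
    · have h3 : dirD ((symbolScale n).dir (Sum.inr j)) (fun p : Phase n => g p.2) =
          fun p => dirD (unitVec j) g p.2 :=
        dirD_comp_const hg contDiff_snd fun q =>
          dirD_eq_of_affine contDiff_snd fun t => by simp [symbolScale, phaseDir]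
      rw [h3]
      refine add_mem (AddSubmonoid.subset_closure ?_) (AddSubmonoid.subset_closure ?_)
      · refine ⟨_, c, contDiff_dirD hg (unitVec j), ?_, hR, rfl⟩
        simpa [symbolScale] using hc
      · exact ⟨g, _, hg, hc.dirD _, hR.dirD _, rfl⟩

/-- The oscillating factor `e^{i(⟨x, ξ⟩ + Φ(x, ξ))}`. -/
def oscFactor (Φ : Rn n → Rn n → ℝ) (p : Phase n) : ℂ :=
  Complex.exp (Complex.I * ((inner ℝ p.1 p.2 + Φ p.1 p.2 : ℝ) : ℂ))

lemma norm_oscFactor (p : Phase n) : ‖oscFactor Φ p‖ = 1 := by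
  rw [oscFactor, Complex.norm_exp]; simp

lemma contDiff_phaseFun (hΦ : ContDiff ℝ ∞ (Function.uncurry Φ)) :
    ContDiff ℝ ∞ (fun p : Phase n => inner ℝ p.1 p.2 + Φ p.1 p.2) :=
  (contDiff_fst.inner ℝ contDiff_snd).add hΦ

lemma contDiff_oscFactor (hΦ : ContDiff ℝ ∞ (Function.uncurry Φ)) :
    ContDiff ℝ ∞ (oscFactor Φ) :=
  (contDiff_const.mul (Complex.ofRealCLM.contDiff.comp (contDiff_phaseFun hΦ))).cexp

lemma dirD_oscFactor (hΦ : ContDiff ℝ ∞ (Function.uncurry Φ)) (v p : Phase n) :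
    dirD v (oscFactor Φ) p = Complex.I *
      ((inner ℝ v.1 p.2 + inner ℝ p.1 v.2 : ℝ) +
        dirD v (fun p => (Φ p.1 p.2 : ℂ)) p) * oscFactor Φ p := by
  have h0 : HasFDerivAt (fun p : Phase n => ((inner ℝ p.1 p.2 + Φ p.1 p.2 : ℝ) : ℂ))
      (Complex.ofRealCLM.comp (fderiv ℝ (fun p : Phase n => inner ℝ p.1 p.2 + Φ p.1 p.2) p)) p :=
    Complex.ofRealCLM.hasFDerivAt.comp p
      (differentiable_of_smooth (contDiff_phaseFun hΦ) p).hasFDerivAt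
  have h1 := (h0.const_mul Complex.I).cexp
  have hin : ContDiff ℝ ∞ (fun p : Phase n => inner ℝ p.1 p.2) :=
    contDiff_fst.inner ℝ contDiff_snd
  have h2 : fderiv ℝ (fun p : Phase n => inner ℝ p.1 p.2 + Φ p.1 p.2) p v =
      (inner ℝ v.1 p.2 + inner ℝ p.1 v.2) + dirD v (Function.uncurry Φ) p := by
    have h3 : fderiv ℝ (fun p : Phase n => inner ℝ p.1 p.2) p v =
        inner ℝ v.1 p.2 + inner ℝ p.1 v.2 := by
      have h4 : DifferentiableAt ℝ (fun p : Phase n => p.1) p := by fun_prop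
      have h5 : DifferentiableAt ℝ (fun p : Phase n => p.2) p := by fun_prop
      rw [fderiv_inner_apply ℝ h4 h5]
      simp [add_comm, fderiv_fst, fderiv_snd]
    have h4 := fderiv_add (differentiable_of_smooth hin p) (differentiable_of_smooth hΦ p)
    have h5 := congrArg (fun L => L v) h4
    refine h5.trans ?_
    rw [add_apply, h3]; rfl
  have h6 := congrFun (dirD_clm hΦ Complex.ofRealCLM v) p
  have h7 : dirD v (fun p => (Φ p.1 p.2 : ℂ)) p = ((dirD v (Function.uncurry Φ) p : ℝ) : ℂ) := h6
  rw [h7, dirD]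
  unfold oscFactor
  rw [h1.fderiv]
  simp [h2]
  ring

/-- `∫ e^{i(⟨x, ξ⟩ + Φ(x, ξ))} c(x, ξ) dξ`. -/
def oscTransform (Φ : Rn n → Rn n → ℝ) (c : Phase n → ℂ) (x : Rn n) : ℂ :=
  ∫ ξ, oscFactor Φ (x, ξ) * c (x, ξ)

lemma oscTransform_eq (hR : SuppBall R c) : oscTransform Φ c = fun x =>
    ∫ ξ in Metric.closedBall 0 R, oscFactor Φ (x, ξ) * c (x, ξ) := by
  funext x
  refine (setIntegral_eq_integral_of_forall_compl_eq_zero fun ζ hζ => ?_).symm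
  rw [hR x ζ hζ, mul_zero]

lemma contDiff_oscTransform (hΦ : ContDiff ℝ ∞ (Function.uncurry Φ)) (hc : ContDiff ℝ ∞ c)
    (hR : SuppBall R c) : ContDiff ℝ ∞ (oscTransform Φ c) := by
  rw [oscTransform_eq hR]
  exact contDiff_setIntegral_compact (f := fun p => oscFactor Φ p * c p)
    (isCompact_closedBall 0 R) ((contDiff_oscFactor hΦ).mul hc)

/-- The symbol of the derivative of an oscillatory transform. -/
def derivSymbol (Φ : Rn n → Rn n → ℝ) (j : Fin n) (c : Phase n → ℂ) (p : Phase n) : ℂ :=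
  dirD (unitVec j, 0) c p + Complex.I * ((p.2 j : ℂ) * c p) +
    Complex.I * (dirD (unitVec j, 0) (fun p => (Φ p.1 p.2 : ℂ)) p * c p)

/-- The symbol of the product of an oscillatory transform with `x_j`. -/
def coordSymbol (Φ : Rn n → Rn n → ℝ) (j : Fin n) (c : Phase n → ℂ) (p : Phase n) : ℂ :=
  Complex.I * dirD (0, unitVec j) c p +
    (-1) * (dirD (0, unitVec j) (fun p => (Φ p.1 p.2 : ℂ)) p * c p)

lemma dirD_oscTransform (hΦ : ContDiff ℝ ∞ (Function.uncurry Φ)) (hc : ContDiff ℝ ∞ c)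
    (hR : SuppBall R c) (j : Fin n) :
    dirD (unitVec j) (oscTransform Φ c) = oscTransform Φ (derivSymbol Φ j c) := by
  have hR' : SuppBall R (derivSymbol Φ j c) := by
    intro q ζ hζ
    simp [derivSymbol, hR q ζ hζ, hR.dirD _ q ζ hζ]
  rw [oscTransform_eq hR, oscTransform_eq hR']
  refine (dirD_setIntegral_compact (μ := volume) (f := fun p => oscFactor Φ p * c p)
    (isCompact_closedBall 0 R) ((contDiff_oscFactor hΦ).mul hc) _).trans ?_
  funext x
  congr 1
  funext ξ
  have h1 := congrFun (dirD_mul (contDiff_oscFactor hΦ) hc (unitVec j, 0)) (x, ξ)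
  refine h1.trans ?_
  rw [Pi.add_apply, Pi.mul_apply, Pi.mul_apply, dirD_oscFactor hΦ]
  simp only [derivSymbol, EuclideanSpace.inner_single_left, inner_zero_right]
  simp
  ring

/-- Integration by parts in `ξ`: multiplication by `x_j` of `e^{i(⟨x, ξ⟩ + Φ(x, ξ))}` is
`-i ∂_{ξ_j} - ∂_{ξ_j} Φ`. -/
lemma mul_oscTransform (hΦ : ContDiff ℝ ∞ (Function.uncurry Φ)) (hc : ContDiff ℝ ∞ c)
    (hR : SuppBall R c) (j : Fin n) (x : Rn n) :
    (x j : ℂ) * oscTransform Φ c x = oscTransform Φ (coordSymbol Φ j c) x := by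
  have hE := contDiff_oscFactor hΦ
  have hsl : ContDiff ℝ ∞ (fun ξ : Rn n => (x, ξ)) := contDiff_prodMk_right x
  have hEx : ContDiff ℝ ∞ (fun ξ : Rn n => oscFactor Φ (x, ξ)) := hE.comp hsl
  have hcx : ContDiff ℝ ∞ (fun ξ : Rn n => c (x, ξ)) := hc.comp hsl
  have hΦc : ContDiff ℝ ∞ (fun p : Phase n => (Φ p.1 p.2 : ℂ)) := Complex.ofRealCLM.contDiff.comp hΦ
  have hD : ∀ {g : Phase n → ℂ}, ContDiff ℝ ∞ g → ∀ ξ,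
      fderiv ℝ (fun ξ => g (x, ξ)) ξ (unitVec j) = dirD (0, unitVec j) g (x, ξ) := fun hg ξ =>
    congrFun (dirD_comp_const hg hsl fun ξ => dirD_prodMk_right x (unitVec j) ξ) ξ
  set θ : Rn n → ℂ := fun ξ => dirD (0, unitVec j) (fun p => (Φ p.1 p.2 : ℂ)) (x, ξ) with hθ
  have hθc : Continuous θ := ((contDiff_dirD hΦc _).comp hsl).continuous
  have hDE : ∀ ξ, dirD (0, unitVec j) (oscFactor Φ) (x, ξ) =
      Complex.I * (x j + θ ξ) * oscFactor Φ (x, ξ) := fun ξ => by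
    rw [dirD_oscFactor hΦ]
    simp [EuclideanSpace.inner_single_right, hθ]
  have hi1 : Integrable fun ξ => oscFactor Φ (x, ξ) * dirD (0, unitVec j) c (x, ξ) :=
    integrable_of_support_closedBall (R := R)
      (hEx.continuous.mul ((contDiff_dirD hc _).comp hsl).continuous)
      fun ζ hζ => mul_eq_zero_of_right _ (hR.dirD _ x ζ hζ)
  have hi2 : Integrable fun ξ => oscFactor Φ (x, ξ) * c (x, ξ) :=
    integrable_of_support_closedBall (R := R) (hEx.continuous.mul hcx.continuous)
      fun ζ hζ => mul_eq_zero_of_right _ (hR x ζ hζ)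
  have hi3 : Integrable fun ξ => oscFactor Φ (x, ξ) * (θ ξ * c (x, ξ)) :=
    integrable_of_support_closedBall (R := R) (hEx.continuous.mul (hθc.mul hcx.continuous))
      fun ζ hζ => mul_eq_zero_of_right _ (mul_eq_zero_of_right _ (hR x ζ hζ))
  have hsum : ∀ ξ, Complex.I * (x j + θ ξ) * oscFactor Φ (x, ξ) * c (x, ξ) =
      Complex.I * x j * (oscFactor Φ (x, ξ) * c (x, ξ)) +
        Complex.I * (oscFactor Φ (x, ξ) * (θ ξ * c (x, ξ))) := fun ξ => by ring
  have hparts := integral_mul_fderiv_eq_neg_fderiv_mul_of_integrable (μ := volume)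
    (f := fun ξ => oscFactor Φ (x, ξ)) (g := fun ξ => c (x, ξ)) (v := unitVec j)
    (by
      simp only [hD hE, hDE, hsum]
      exact (hi2.const_mul _).add (hi3.const_mul _))
    (by simpa only [hD hc] using hi1) hi2
    (fun ζ _ => differentiable_of_smooth hEx ζ) (fun ζ _ => differentiable_of_smooth hcx ζ)
  simp only [hD hE, hD hc, hDE, hsum] at hparts
  rw [integral_add (hi2.const_mul _) (hi3.const_mul _), integral_const_mul,
    integral_const_mul] at hparts
  have hrhs : oscTransform Φ (coordSymbol Φ j c) x =
      Complex.I * (∫ ξ, oscFactor Φ (x, ξ) * dirD (0, unitVec j) c (x, ξ)) -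
        ∫ ξ, oscFactor Φ (x, ξ) * (θ ξ * c (x, ξ)) := by
    rw [← integral_const_mul, ← integral_sub (hi1.const_mul _) hi3]
    unfold oscTransform
    congr 1
    funext ξ
    simp only [coordSymbol, hθ]
    ring
  rw [hrhs, hparts]
  unfold oscTransform
  linear_combination ((x j : ℂ) * (∫ ξ, oscFactor Φ (x, ξ) * c (x, ξ)) +
    ∫ ξ, oscFactor Φ (x, ξ) * (θ ξ * c (x, ξ))) * Complex.I_sq

lemma mem_phase {ε : ℝ} (hΦ : IsSymbol (1 - ε) Φ) :
    (symbolScale n).Mem (1 - ε) (fun p => (Φ p.1 p.2 : ℂ)) :=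
  isSymbol_iff_mem.1 (hΦ.clm Complex.ofRealCLM)

lemma mem_derivSymbol {ε m : ℝ} (hε : 0 < ε) (hΦ : IsSymbol (1 - ε) Φ)
    (hc : (symbolScale n).Mem m c) (hR : SuppBall R c) (j : Fin n) :
    (symbolScale n).Mem m (derivSymbol Φ j c) ∧ SuppBall R (derivSymbol Φ j c) := by
  have hS := symbolScale_isMultiplicative (n := n)
  constructor
  · refine SymbolScale.Mem.add (SymbolScale.Mem.add ?_ ?_) ?_
    · exact mem_symbolScale_mono (by simp [symbolScale]) (hc.dirD (Sum.inl j))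
    · refine SymbolScale.Mem.const_mul hS _
        (mem_symbolScale_mul_snd (g := fun ξ => (ξ j : ℂ)) ?_ hc hR)
      exact Complex.ofRealCLM.contDiff.comp (by fun_prop : ContDiff ℝ ∞ fun ξ : Rn n => ξ j)
    · refine SymbolScale.Mem.const_mul hS _ (mem_symbolScale_mono ?_
        (((mem_phase hΦ).dirD (Sum.inl j)).mul hS hc))
      simp [symbolScale]; linarith
  · intro q ζ hζ
    simp [derivSymbol, hR q ζ hζ, hR.dirD _ q ζ hζ]

lemma mem_coordSymbol {ε m : ℝ} (hε1 : ε ≤ 1) (hΦ : IsSymbol (1 - ε) Φ)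
    (hc : (symbolScale n).Mem m c) (hR : SuppBall R c) (j : Fin n) :
    (symbolScale n).Mem (m + (1 - ε)) (coordSymbol Φ j c) ∧ SuppBall R (coordSymbol Φ j c) := by
  have hS := symbolScale_isMultiplicative (n := n)
  constructor
  · refine SymbolScale.Mem.add ?_ ?_
    · refine SymbolScale.Mem.const_mul hS _ (mem_symbolScale_mono ?_ (hc.dirD (Sum.inr j)))
      simp [symbolScale]; linarith
    · refine SymbolScale.Mem.const_mul hS _ (mem_symbolScale_mono ?_
        (((mem_phase hΦ).dirD (Sum.inr j)).mul hS hc))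
      simp [symbolScale]; linarith
  · intro q ζ hζ
    simp [coordSymbol, hR q ζ hζ, hR.dirD _ q ζ hζ]

/-- Each integration by parts gains a factor `⟨x⟩⁻¹` and loses a factor `⟨x⟩^(1 - ε)`. -/
lemma norm_oscTransform_le {ε : ℝ} (hε1 : ε ≤ 1) (hΦ : IsSymbol (1 - ε) Φ) (M : ℕ) {m : ℝ}
    (hc : (symbolScale n).Mem m c) (hR : SuppBall R c) :
    ∃ C : ℝ, ∀ x, ‖oscTransform Φ c x‖ * (1 + ‖x‖) ^ M ≤
      C * (1 + ‖x‖) ^ (m + M * (1 - ε)) := by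
  induction M generalizing m c with
  | zero =>
    obtain ⟨C, hC⟩ := hc.bound
    refine ⟨C * volume.real (Metric.closedBall (0 : Rn n) R), fun x => ?_⟩
    rw [oscTransform_eq hR, pow_zero, mul_one]
    refine (norm_setIntegral_le_of_norm_le_const (C := C * (1 + ‖x‖) ^ m)
      (isCompact_closedBall 0 R).measure_lt_top (fun ζ _ => ?_)).trans (le_of_eq ?_)
    · rw [norm_mul, norm_oscFactor, one_mul]
      exact hC (x, ζ)
    · simp; ring
  | succ M ih =>
    obtain ⟨C, hC⟩ := ih hc hR
    have hcs := mem_coordSymbol hε1 hΦ hc hR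
    choose C' hC' using fun j => ih (hcs j).1 (hcs j).2
    refine ⟨|C| + ∑ j, C' j, fun x => ?_⟩
    have hx := one_le_bracket x
    have h1 : ‖oscTransform Φ c x‖ * (1 + ‖x‖) ≤
        ‖oscTransform Φ c x‖ + ∑ j, ‖oscTransform Φ (coordSymbol Φ j c) x‖ := by
      have h2 : ∀ j, ‖oscTransform Φ (coordSymbol Φ j c) x‖ =
          |x j| * ‖oscTransform Φ c x‖ := by
        intro j
        rw [← mul_oscTransform hΦ.1 hc.1 hR, norm_mul]
        simp
      simp only [h2]
      rw [← Finset.sum_mul]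
      nlinarith [norm_le_sum_abs x, norm_nonneg (oscTransform Φ c x)]
    have hexp : ∀ j : Fin n, m + (1 - ε) + M * (1 - ε) = m + ((M + 1 : ℕ) : ℝ) * (1 - ε) := by
      intro j; push_cast; ring
    calc ‖oscTransform Φ c x‖ * (1 + ‖x‖) ^ (M + 1)
        = ‖oscTransform Φ c x‖ * (1 + ‖x‖) * (1 + ‖x‖) ^ M := by ring
      _ ≤ (‖oscTransform Φ c x‖ + ∑ j, ‖oscTransform Φ (coordSymbol Φ j c) x‖) *
          (1 + ‖x‖) ^ M := by gcongr
      _ = ‖oscTransform Φ c x‖ * (1 + ‖x‖) ^ M +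
          ∑ j, ‖oscTransform Φ (coordSymbol Φ j c) x‖ * (1 + ‖x‖) ^ M := by
          rw [add_mul, Finset.sum_mul]
      _ ≤ |C| * (1 + ‖x‖) ^ (m + ((M + 1 : ℕ) : ℝ) * (1 - ε)) +
          ∑ j, C' j * (1 + ‖x‖) ^ (m + ((M + 1 : ℕ) : ℝ) * (1 - ε)) := by
          refine add_le_add ((hC x).trans ?_) (Finset.sum_le_sum fun j _ => ?_)
          · refine mul_le_mul (le_abs_self C) ?_ (by positivity) (abs_nonneg C)
            refine Real.rpow_le_rpow_of_exponent_le hx ?_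
            push_cast; nlinarith
          · rw [← hexp j]; exact hC' j x
      _ = _ := by rw [← Finset.sum_mul, ← add_mul]

/-- Oscillatory transforms with symbols of any order and compact support in `ξ` are Schwartz
functions. -/
theorem exists_schwartz_oscTransform {ε : ℝ} (hε : 0 < ε) (hε1 : ε ≤ 1)
    (hΦ : IsSymbol (1 - ε) Φ) {m : ℝ} (hc : (symbolScale n).Mem m c) (hR : SuppBall R c) :
    ∃ v : 𝓢(Rn n, ℂ), ⇑v = oscTransform Φ c := by
  refine exists_schwartz_of_family (fun f => ∃ m c, (symbolScale n).Mem m c ∧ SuppBall R c ∧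
    f = oscTransform Φ c) ?_ ?_ ?_ ⟨m, c, hc, hR, rfl⟩
  · rintro _ ⟨m, c, hc, hR, rfl⟩
    exact contDiff_oscTransform hΦ.1 hc.1 hR
  · rintro _ ⟨m, c, hc, hR, rfl⟩ k
    -- `M` integrations by parts gain `⟨x⟩^(-Mε)`, which has to compensate `⟨x⟩^(m + k)`
    obtain ⟨M, hM⟩ := exists_nat_ge ((m + k) / ε)
    rw [div_le_iff₀ hε] at hM
    obtain ⟨C, hC⟩ := norm_oscTransform_le hε1 hΦ M hc hR
    refine ⟨|C|, fun x => ?_⟩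
    have hx := bracket_pos x
    have h1 : (1 + ‖x‖) ^ (m + M * (1 - ε)) * (1 + ‖x‖) ^ k ≤ (1 + ‖x‖) ^ M := by
      rw [← Real.rpow_natCast, ← Real.rpow_natCast, ← Real.rpow_add hx]
      exact Real.rpow_le_rpow_of_exponent_le (one_le_bracket x) (by nlinarith)
    have h2 : 0 < (1 + ‖x‖) ^ M := by positivity
    refine le_of_mul_le_mul_right ?_ h2
    calc ‖x‖ ^ k * ‖oscTransform Φ c x‖ * (1 + ‖x‖) ^ M
        ≤ (1 + ‖x‖) ^ k * ‖oscTransform Φ c x‖ * (1 + ‖x‖) ^ M := by gcongr; linarith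
      _ = (‖oscTransform Φ c x‖ * (1 + ‖x‖) ^ M) * (1 + ‖x‖) ^ k := by ring
      _ ≤ (|C| * (1 + ‖x‖) ^ (m + M * (1 - ε))) * (1 + ‖x‖) ^ k :=
          mul_le_mul_of_nonneg_right
            ((hC x).trans (mul_le_mul_of_nonneg_right (le_abs_self C) (by positivity)))
            (by positivity)
      _ = |C| * ((1 + ‖x‖) ^ (m + M * (1 - ε)) * (1 + ‖x‖) ^ k) := by ring
      _ ≤ |C| * (1 + ‖x‖) ^ M := by gcongr
  · rintro _ ⟨m, c, hc, hR, rfl⟩ j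
    have := mem_derivSymbol hε hΦ hc hR j
    exact ⟨m, _, this.1, this.2, dirD_oscTransform hΦ.1 hc.1 hR j⟩

/-- The normalizing constant `(2π)^(-n/2)`. -/
def fourierConst (n : ℕ) : ℂ := (((2 * Real.pi) ^ (-(n : ℝ) / 2) : ℝ) : ℂ)

lemma fourierU_eq (u : Rn n → ℂ) (ξ : Rn n) :
    fourierU u ξ = fourierConst n * ∫ x, oscKernel ξ x * u x := by
  simp only [fourierU, fourierConst, oscKernel, real_inner_comm ξ]

lemma contDiff_fourierU (u : 𝓢(Rn n, ℂ)) : ContDiff ℝ ∞ (fourierU u) := by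
  have h1 : fourierU u = fun ξ => fourierConst n * (𝓕 u) ((2 * Real.pi)⁻¹ • ξ) := by
    funext ξ
    rw [fourierU_eq, oscInt_eq_fourier, SchwartzMap.fourier_coe]
  rw [h1]
  exact contDiff_const.mul (((𝓕 u).smooth ⊤).comp (contDiff_id.const_smul _))

/-- The operator `J(Φ, a)` as an oscillatory transform, with the symbol `a(x, ξ) û(ξ)`. -/
lemma oscPdo_eq (Φ : Rn n → Rn n → ℝ) (a : Rn n → Rn n → ℂ) (u : Rn n → ℂ) :
    oscPdo Φ a u = fun x => fourierConst n *
      oscTransform Φ (fun p => fourierU u p.2 * a p.1 p.2) x := by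
  funext x
  unfold oscPdo pdo fourierConst oscTransform oscFactor
  congr 2
  funext ξ
  have : Complex.I * ((inner ℝ x ξ + Φ x ξ : ℝ) : ℂ) =
      Complex.I * (inner ℝ x ξ : ℝ) + Complex.I * (Φ x ξ : ℂ) := by push_cast; ring
  rw [this, Complex.exp_add]
  ring

lemma CompactSupportInXi.exists_suppBall {a : Rn n → Rn n → ℂ} (h : CompactSupportInXi a) :
    ∃ R : ℝ, 0 ≤ R ∧ SuppBall R (Function.uncurry a) := by
  obtain ⟨K, hK, h⟩ := h
  obtain ⟨R, hR⟩ := hK.isBounded.subset_closedBall 0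
  exact ⟨max R 0, le_max_right _ _, fun x ξ hξ => h x ξ fun hK' =>
    hξ (Metric.closedBall_subset_closedBall (le_max_left _ _) (hR hK'))⟩

/-- `J(Φ, a)` maps the Schwartz space into itself. -/
theorem exists_schwartz_oscPdo {ε ma : ℝ} (hε : 0 < ε) (hΦ : IsSymbol (1 - ε) Φ)
    {a : Rn n → Rn n → ℂ} (ha : IsSymbol ma a) (hR : SuppBall R (Function.uncurry a))
    (u : 𝓢(Rn n, ℂ)) : ∃ v : 𝓢(Rn n, ℂ), ⇑v = oscPdo Φ a u := by
  -- a smaller `ε` gives a larger class of phases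
  have hΦ' : IsSymbol (1 - min ε 1) Φ := hΦ.mono (by linarith [min_le_left ε 1])
  obtain ⟨v, hv⟩ := exists_schwartz_oscTransform (lt_min hε one_pos) (min_le_right ε 1) hΦ'
    (mem_symbolScale_mul_snd (contDiff_fourierU u) (isSymbol_iff_mem.1 ha) hR) (R := R)
    (fun x ξ hξ => mul_eq_zero_of_right _ (hR x ξ hξ))
  refine ⟨fourierConst n • v, ?_⟩
  rw [oscPdo_eq]
  funext x
  have := congrFun hv x
  simp only [smul_apply, smul_eq_mul, this]
  rfl

end SchwartzRange

/-! ### The composition formula -/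

section Composition

open MeasureTheory

variable {n : ℕ} {Φ : Rn n → Rn n → ℝ} {a b : Rn n → Rn n → ℂ}

lemma exists_norm_ampGrad_le (hΦ : IsSymbol 1 Φ) : ∃ C : ℝ, ∀ v, ‖ampGrad Φ v‖ ≤ C := by
  choose L C hC using fun j => (mem_ampGrad hΦ j).bound
  refine ⟨∑ j, C j, fun v => (norm_le_sum_abs _).trans (Finset.sum_le_sum fun j _ => ?_)⟩
  simpa using hC j v

/-- The amplitude has compact support in `ζ`, uniformly in the other variables, because the
gradient of the phase is bounded. -/
lemma exists_suppBall_ampFun (hΦ : IsSymbol 1 Φ) {Ra Rb : ℝ}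
    (ha : SuppBall Ra (Function.uncurry a)) (hb : SuppBall Rb (Function.uncurry b)) :
    ∃ R, SuppBall R (ampFun Φ a b) := by
  obtain ⟨C, hC⟩ := exists_norm_ampGrad_le hΦ
  refine ⟨Ra + Rb + C, fun q ζ hζ => ?_⟩
  change b q.1.1 (q.1.2 + ζ + ampGrad Φ (q, ζ)) * a (q.1.1 + q.2) q.1.2 = 0
  by_cases hη : q.1.2 ∈ Metric.closedBall 0 Ra
  · refine mul_eq_zero_of_left (hb q.1.1 (q.1.2 + ζ + ampGrad Φ (q, ζ)) fun h => hζ ?_) _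
    simp only [mem_closedBall_zero_iff] at hη h ⊢
    have h1 : ‖ampGrad Φ (q, ζ)‖ ≤ C := hC _
    have h2 : ζ = q.1.2 + ζ + ampGrad Φ (q, ζ) - q.1.2 - ampGrad Φ (q, ζ) := by abel
    have h3 : ‖q.1.2 + ζ + ampGrad Φ (q, ζ)‖ ≤ Rb := h
    rw [h2]
    refine (norm_sub_le _ _).trans ?_
    have := norm_sub_le (q.1.2 + ζ + ampGrad Φ (q, ζ)) q.1.2
    linarith
  · exact mul_eq_zero_of_right _ (ha (q.1.1 + q.2) _ hη)

/-- The fundamental theorem of calculus along the segment from `x` to `x + z`. -/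
lemma inner_meanGrad (hΦ : ContDiff ℝ ∞ (Function.uncurry Φ)) (x z η : Rn n) :
    inner ℝ z (meanGrad Φ x (x + z) η) = Φ (x + z) η - Φ x η := by
  have h1 : ∀ s : ℝ, (1 - s) • x + s • (x + z) = x + s • z := fun s => by module
  have hc : Continuous fun s : ℝ => gradX Φ (x + s • z) η :=
    (contDiff_gradX hΦ).continuous.comp (f := fun s : ℝ => (x + s • z, η)) (by fun_prop)
  unfold meanGrad
  simp only [h1]
  have h2 := (innerSL ℝ z).intervalIntegral_comp_comm (μ := volume) (hc.intervalIntegrable 0 1)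
  simp only [innerSL_apply_apply] at h2
  rw [← h2]
  have h3 : ∀ s ∈ Set.uIcc (0 : ℝ) 1, HasDerivAt (fun s : ℝ => Φ (x + s • z) η)
      (inner ℝ z (gradX Φ (x + s • z) η)) s := by
    intro s _
    have hΦη : ContDiff ℝ ∞ (fun y => Φ y η) := hΦ.comp (contDiff_prodMk_left η)
    have h4 : HasGradientAt (fun y => Φ y η) (gradX Φ (x + s • z) η) (x + s • z) :=
      (differentiable_of_smooth hΦη _).hasGradientAt
    have h5 : HasDerivAt (fun s : ℝ => x + s • z) z s := by
      simpa using ((hasDerivAt_id s).smul_const z).const_add x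
    have h6 := h4.hasFDerivAt.comp_hasDerivAt s h5
    rw [real_inner_comm, ← InnerProductSpace.toDual_apply_apply (𝕜 := ℝ)]
    exact h6
  rw [intervalIntegral.integral_eq_sub_of_hasDerivAt h3
    ((continuous_const.inner hc).intervalIntegrable 0 1)]
  simp

lemma oscKernel_add_left (x z ξ : Rn n) :
    oscKernel (x + z) ξ = oscKernel x ξ * oscKernel z ξ := by
  rw [oscKernel, oscKernel, oscKernel, ← Complex.exp_add, inner_add_left]
  push_cast; ring_nf

lemma oscKernel_comm (x ξ : Rn n) : oscKernel x ξ = oscKernel ξ x := by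
  rw [oscKernel, oscKernel, real_inner_comm]

/-- The kernel `∫ e^{-i⟨z, ξ⟩} b(x, ξ) dξ` of the operator `b(x, D)`. -/
def pdoKernel (b : Rn n → Rn n → ℂ) (x z : Rn n) : ℂ := ∫ ξ, oscKernel z ξ * b x ξ

/-- The substitution `ξ = η + ζ + r` turns the inner integral of the composed symbol into the
kernel of `b(x, D)`. -/
lemma oscFactor_mul_oscInt (hΦ : ContDiff ℝ ∞ (Function.uncurry Φ)) (x η z : Rn n) :
    oscFactor Φ (x, η) * oscInt (dilate (ampFun Φ a b)) (((x, η), 1), z) =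
      pdoKernel b x z * (oscFactor Φ (x + z, η) * a (x + z) η) := by
  set w := η + meanGrad Φ x (x + z) η with hw
  set e : ℂ := Complex.exp (Complex.I * (inner ℝ z w : ℝ)) with he
  have h1 : ∀ ζ, oscKernel z ζ = e * oscKernel z (ζ + w) := by
    intro ζ
    rw [oscKernel, oscKernel, he, ← Complex.exp_add, inner_add_right z ζ w]
    congr 1
    push_cast; ring
  have h2 : oscInt (dilate (ampFun Φ a b)) (((x, η), 1), z) =
      e * pdoKernel b x z * a (x + z) η := by
    have h3 := integral_add_right_eq_self (μ := volume) (fun ξ => oscKernel z ξ * b x ξ) w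
    rw [pdoKernel, ← h3, ← integral_const_mul, ← integral_mul_const]
    unfold oscInt
    congr 1
    funext ζ
    have h4 : dilate (ampFun Φ a b) ((((x, η), 1), z), ζ) = b x (ζ + w) * a (x + z) η := by
      simp only [dilate, ampFun, amplitude, one_smul, hw]
      congr 2; abel
    rw [h4, h1]; ring
  have h5 : oscFactor Φ (x, η) * e = oscFactor Φ (x + z, η) := by
    rw [he, oscFactor, oscFactor, ← Complex.exp_add, ← mul_add, ← Complex.ofReal_add]
    congr 3
    simp only [hw, inner_add_right, inner_add_left, inner_meanGrad hΦ]
    ring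
  rw [h2, ← h5]; ring

/-- Pseudodifferential operators as integral operators. -/
lemma pdo_eq_integral_pdoKernel {R : ℝ} (hb : ContDiff ℝ ∞ (Function.uncurry b))
    (hR : SuppBall R (Function.uncurry b)) {v : Rn n → ℂ} (hv : Integrable v) (x : Rn n) :
    pdo b v x = fourierConst n ^ 2 * ∫ z, pdoKernel b x z * v (x + z) := by
  have hbx : ContDiff ℝ ∞ (b x) := hb.comp (contDiff_prodMk_right x)
  have hbi : Integrable (b x) := integrable_of_support_closedBall hbx.continuous (hR x)
  have hvx : Integrable fun z => v (x + z) := hv.comp_add_left x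
  have h1 : ∀ ξ : Rn n, Complex.exp (Complex.I * (inner ℝ x ξ : ℝ)) * b x ξ * fourierU v ξ =
      fourierConst n * ∫ z, oscKernel z ξ * b x ξ * v (x + z) := by
    intro ξ
    have h2 := integral_add_left_eq_self (μ := volume) (fun y => oscKernel y ξ * v y) x
    have h3 : Complex.exp (Complex.I * (inner ℝ x ξ : ℝ)) * oscKernel x ξ = 1 := by
      rw [oscKernel, ← Complex.exp_add]; simp
    rw [fourierU_eq]
    simp only [oscKernel_comm ξ]
    rw [← h2, mul_left_comm, ← integral_const_mul]
    congr 2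
    funext z
    rw [oscKernel_add_left]
    linear_combination (b x ξ * oscKernel z ξ * v (x + z)) * h3
  have hint : Integrable (Function.uncurry fun ξ z : Rn n => oscKernel z ξ * b x ξ * v (x + z))
      (volume.prod volume) := by
    have hk : Continuous fun p : Rn n × Rn n => oscKernel p.2 p.1 :=
      contDiff_oscKernel.continuous.comp continuous_swap
    have h2 := (hbi.mul_prod hvx).bdd_mul (c := 1) hk.aestronglyMeasurable
      (Filter.Eventually.of_forall fun p => (norm_oscKernel p.2 p.1).le)
    refine h2.congr (Filter.Eventually.of_forall fun p => ?_)
    simp only [Function.uncurry]; ring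
  change fourierConst n * _ = _
  simp only [h1]
  rw [integral_const_mul, integral_integral_swap hint, pow_two, mul_assoc]
  simp only [integral_mul_const]
  rfl

/-- The symbol `d` with `b(x, D) J(Φ, a) = J(Φ, d)`. It is
`(2π)^(-n) ∬ e^{-i⟨z, ζ⟩} p(z, ζ; x, η) dζ dz`, the value at `t = 1` of the iterated integral of the
dilated amplitude. -/
def compSymbol (Φ : Rn n → Rn n → ℝ) (a b : Rn n → Rn n → ℂ) (x η : Rn n) : ℂ :=
  fourierConst n ^ 2 * iterInt (dilate (ampFun Φ a b)) ((x, η), 1)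

lemma oscInt_dilate_ampFun_eq_zero {Ra : ℝ} (ha : SuppBall Ra (Function.uncurry a)) {η : Rn n}
    (hη : η ∉ Metric.closedBall 0 Ra) (x z : Rn n) :
    oscInt (dilate (ampFun Φ a b)) (((x, η), 1), z) = 0 := by
  have : ∀ ζ, dilate (ampFun Φ a b) ((((x, η), 1), z), ζ) = 0 := fun ζ =>
    mul_eq_zero_of_right _ (ha _ _ hη)
  simp [oscInt, this]

lemma compactSupportInXi_compSymbol (ha : CompactSupportInXi a) :
    CompactSupportInXi (compSymbol Φ a b) := by
  obtain ⟨Ra, -, hRa⟩ := ha.exists_suppBall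
  refine ⟨Metric.closedBall 0 Ra, isCompact_closedBall 0 Ra, fun x η hη => ?_⟩
  simp [compSymbol, iterInt, oscInt_dilate_ampFun_eq_zero hRa hη]

/-- The iterated integral converges absolutely, so that the order of integration can be
exchanged. -/
lemma integrable_oscInt_mul {Ra R : ℝ} {m : ℝ × ℕ} (hp : (ampScale n).Mem m (ampFun Φ a b))
    (hR : SuppBall R (ampFun Φ a b)) (ha : SuppBall Ra (Function.uncurry a))
    {g : Rn n → ℂ} (hg : Continuous g) (x : Rn n) :
    Integrable (fun q : Rn n × Rn n =>
      g q.2 * oscInt (dilate (ampFun Φ a b)) (((x, q.2), 1), q.1)) (volume.prod volume) := by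
  obtain ⟨L, C, hC⟩ := norm_oscInt_le (mem_dilate hp) hR.dilate (n + 1)
  obtain ⟨B, hB⟩ := (isCompact_closedBall (0 : Rn n) Ra).exists_bound_of_continuousOn
    hg.continuousOn
  set D : ℝ := C * ((1 + ‖x‖) ^ m.1 * (1 + ‖(1 : ℝ)‖) ^ L) with hD
  have hI1 : Integrable fun z : Rn n => (1 + ‖z‖) ^ (-((n : ℝ) + 1)) :=
    integrable_one_add_norm (by simp)
  have hI2 : Integrable ((Metric.closedBall (0 : Rn n) Ra).indicator fun _ => |B| * D) :=
    (integrableOn_const (isCompact_closedBall 0 Ra).measure_lt_top.ne).integrable_indicator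
      Metric.isClosed_closedBall.measurableSet
  refine (hI1.mul_prod hI2).mono' ?_ (Filter.Eventually.of_forall fun q => ?_)
  · have hc := (contDiff_oscInt (mem_dilate hp).1 hR.dilate).continuous
    exact ((hg.comp continuous_snd).mul
      (hc.comp (by fun_prop : Continuous fun q : Rn n × Rn n =>
        (((x, q.2), (1 : ℝ)), q.1)))).aestronglyMeasurable
  · by_cases hq : q.2 ∈ Metric.closedBall (0 : Rn n) Ra
    · have h3 : 0 < (1 + ‖q.1‖) ^ (n + 1) := pow_pos (bracket_pos _) _
      have h4 : (1 + ‖q.1‖) ^ (-((n : ℝ) + 1)) = ((1 + ‖q.1‖) ^ (n + 1))⁻¹ := by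
        rw [Real.rpow_neg (bracket_pos _).le, ← Real.rpow_natCast]; simp
      have h5 := hC (((x, q.2), 1), q.1)
      rw [Set.indicator_of_mem hq, norm_mul, h4, mul_comm (_⁻¹), ← div_eq_mul_inv,
        le_div_iff₀ h3, mul_assoc]
      exact mul_le_mul ((hB _ hq).trans (le_abs_self B)) h5 (by positivity) (abs_nonneg B)
    · rw [oscInt_dilate_ampFun_eq_zero ha hq, Set.indicator_of_notMem hq]; simp

/-- Insert the formula for `J(Φ, a) u` into the integral operator `b(x, D)`, and exchange the
integrals over `z` and `η`. -/
theorem pdo_oscPdo {ε ma mb : ℝ} (hε : 0 < ε) (hΦ : IsSymbol (1 - ε) Φ) (ha : IsSymbol ma a)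
    (hb : IsSymbol mb b) (ha_supp : CompactSupportInXi a) (hb_supp : CompactSupportInXi b)
    (u : 𝓢(Rn n, ℂ)) : pdo b (oscPdo Φ a u) = oscPdo Φ (compSymbol Φ a b) u := by
  have hΦ1 : IsSymbol 1 Φ := hΦ.mono (by linarith)
  obtain ⟨Ra, -, hRa⟩ := ha_supp.exists_suppBall
  obtain ⟨Rb, -, hRb⟩ := hb_supp.exists_suppBall
  obtain ⟨R, hR⟩ := exists_suppBall_ampFun hΦ1 hRa hRb
  obtain ⟨K, hp⟩ := mem_ampFun hΦ1 ha hb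
  obtain ⟨v, hv⟩ := exists_schwartz_oscPdo hε hΦ ha hRa u
  have hvi : Integrable (oscPdo Φ a u) := hv ▸ v.integrable
  funext x
  have hgc : Continuous fun η => oscFactor Φ (x, η) * fourierU u η :=
    (((contDiff_oscFactor hΦ.1).comp (contDiff_prodMk_right x)).mul
      (contDiff_fourierU u)).continuous
  have h1 : ∀ z, pdoKernel b x z * oscPdo Φ a u (x + z) = fourierConst n *
      ∫ η, (oscFactor Φ (x, η) * fourierU u η) *
        oscInt (dilate (ampFun Φ a b)) (((x, η), 1), z) := by
    intro z
    simp only [oscPdo_eq, oscTransform]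
    rw [mul_left_comm, ← integral_const_mul]
    congr 2
    funext η
    linear_combination (-fourierU u η) * oscFactor_mul_oscInt (a := a) (b := b) hΦ.1 x η z
  rw [pdo_eq_integral_pdoKernel hb.1 hRb hvi]
  simp only [h1]
  rw [integral_const_mul, integral_integral_swap (integrable_oscInt_mul hp hR hRa hgc x),
    oscPdo_eq]
  simp only [oscTransform, compSymbol]
  rw [mul_left_comm, ← integral_const_mul]
  congr 2
  funext η
  rw [integral_const_mul, iterInt]
  ring

lemma fourierConst_sq_mul (n : ℕ) : fourierConst n ^ 2 * (2 * Real.pi) ^ n = 1 := by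
  have h : (((2 * Real.pi) ^ (-(n : ℝ) / 2)) ^ 2 * (2 * Real.pi) ^ n : ℝ) = 1 := by
    have hpi : (0 : ℝ) < 2 * Real.pi := by positivity
    rw [← Real.rpow_natCast, ← Real.rpow_natCast, ← Real.rpow_mul hpi.le, ← Real.rpow_add hpi]
    have : -(n : ℝ) / 2 * (2 : ℕ) + n = 0 := by push_cast; ring
    rw [this, Real.rpow_zero]
  rw [fourierConst]
  exact_mod_cast h

/-- The asymptotic expansion: the Taylor coefficients in `t` are the sums of the terms with
`|α| = k`, and the Taylor remainder has order `ma + mb - N`. For `N = 0` this says that the composed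
symbol has order `ma + mb`. -/
theorem isSymbol_compSymbol_sub (hΦ : IsSymbol 1 Φ) {ma mb : ℝ} (ha : IsSymbol ma a)
    (hb : IsSymbol mb b) (ha_supp : CompactSupportInXi a) (hb_supp : CompactSupportInXi b)
    (N : ℕ) : IsSymbol (ma + mb - N) (fun x η => compSymbol Φ a b x η -
      ∑ k ∈ Finset.range N, ∑ α ∈ Finset.piAntidiag (Finset.univ : Finset (Fin n)) k,
        (1 / (multiFactorial α : ℂ)) * expansionTerm Φ a b α x η) := by
  obtain ⟨Ra, -, hRa⟩ := ha_supp.exists_suppBall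
  obtain ⟨Rb, -, hRb⟩ := hb_supp.exists_suppBall
  obtain ⟨R, hR⟩ := exists_suppBall_ampFun hΦ hRa hRb
  obtain ⟨K, hp⟩ := mem_ampFun hΦ ha hb
  have h1 := SymbolScale.Mem.const_mul symbolScale_isMultiplicative (fourierConst n ^ 2)
    (mem_taylor_remainder (mem_iterInt (mem_dilate hp) hR.dilate) N)
  rw [isSymbol_iff_mem]
  convert h1 using 1
  funext p
  simp only [Function.uncurry, compSymbol, mul_sub, Finset.mul_sum]
  congr 1
  refine Finset.sum_congr rfl fun k _ => ?_
  have hk : (k.factorial : ℂ) ≠ 0 := by exact_mod_cast k.factorial_ne_zero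
  simp only [expansionTerm_eq hp.1]
  rw [iterate_dirD_iterInt hp hR]
  have h2 : ∀ S : ℂ, fourierConst n ^ 2 * (1 / (k.factorial : ℂ) *
      ((2 * Real.pi) ^ n * (k.factorial * S))) = S := by
    intro S
    have h3 := fourierConst_sq_mul n
    field_simp
    linear_combination S * h3
  exact (h2 _).symm

end Composition

end OscSymbol

end

theorem mainTheorem11 (n : ℕ) (ε ma mb : ℝ) (hε : 0 < ε)
    (Φ : EuclideanSpace ℝ (Fin n) → EuclideanSpace ℝ (Fin n) → ℝ)
    (a b : EuclideanSpace ℝ (Fin n) → EuclideanSpace ℝ (Fin n) → ℂ)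
    (hΦ : OscSymbol.IsSymbol (1 - ε) Φ)
    (ha : OscSymbol.IsSymbol ma a) (hb : OscSymbol.IsSymbol mb b)
    (ha_supp : OscSymbol.CompactSupportInXi a) (hb_supp : OscSymbol.CompactSupportInXi b) :
    (∃ d : EuclideanSpace ℝ (Fin n) → EuclideanSpace ℝ (Fin n) → ℂ,
      OscSymbol.IsSymbol (ma + mb) d ∧
      OscSymbol.CompactSupportInXi d ∧
      (∀ u : 𝓢(EuclideanSpace ℝ (Fin n), ℂ),
        (∃ v : 𝓢(EuclideanSpace ℝ (Fin n), ℂ), ⇑v = OscSymbol.oscPdo Φ a u) ∧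
        OscSymbol.pdo b (OscSymbol.oscPdo Φ a u) = OscSymbol.oscPdo Φ d u) ∧
      OscSymbol.HasSymbolExpansion (ma + mb) d (OscSymbol.expansionTerm Φ a b)) ∧
    (∀ α : Fin n → ℕ,
      OscSymbol.IsSymbol (ma + mb - OscSymbol.order α) (OscSymbol.expansionTerm Φ a b α)) ∧
    (∀ x η : EuclideanSpace ℝ (Fin n),
      OscSymbol.expansionTerm Φ a b 0 x η = b x (η + OscSymbol.gradX Φ x η) * a x η) ∧
    (∀ α : Fin n → ℕ, OscSymbol.order α = 1 → ∀ x η : EuclideanSpace ℝ (Fin n),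
      OscSymbol.expansionTerm Φ a b α x η =
        OscSymbol.multiDeriv α (b x) (η + OscSymbol.gradX Φ x η) *
            OscSymbol.multiD α (fun y => a y η) x +
          (∑ k : Fin n,
            OscSymbol.partialDeriv k (OscSymbol.multiDeriv α (b x))
                (η + OscSymbol.gradX Φ x η) *
              ((1 / 2) * OscSymbol.partialDeriv k
                (OscSymbol.multiD α (fun y => (Φ y η : ℂ))) x)) * a x η) := by
  have hΦ1 : OscSymbol.IsSymbol 1 Φ := hΦ.mono (by linarith)
  obtain ⟨Ra, -, hRa⟩ := ha_supp.exists_suppBall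
  refine ⟨⟨OscSymbol.compSymbol Φ a b, ?_, OscSymbol.compactSupportInXi_compSymbol ha_supp,
    fun u => ⟨OscSymbol.exists_schwartz_oscPdo hε hΦ ha hRa u,
      OscSymbol.pdo_oscPdo hε hΦ ha hb ha_supp hb_supp u⟩,
    OscSymbol.isSymbol_compSymbol_sub hΦ1 ha hb ha_supp hb_supp⟩,
    OscSymbol.isSymbol_expansionTerm hΦ1 ha hb, OscSymbol.expansionTerm_zero Φ a b,
    fun α hα x η => OscSymbol.expansionTerm_of_order_eq_one hΦ1 ha.1 hb.1 hα x η⟩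
  simpa using OscSymbol.isSymbol_compSymbol_sub hΦ1 ha hb ha_supp hb_supp 0
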